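/- An infinite time Turing machine (ITTM) has finitely many states, among them distinct start, halt and limit states; three one-way infinite tapes (input, scratch, output) with cells holding $0$ or $1$; and one head that scans the corresponding cells of the three tapes simultaneously. A computation $\varphi_p(x)$ of a program $p$ on input $x\in 2^\omega$ is indexed by ordinal stages. At stage $0$ the machine is in the start state with the head on the first cell, $x$ on the input tape and the other tapes filled with $0$. At successor stages the machine follows its program: according to the state and the three scanned symbols it writes three symbols, moves the head one cell left or right (a left move from the first cell leaves the head in place) and changes state. At limit stages it is in the limit state with the head on the first cell, and every cell shows the $\limsup$ of its earlier values. The computation ends when the halt state is reached; we then write $\varphi_p(x)\downarrow$, and the output is the content of the output tape. The output of $\varphi_p(x)$ stabilizes if from some stage onward the content of the output tape does not change during the computation (in particular, this holds if the computation halts). A cardinal-recognizing infinite time Turing machine (CRITTM) is defined in the same way, except that it has a further special state, the cardinal state, which is entered instead of the limit state at those limit stages that are uncountable cardinals. A set $A\subseteq 2^\omega$ is CRITTM-decidable if there is a CRITTM that halts on every input $x\in 2^\omega$, with output $1000\ldots$ if $x\in A$ and output $0000\ldots$ if $x\notin A$. Fix the coding of ITTM programs as reals (elements of $2^\omega$)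 in which the list of instructions of a program, ordered by state (the start, halt and limit states are numbered $0,1,2$ and the others follow) and then lexicographically by scanned symbols, is written as a finite binary string $b_0\ldots b_{k-1}$ (each instruction being given by its three written symbols, its direction bit ($0$ for left, $1$ for right) and the number of the next state in unary followed by a $0$) and coded by the real $1b_01b_1\ldots1b_{k-1}000\ldots$. Identify a program with its code, and code pairs of reals as reals by $(x,y)\mapsto x_0y_0x_1y_1x_2y_2\ldots$. **Proposition.** The following three sets are CRITTM-decidable, where $p$ ranges over (codes of) ITTM programs and $x$ over $2^\omega$: - the weak halting problem $0^\triangledown=\{p : \varphi_p(0)\downarrow\}$, where $0=000\ldots$; - the strong halting problem $0^\blacktriangledown=\{(p,x) : \varphi_p(x)\downarrow\}$; - the stabilization problem $S=\{(p,x) : \text{the output of }\varphi_p(x)\text{ stabilizes}\}$. -/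

import Mathlib

namespace CRITTM

/-- Elements of Cantor space, called reals: infinite binary sequences. -/
abbrev Cantor : Type := ℕ → Bool

/-- The three tapes of an infinite time Turing machine. -/
inductive Track
  | input
  | scratch
  | output

/-- A single instruction: change to state `next`, write the symbol `write t` on the scanned cell
of each tape `t`, and move the head one cell in the direction `move`. -/
structure Instr (S : Type) where
  next : S
  write : Track → Bool
  move : Turing.Dir

/-- An instruction table: it is consulted with the current state and the three scanned symbols. -/
abbrev Table (S : Type) : Type := S → (Track → Bool) → Instr S

/-- A configuration: the state, the position of the (single) head, and the contents of the three
tapes, each of which is infinite to the right. -/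
structure Config (S : Type) where
  state : S
  head : ℕ
  tape : Track → ℕ → Bool

/-- The next configuration. A head that is told to move left from the first cell stays there
(`0 - 1 = 0` in `ℕ`). -/
def Config.step {S : Type} (δ : Table S) (c : Config S) : Config S where
  state := (δ c.state fun t => c.tape t c.head).next
  head :=
    match (δ c.state fun t => c.tape t c.head).move with
    | Turing.Dir.left => c.head - 1
    | Turing.Dir.right => c.head + 1
  tape t k := if k = c.head then (δ c.state fun t => c.tape t c.head).write t else c.tape t k

/-- A transfinite machine: its instruction table, its start and halting states, and the state
that it enters at each limit stage. Only the two instances `Program.machine` and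
`CProgram.machine` below are used. -/
structure Machine (S : Type) where
  table : Table S
  start : S
  halt : S
  limitState : Ordinal.{0} → S

namespace Machine

variable {S : Type} (M : Machine S)

/-- The initial configuration on input `x`: start state, head on the first cell, `x` on the input
tape, and the other two tapes blank. -/
def init (x : Cantor) : Config S where
  state := M.start
  head := 0
  tape
    | Track.input => x
    | Track.scratch => fun _ => false
    | Track.output => fun _ => false

open Classical in
/-- The configuration at the limit stage `l`, given the configurations at all earlier stages: the
head is on the first cell and every cell shows the limsup of its earlier values, that is, it shows
1 if and only if it showed 1 at unboundedly many stages below `l`. -/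
noncomputable def limitConfig (l : Ordinal.{0}) (prev : ∀ a < l, Config S) : Config S where
  state := M.limitState l
  head := 0
  tape t k := decide (∀ a < l, ∃ b, ∃ hb : b < l, a ≤ b ∧ (prev b hb).tape t k = true)

/-- The configuration at stage `a` of the computation on input `x`. (After the halting state has
been reached the computation is over, and later values of this function play no role.) -/
noncomputable def run (x : Cantor) (a : Ordinal.{0}) : Config S :=
  Ordinal.limitRecOn a (M.init x) (fun _ c => c.step M.table) (fun l _ prev => M.limitConfig l prev)

theorem run_zero (x : Cantor) : M.run x 0 = M.init x :=
  Ordinal.limitRecOn_zero ..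

theorem run_add_one (x : Cantor) (a : Ordinal.{0}) :
    M.run x (a + 1) = (M.run x a).step M.table :=
  Ordinal.limitRecOn_add_one ..

theorem run_limit (x : Cantor) {l : Ordinal.{0}} (hl : Order.IsSuccLimit l) :
    M.run x l = M.limitConfig l (fun a _ => M.run x a) :=
  Ordinal.limitRecOn_limit _ _ _ _ hl

/-- `a` is a stage of the computation on input `x`: the machine has not halted before `a`. -/
def IsStage (x : Cantor) (a : Ordinal.{0}) : Prop :=
  ∀ b < a, (M.run x b).state ≠ M.halt

/-- The computation on input `x` halts at stage `a`. -/
def HaltsAt (x : Cantor) (a : Ordinal.{0}) : Prop :=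
  M.IsStage x a ∧ (M.run x a).state = M.halt

/-- The computation on input `x` halts. -/
def Halts (x : Cantor) : Prop :=
  ∃ a, M.HaltsAt x a

/-- The computation on input `x` halts with output `y`. -/
def HaltsWith (x y : Cantor) : Prop :=
  ∃ a, M.HaltsAt x a ∧ (M.run x a).tape Track.output = y

/-- The output of the computation on input `x` stabilizes: from some stage onward the contents of
the output tape do not change during the computation. -/
def Stabilizes (x : Cantor) : Prop :=
  ∃ a, M.IsStage x a ∧
    ∀ b, a ≤ b → M.IsStage x b → (M.run x b).tape Track.output = (M.run x a).tape Track.output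

end Machine

/-- The states of an infinite time Turing machine: three special states, and further states
indexed by `Q`. -/
inductive IState (Q : Type)
  | start
  | halt
  | limit
  | aux (q : Q)

/-- The states of a cardinal-recognizing machine: there is also a special cardinal state. -/
inductive CState (Q : Type)
  | start
  | halt
  | limit
  | cardinal
  | aux (q : Q)

/-- A program for an (ordinary) infinite time Turing machine, with `n` states other than the
special ones. -/
abbrev Program (n : ℕ) : Type := Table (IState (Fin n))

/-- The computations `φ_p` of an infinite time Turing machine: the limit state is entered at every
limit stage. -/
def Program.machine {n : ℕ} (p : Program n) : Machine (IState (Fin n)) where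
  table := p
  start := IState.start
  halt := IState.halt
  limitState _ := IState.limit

/-- A program for a cardinal-recognizing infinite time Turing machine. -/
abbrev CProgram (Q : Type) : Type := Table (CState Q)

open Classical in
/-- The computations of a cardinal-recognizing infinite time Turing machine: the cardinal state is
entered at the stages that are uncountable cardinals, and the limit state at all other limit
stages. -/
noncomputable def CProgram.machine {Q : Type} (p : CProgram Q) : Machine (CState Q) where
  table := p
  start := CState.start
  halt := CState.halt
  limitState l :=
    if ∃ κ : Cardinal.{0}, Cardinal.aleph0 < κ ∧ κ.ord = l then CState.cardinal else CState.limit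

/-- `f` is CRITTM-computable: some program with finitely many states halts on every input `x` with
output `f x`. -/
def ComputableFun (f : Cantor → Cantor) : Prop :=
  ∃ (Q : Type) (_ : Finite Q) (p : CProgram Q), ∀ x, p.machine.HaltsWith x (f x)

open Classical in
/-- The characteristic function of a set of reals, with the values `1000…` and `0000…`. -/
noncomputable def charFun (A : Set Cantor) (x : Cantor) : Cantor :=
  fun k => decide (k = 0 ∧ x ∈ A)

/-- `A` is CRITTM-decidable: its characteristic function is CRITTM-computable. -/
def DecidableSet (A : Set Cantor) : Prop :=
  ComputableFun (charFun A)

/-- The code `x₀ y₀ x₁ y₁ x₂ y₂ …` of the pair `(x, y)`. -/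
def pair (x y : Cantor) : Cantor :=
  fun k => if k % 2 = 0 then x (k / 2) else y (k / 2)

/-! ### Coding of programs as reals -/

/-- The number of a state in the list `start, halt, limit, aux 0, aux 1, …`. -/
def IState.number {n : ℕ} : IState (Fin n) → ℕ
  | IState.start => 0
  | IState.halt => 1
  | IState.limit => 2
  | IState.aux i => i + 3

/-- All states of a program, in the order of their numbers. -/
def stateList (n : ℕ) : List (IState (Fin n)) :=
  [IState.start, IState.halt, IState.limit] ++ (List.finRange n).map IState.aux

/-- The three scanned symbols, from their values on the input, scratch and output tape. -/
def symbols (i s o : Bool) : Track → Bool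
  | Track.input => i
  | Track.scratch => s
  | Track.output => o

/-- The eight possible triples of scanned symbols, in lexicographic order. -/
def symbolList : List (Track → Bool) :=
  [symbols false false false, symbols false false true,
   symbols false true false, symbols false true true,
   symbols true false false, symbols true false true,
   symbols true true false, symbols true true true]

/-- The code of an instruction: the three symbols to be written, the direction (0 for left, 1 for
right), and the number of the next state in unary, followed by 0. -/
def Instr.bits {n : ℕ} (c : Instr (IState (Fin n))) : List Bool :=
  [c.write Track.input, c.write Track.scratch, c.write Track.output,
    decide (c.move = Turing.Dir.right)] ++ List.replicate c.next.number true ++ [false]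

/-- The list of all instructions of a program, sorted by state and then by scanned symbols. -/
def Program.instrs {n : ℕ} (p : Program n) : List (Instr (IState (Fin n))) :=
  (stateList n).flatMap fun q => symbolList.map fun s => p q s

/-- The instructions of a program, written one after another as a finite binary string. -/
def Program.bits {n : ℕ} (p : Program n) : List Bool :=
  p.instrs.flatMap Instr.bits

/-- The real coding a program whose binary string is `b₀ b₁ … b_{k-1}`:
the sequence `1 b₀ 1 b₁ … 1 b_{k-1} 0 0 0 …`. -/
def Program.code {n : ℕ} (p : Program n) : Cantor :=
  pair (fun k => decide (k < p.bits.length)) (fun k => p.bits.getD k false)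

/-! ### The three problems -/

/-- The weak halting problem for infinite time Turing machines. -/
def weakHalting : Set Cantor :=
  {z | ∃ (n : ℕ) (p : Program n), z = p.code ∧ p.machine.Halts (fun _ => false)}

/-- The strong halting problem for infinite time Turing machines. -/
def strongHalting : Set Cantor :=
  {z | ∃ (n : ℕ) (p : Program n) (x : Cantor), z = pair p.code x ∧ p.machine.Halts x}

/-- The stabilization problem for infinite time Turing machines. -/
def stabilization : Set Cantor :=
  {z | ∃ (n : ℕ) (p : Program n) (x : Cantor), z = pair p.code x ∧ p.machine.Stabilizes x}

/-! ### The coding is faithful: distinct programs have distinct codes -/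

theorem pair_injective {x y x' y' : Cantor} (h : pair x y = pair x' y') : x = x' ∧ y = y' := by
  constructor
  · funext k
    simpa [pair] using congrFun h (2 * k)
  · funext k
    have := congrFun h (2 * k + 1)
    have h1 : (2 * k + 1) / 2 = k := by omega
    have h2 : (2 * k + 1) % 2 = 1 := by omega
    simpa [pair, h1, h2] using this

theorem replicate_append_cancel {a b : ℕ} {u v : List Bool}
    (h : List.replicate a true ++ false :: u = List.replicate b true ++ false :: v) :
    a = b ∧ u = v := by
  induction a generalizing b with
  | zero => cases b <;> simp_all [List.replicate_succ]
  | succ a ih =>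
    cases b with
    | zero => simp_all [List.replicate_succ]
    | succ b =>
      have := @ih b (by simpa [List.replicate_succ] using h)
      exact ⟨by rw [this.1], this.2⟩

/-- The data of an instruction that its code records. -/
def Instr.data {n : ℕ} (c : Instr (IState (Fin n))) : Bool × Bool × Bool × Bool × ℕ :=
  (c.write Track.input, c.write Track.scratch, c.write Track.output,
    decide (c.move = Turing.Dir.right), c.next.number)

theorem Instr.bits_append_cancel {n m : ℕ} {c : Instr (IState (Fin n))}
    {d : Instr (IState (Fin m))} {u v : List Bool} (h : c.bits ++ u = d.bits ++ v) :
    c.data = d.data ∧ u = v := by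
  simp only [Instr.bits, List.cons_append, List.nil_append, List.append_assoc,
    List.cons.injEq] at h
  obtain ⟨h1, h2, h3, h4, h5⟩ := h
  obtain ⟨h6, h7⟩ := replicate_append_cancel h5
  exact ⟨by simp [Instr.data, h1, h2, h3, h4, h6], h7⟩

theorem map_data_eq {n m : ℕ} (l : List (Instr (IState (Fin n))))
    (l' : List (Instr (IState (Fin m)))) (h : l.flatMap Instr.bits = l'.flatMap Instr.bits) :
    l.map Instr.data = l'.map Instr.data := by
  induction l generalizing l' with
  | nil =>
    cases l' with
    | nil => rfl
    | cons d l' => simp [Instr.bits] at h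
  | cons c l ih =>
    cases l' with
    | nil => simp [Instr.bits] at h
    | cons d l' =>
      simp only [List.flatMap_cons] at h
      obtain ⟨h1, h2⟩ := Instr.bits_append_cancel h
      simp [h1, ih l' h2]

theorem IState.number_injective {n : ℕ} {q r : IState (Fin n)} (h : q.number = r.number) :
    q = r := by
  cases q <;> cases r <;> simp_all [IState.number, Fin.ext_iff]

theorem Instr.data_injective {n : ℕ} :
    Function.Injective (Instr.data : Instr (IState (Fin n)) → _) := by
  rintro ⟨q, w, d⟩ ⟨q', w', d'⟩ h
  simp only [Instr.data, Prod.mk.injEq] at h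
  obtain ⟨h1, h2, h3, h4, h5⟩ := h
  have hq := IState.number_injective h5
  have hw : w = w' := by
    funext t
    cases t <;> assumption
  have hd : d = d' := by
    cases d <;> cases d' <;> simp_all
  rw [hq, hw, hd]

theorem mem_stateList {n : ℕ} (q : IState (Fin n)) : q ∈ stateList n := by
  cases q <;> simp [stateList]

theorem mem_symbolList (s : Track → Bool) : s ∈ symbolList := by
  have h : s = symbols (s Track.input) (s Track.scratch) (s Track.output) := by
    funext t
    cases t <;> rfl
  rw [h]
  cases s Track.input <;> cases s Track.scratch <;> cases s Track.output <;> simp [symbolList]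

theorem Program.length_instrs {n : ℕ} (p : Program n) : p.instrs.length = 8 * (n + 3) := by
  simp [Program.instrs, List.length_flatMap, stateList, symbolList, Function.comp_def]
  ring

theorem Program.instrs_injective {n : ℕ} {p q : Program n} (h : p.instrs = q.instrs) : p = q := by
  have key : ∀ L : List (IState (Fin n)),
      (L.flatMap fun a => symbolList.map fun s => p a s) =
        (L.flatMap fun a => symbolList.map fun s => q a s) →
      ∀ a ∈ L, ∀ s ∈ symbolList, p a s = q a s := by
    intro L
    induction L with
    | nil => simp
    | cons b L ih =>
      intro hL a ha
      simp only [List.flatMap_cons] at hL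
      obtain ⟨h1, h2⟩ := List.append_inj hL (by simp)
      rcases List.mem_cons.1 ha with rfl | ha
      · exact List.map_inj_left.1 h1
      · exact ih h2 a ha
  funext a s
  exact key _ h a (mem_stateList a) s (mem_symbolList s)

theorem Program.code_injective {n m : ℕ} {p : Program n} {q : Program m} (h : p.code = q.code) :
    n = m ∧ HEq p q := by
  obtain ⟨h1, h2⟩ := pair_injective h
  have hlen : p.bits.length = q.bits.length := by
    have h3 := congrFun h1 q.bits.length
    have h4 := congrFun h1 p.bits.length
    simp at h3 h4
    omega
  have hbits : p.bits = q.bits := by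
    apply List.ext_getElem hlen
    intro k hk hk'
    have := congrFun h2 k
    simpa [List.getD_eq_getElem?_getD, hk, hk'] using this
  have hdata := map_data_eq _ _ hbits
  have hnm : n = m := by
    have := congrArg List.length hdata
    simp only [List.length_map, Program.length_instrs] at this
    omega
  subst hnm
  exact ⟨rfl, heq_of_eq (Program.instrs_injective (Instr.data_injective.list_map hdata))⟩

end CRITTM

/-!
One cardinal-recognizing machine, with small variations, decides the three problems. It rejects
inputs that do not code a program, and simulates the computation of the coded program stage by
stage. If the simulated computation does not halt before `ω₁`, the machine arrives at stage `ω₁` and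
enters the cardinal state, where the answer can be read off.

*Why `ω₁` is late enough.* A configuration of an ordinary machine at a limit stage is given by
countably many cells. So by a closing-off argument the configuration at `ω₁` already occurs at some
stage `l < ω₁`, after which the cells that are 0 at `ω₁` stay 0 (`exists_run_eq_omega_one`). It
follows that the computation is periodic with period `ω₁` from `l` on (`exists_period`). Therefore a
computation that halts does so before `ω₁` (`lt_omega_one_of_haltsAt`), and the output of one that
does not halt stabilizes if and only if it changes at boundedly many stages below `ω₁`
(`stabilizes_iff`). This is recorded in one cell, which shows after each step whether the output has
just been changed: by the limsup rule its value at `ω₁` tells whether the changes are unbounded.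

*The simulation.* All data are kept on the scratch tape, whose cells are grouped into units with one
cell for each `Field`. Some fields are the program code and the three tapes of the simulated machine.
One step of the simulated machine takes finitely many steps (`runs_simStep`), so `ω` many stages are
simulated by `ω` many stages. In between, every simulated cell shows its old or its new value.
So the simulated cells obey the limsup rule at limits: after `t + ω * b` stages, where `t` is
the stage at which the simulation starts, the memory is that of stage `ω * b` of the simulated
computation (`exists_memory_limit`), except for the marks that keep the positions of the simulated
head and state. At a limit stage, these positions are known anyway. What the limit has left in the
mark fields does no harm: only the first mark counts, and placing a mark clears the cells to its left.
Since `t + ω * ω₁ = ω₁`, the simulation has arrived at stage `ω₁` when the cardinal state is entered.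

*Preparation.* Up to stage `ω` the input is copied to the scratch tape (`copy_limit`). That a real is
of the form `1b₀1b₁…1b_{k-1}000…` is a condition on infinitely many cells, so another `ω` many steps
are spent on it (`cases_scanPhase`); after that the finite string is parsed, and its state numbers are
checked (`cases_checkPhase`). Flags on the scratch tape tell the limit state which phase has ended.

The programs are written in a small structured language (`Code`), which is compiled to instruction
tables. Its terminating and diverging executions (`Exec`, `Diverge`) are related to the stages of the
machine by `haltsAt_of_exec` and `isStage_of_diverge`.
-/

namespace CRITTM

/-! ### A structured programming language for the tapes -/

/-- The contents of the three tapes. -/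
abbrev Tape : Type := Track → ℕ → Bool

/-- The three symbols on the cells in position `h`. -/
def scan (T : Tape) (h : ℕ) : Track → Bool := fun t => T t h

/-- Write the symbols `s` on the cells in position `h`. -/
def putAt (T : Tape) (h : ℕ) (s : Track → Bool) : Tape :=
  fun t k => if k = h then s t else T t k

/-- The position of a head after a move. -/
def moveHead : Turing.Dir → ℕ → ℕ
  | Turing.Dir.left, h => h - 1
  | Turing.Dir.right, h => h + 1

theorem putAt_scan (T : Tape) (h : ℕ) : putAt T h (scan T h) = T := by
  funext t k
  by_cases hk : k = h <;> simp [putAt, scan, hk]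

theorem step_mk {S : Type} (δ : Table S) (s : S) (h : ℕ) (T : Tape) :
    Config.step δ ⟨s, h, T⟩ = ⟨(δ s (scan T h)).next, moveHead (δ s (scan T h)).move h,
      putAt T h (δ s (scan T h)).write⟩ := by
  simp only [Config.step, Config.mk.injEq]
  refine ⟨rfl, ?_, rfl⟩
  change _ = moveHead (δ s fun t => T t h).move h
  cases (δ s fun t => T t h).move <;> rfl

/-- Structured programs for a head on three tapes. `act w d` overwrites the scanned symbols `s` by
`w s` and moves in direction `d`; tests look at the scanned symbols; `halt` ends the whole
computation. -/
inductive Code : Type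
  | act (w : (Track → Bool) → Track → Bool) (d : Turing.Dir)
  | seq (P Q : Code)
  | ite (t : (Track → Bool) → Bool) (P Q : Code)
  | loop (t : (Track → Bool) → Bool) (P : Code)
  | halt

namespace Code

infixr:60 " ;; " => Code.seq

/-- The control points of a program. An instruction of a machine always moves the head, so a test
takes two steps, one to the right and one back to the left; the points `some b` wait for the step
back after a test with result `b`. -/
def Pt : Code → Type
  | act _ _ => Unit
  | seq P Q => Pt P ⊕ Pt Q
  | ite _ P Q => Option Bool ⊕ (Pt P ⊕ Pt Q)
  | loop _ P => Option Bool ⊕ Pt P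
  | halt => Unit

instance finite_pt : ∀ P : Code, Finite P.Pt
  | act _ _ => inferInstanceAs (Finite Unit)
  | seq P Q => by
    have := finite_pt P
    have := finite_pt Q
    exact inferInstanceAs (Finite (P.Pt ⊕ Q.Pt))
  | ite _ P Q => by
    have := finite_pt P
    have := finite_pt Q
    exact inferInstanceAs (Finite (Option Bool ⊕ (P.Pt ⊕ Q.Pt)))
  | loop _ P => by
    have := finite_pt P
    exact inferInstanceAs (Finite (Option Bool ⊕ P.Pt))
  | halt => inferInstanceAs (Finite Unit)

/-- The control point at which the execution of a program begins. -/
def entry : ∀ P : Code, P.Pt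
  | act _ _ => ()
  | seq P _ => Sum.inl P.entry
  | ite _ _ _ => Sum.inl none
  | loop _ _ => Sum.inl none
  | halt => ()

/-- The instruction table of a program whose control points are embedded into the set `S` of states
by `emb`. When the program ends, the state `exit` is entered. -/
def table {S : Type} (hlt : S) : ∀ (P : Code) (_ : P.Pt → S) (_ : S), P.Pt → (Track → Bool) → Instr S
  | act w d, _, exit, _, s => ⟨exit, w s, d⟩
  | seq P Q, emb, _, Sum.inl p, s =>
    P.table hlt (fun p => emb (Sum.inl p)) (emb (Sum.inr Q.entry)) p s
  | seq _ Q, emb, exit, Sum.inr q, s => Q.table hlt (fun q => emb (Sum.inr q)) exit q s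
  | ite t _ _, emb, _, Sum.inl none, s => ⟨emb (Sum.inl (some (t s))), s, Turing.Dir.right⟩
  | ite _ P Q, emb, _, Sum.inl (some b), s =>
    ⟨emb (Sum.inr (if b then Sum.inl P.entry else Sum.inr Q.entry)), s, Turing.Dir.left⟩
  | ite _ P _, emb, exit, Sum.inr (Sum.inl p), s =>
    P.table hlt (fun p => emb (Sum.inr (Sum.inl p))) exit p s
  | ite _ _ Q, emb, exit, Sum.inr (Sum.inr q), s =>
    Q.table hlt (fun q => emb (Sum.inr (Sum.inr q))) exit q s
  | loop t _, emb, _, Sum.inl none, s => ⟨emb (Sum.inl (some (t s))), s, Turing.Dir.right⟩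
  | loop _ P, emb, exit, Sum.inl (some b), s =>
    ⟨if b then emb (Sum.inr P.entry) else exit, s, Turing.Dir.left⟩
  | loop _ P, emb, _, Sum.inr p, s =>
    P.table hlt (fun p => emb (Sum.inr p)) (emb (Sum.inl none)) p s
  | halt, _, _, _, s => ⟨hlt, s, Turing.Dir.right⟩

/-- The table `δ` executes the program `P` on the states in the range of `emb`. -/
structure Embeds {S : Type} (δ : Table S) (hlt : S) (P : Code) (emb : P.Pt → S) (exit : S) :
    Prop where
  table_eq : ∀ p s, δ (emb p) s = P.table hlt emb exit p s
  ne_halt : ∀ p, emb p ≠ hlt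

end Code

open Code

/-- `Exec I P h T o h' T'`: started with the head on position `h` and tapes `T`, the program `P`
takes the head to `h'` and the tapes to `T'`, either by running to its end (if `o` is `false`) or by
halting (if `o` is `true`), and the contents of the tapes have the property `I` all along. -/
inductive Exec (I : Tape → Prop) : Code → ℕ → Tape → Bool → ℕ → Tape → Prop
  | act {w d h T} : I T → Exec I (act w d) h T false (moveHead d h) (putAt T h (w (scan T h)))
  | seq {P Q h T h₁ T₁ o h₂ T₂} :
    Exec I P h T false h₁ T₁ → Exec I Q h₁ T₁ o h₂ T₂ → Exec I (P ;; Q) h T o h₂ T₂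
  | seqHalt {P Q h T h₁ T₁} : Exec I P h T true h₁ T₁ → Exec I (P ;; Q) h T true h₁ T₁
  | iteTrue {t P Q h T o h₁ T₁} :
    I T → t (scan T h) = true → Exec I P h T o h₁ T₁ → Exec I (ite t P Q) h T o h₁ T₁
  | iteFalse {t P Q h T o h₁ T₁} :
    I T → t (scan T h) = false → Exec I Q h T o h₁ T₁ → Exec I (ite t P Q) h T o h₁ T₁
  | loopDone {t P h T} : I T → t (scan T h) = false → Exec I (loop t P) h T false h T
  | loopStep {t P h T h₁ T₁ o h₂ T₂} : I T → t (scan T h) = true →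
    Exec I P h T false h₁ T₁ → Exec I (loop t P) h₁ T₁ o h₂ T₂ → Exec I (loop t P) h T o h₂ T₂
  | loopHalt {t P h T h₁ T₁} : I T → t (scan T h) = true →
    Exec I P h T true h₁ T₁ → Exec I (loop t P) h T true h₁ T₁
  | halt {h T} : I T → Exec I halt h T true (h + 1) T

/-- `Diverge I c P h T`: started with the head on position `h` and tapes `T`, the program `P`
reaches a loop that it repeats forever. The tapes show `c i` at the beginning of round `i` of this
loop; they have the property `I (i + 1)` during round `i`, and `I 0` before the loop is reached. -/
inductive Diverge (I : ℕ → Tape → Prop) (c : ℕ → Tape) : Code → ℕ → Tape → Prop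
  | loop {t P} (h : ℕ → ℕ) : (∀ i, I (i + 1) (c i)) → (∀ i, t (scan (c i) (h i)) = true) →
    (∀ i, Exec (I (i + 1)) P (h i) (c i) false (h (i + 1)) (c (i + 1))) →
    Diverge I c (loop t P) (h 0) (c 0)
  | seqLeft {P Q h T} : Diverge I c P h T → Diverge I c (P ;; Q) h T
  | seqRight {P Q h T h₁ T₁} :
    Exec (I 0) P h T false h₁ T₁ → Diverge I c Q h₁ T₁ → Diverge I c (P ;; Q) h T
  | iteTrue {t P Q h T} :
    I 0 T → t (scan T h) = true → Diverge I c P h T → Diverge I c (ite t P Q) h T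
  | iteFalse {t P Q h T} :
    I 0 T → t (scan T h) = false → Diverge I c Q h T → Diverge I c (ite t P Q) h T

/-- `Path δ hlt I n a b`: in `n` steps, the table `δ` leads from the configuration `a` to `b`, and
before `b`, the state `hlt` is not entered and the tapes have the property `I`. -/
inductive Path {S : Type} (δ : Table S) (hlt : S) (I : Tape → Prop) :
    ℕ → Config S → Config S → Prop
  | nil (a) : Path δ hlt I 0 a a
  | cons {n a b} : a.state ≠ hlt → I a.tape → Path δ hlt I n (a.step δ) b → Path δ hlt I (n + 1) a b

namespace Path

variable {S : Type} {δ : Table S} {hlt : S} {I : Tape → Prop}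

theorem trans {n m : ℕ} {a b c : Config S} (h : Path δ hlt I n a b) (h' : Path δ hlt I m b c) :
    Path δ hlt I (n + m) a c := by
  induction h with
  | nil => simpa using h'
  | @cons n a b h1 h2 _ ih =>
    rw [Nat.add_right_comm]
    exact cons h1 h2 (ih h')

theorem iterate_eq {n : ℕ} {a b : Config S} (h : Path δ hlt I n a b) :
    (Config.step δ)^[n] a = b := by
  induction h with
  | nil => rfl
  | cons _ _ _ ih => exact ih

theorem before {n : ℕ} {a b : Config S} (h : Path δ hlt I n a b) :
    ∀ i < n, ((Config.step δ)^[i] a).state ≠ hlt ∧ I ((Config.step δ)^[i] a).tape := by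
  induction h with
  | nil => simp
  | cons h1 h2 _ ih =>
    rintro (_ | i) hi
    · exact ⟨h1, h2⟩
    · exact ih i (by omega)

end Path

section Compile

variable {S : Type} {δ : Table S} {hlt : S}

theorem Code.Embeds.seqLeft {P Q : Code} {emb : (P ;; Q).Pt → S} {exit : S}
    (h : Embeds δ hlt (P ;; Q) emb exit) :
    Embeds δ hlt P (fun p => emb (Sum.inl p)) (emb (Sum.inr Q.entry)) :=
  ⟨fun p s => h.table_eq (Sum.inl p) s, fun _ => h.ne_halt _⟩

theorem Code.Embeds.seqRight {P Q : Code} {emb : (P ;; Q).Pt → S} {exit : S}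
    (h : Embeds δ hlt (P ;; Q) emb exit) :
    Embeds δ hlt Q (fun p => emb (Sum.inr p)) exit :=
  ⟨fun p s => h.table_eq (Sum.inr p) s, fun _ => h.ne_halt _⟩

theorem Code.Embeds.iteLeft {t} {P Q : Code} {emb : (ite t P Q).Pt → S} {exit : S}
    (h : Embeds δ hlt (ite t P Q) emb exit) :
    Embeds δ hlt P (fun p => emb (Sum.inr (Sum.inl p))) exit :=
  ⟨fun p s => h.table_eq (Sum.inr (Sum.inl p)) s, fun _ => h.ne_halt _⟩

theorem Code.Embeds.iteRight {t} {P Q : Code} {emb : (ite t P Q).Pt → S} {exit : S}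
    (h : Embeds δ hlt (ite t P Q) emb exit) :
    Embeds δ hlt Q (fun p => emb (Sum.inr (Sum.inr p))) exit :=
  ⟨fun p s => h.table_eq (Sum.inr (Sum.inr p)) s, fun _ => h.ne_halt _⟩

theorem Code.Embeds.loopBody {t} {P : Code} {emb : (loop t P).Pt → S} {exit : S}
    (h : Embeds δ hlt (loop t P) emb exit) :
    Embeds δ hlt P (fun p => emb (Sum.inr p)) (emb (Sum.inl none)) :=
  ⟨fun p s => h.table_eq (Sum.inr p) s, fun _ => h.ne_halt _⟩

theorem Path.keep {I : Tape → Prop} {s s' : S} {d : Turing.Dir} {h : ℕ} {T : Tape} (hs : s ≠ hlt)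
    (hI : I T) (hδ : δ s (scan T h) = ⟨s', scan T h, d⟩) :
    Path δ hlt I 1 ⟨s, h, T⟩ ⟨s', moveHead d h, T⟩ := by
  refine .cons hs hI ?_
  rw [step_mk, hδ]
  simp only [putAt_scan]
  exact .nil _

theorem Path.ite_test {I : Tape → Prop} {t} {P Q : Code} {emb : (ite t P Q).Pt → S} {exit : S}
    (he : Embeds δ hlt (ite t P Q) emb exit) (h : ℕ) {T : Tape} (hI : I T) :
    Path δ hlt I 2 ⟨emb (ite t P Q).entry, h, T⟩ ⟨emb (Sum.inr
      (if t (scan T h) = true then Sum.inl P.entry else Sum.inr Q.entry)), h, T⟩ :=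
  (Path.keep (he.ne_halt _) hI (he.table_eq (Sum.inl none) _)).trans
    (Path.keep (he.ne_halt _) hI (he.table_eq (Sum.inl (some (t (scan T h)))) _))

theorem Path.loop_test {I : Tape → Prop} {t} {P : Code} {emb : (loop t P).Pt → S} {exit : S}
    (he : Embeds δ hlt (loop t P) emb exit) (h : ℕ) {T : Tape} (hI : I T) :
    Path δ hlt I 2 ⟨emb (loop t P).entry, h, T⟩
      ⟨if t (scan T h) = true then emb (Sum.inr P.entry) else exit, h, T⟩ :=
  (Path.keep (he.ne_halt _) hI (he.table_eq (Sum.inl none) _)).trans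
    (Path.keep (he.ne_halt _) hI (he.table_eq (Sum.inl (some (t (scan T h)))) _))

/-- Compiled programs do what `Exec` says. -/
theorem Exec.path {I : Tape → Prop} {P : Code} {h : ℕ} {T : Tape} {o : Bool} {h' : ℕ} {T' : Tape}
    (hx : Exec I P h T o h' T') : ∀ {emb : P.Pt → S} {exit : S}, Embeds δ hlt P emb exit →
    ∃ n, 0 < n ∧ Path δ hlt I n ⟨emb P.entry, h, T⟩ ⟨if o = true then hlt else exit, h', T'⟩ := by
  induction hx with
  | act hI =>
    intro emb exit he
    refine ⟨1, one_pos, .cons (he.ne_halt _) hI ?_⟩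
    rw [step_mk, he.table_eq]
    exact .nil _
  | seq _ _ ih1 ih2 =>
    intro emb exit he
    obtain ⟨n, hn, p⟩ := ih1 he.seqLeft
    obtain ⟨m, _, q⟩ := ih2 he.seqRight
    exact ⟨n + m, by omega, p.trans q⟩
  | seqHalt _ ih =>
    intro emb exit he
    exact ih he.seqLeft
  | @iteTrue _ _ _ h _ _ _ _ hI ht _ ih =>
    intro emb exit he
    obtain ⟨n, hn, p⟩ := ih he.iteLeft
    have := Path.ite_test he h hI
    rw [if_pos ht] at this
    exact ⟨2 + n, by omega, this.trans p⟩
  | @iteFalse _ _ _ h _ _ _ _ hI ht _ ih =>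
    intro emb exit he
    obtain ⟨n, hn, p⟩ := ih he.iteRight
    have := Path.ite_test he h hI
    rw [if_neg (by simp [ht])] at this
    exact ⟨2 + n, by omega, this.trans p⟩
  | @loopDone _ _ h _ hI ht =>
    intro emb exit he
    have := Path.loop_test he h hI
    rw [if_neg (by simp [ht])] at this
    exact ⟨2, by omega, this⟩
  | @loopStep _ _ h _ _ _ _ _ _ hI ht _ _ ih1 ih2 =>
    intro emb exit he
    obtain ⟨n, hn, p⟩ := ih1 he.loopBody
    obtain ⟨m, hm, q⟩ := ih2 he
    have := Path.loop_test he h hI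
    rw [if_pos ht] at this
    exact ⟨2 + n + m, by omega, (this.trans p).trans q⟩
  | @loopHalt _ _ h _ _ _ hI ht _ ih =>
    intro emb exit he
    obtain ⟨n, hn, p⟩ := ih he.loopBody
    have := Path.loop_test he h hI
    rw [if_pos ht] at this
    exact ⟨2 + n, by omega, this.trans p⟩
  | halt hI =>
    intro emb exit he
    refine ⟨1, one_pos, .cons (he.ne_halt _) hI ?_⟩
    rw [step_mk, he.table_eq]
    simp only [Code.table, moveHead, putAt_scan]
    exact .nil _

/-- In the run from the configuration `a`, a loop begins its rounds at the steps
`n 1 ≤ n 2 < n 3 < …`, as described for `Diverge`. -/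
structure Milestones (δ : Table S) (hlt : S) (I : ℕ → Tape → Prop) (c : ℕ → Tape) (a : Config S)
    (n : ℕ → ℕ) : Prop where
  zero : n 0 = 0
  mono : Monotone n
  lt : ∀ i, n (i + 1) < n (i + 2)
  tape : ∀ i, ((Config.step δ)^[n (i + 1)] a).tape = c i
  between : ∀ i k, n i ≤ k → k < n (i + 1) →
    ((Config.step δ)^[k] a).state ≠ hlt ∧ I i ((Config.step δ)^[k] a).tape

theorem Milestones.prepend {I : ℕ → Tape → Prop} {c : ℕ → Tape} {a b : Config S} {n : ℕ → ℕ}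
    {m : ℕ} (hm : Milestones δ hlt I c b n) (p : Path δ hlt (I 0) m a b) :
    ∃ n', Milestones δ hlt I c a n' := by
  have key : ∀ k, (Config.step δ)^[k + m] a = (Config.step δ)^[k] b := fun k => by
    rw [Function.iterate_add_apply, p.iterate_eq]
  refine ⟨fun i => if i = 0 then 0 else n i + m, rfl, ?_, ?_, ?_, ?_⟩
  · refine monotone_nat_of_le_succ fun i => ?_
    have := hm.mono (Nat.le_succ i)
    rcases Nat.eq_zero_or_pos i with rfl | h
    · simp
    · simp only [Nat.succ_eq_add_one] at this
      simp [h.ne', this]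
  · intro i
    simpa using hm.lt i
  · intro i
    simp only [Nat.add_eq_zero_iff, one_ne_zero, and_false, if_false, key]
    exact hm.tape i
  · intro i k h1 h2
    by_cases hk : k < m
    · have : i = 0 := by
        by_contra h
        simp only [h, if_false] at h1
        omega
      subst this
      exact p.before k hk
    · obtain ⟨k, rfl⟩ : ∃ k', k = k' + m := ⟨k - m, by omega⟩
      rw [key]
      refine hm.between i k ?_ (by simpa using h2)
      rcases Nat.eq_zero_or_pos i with rfl | h
      · simp [hm.zero]
      · simpa [h.ne'] using h1

/-- Compiled programs do what `Diverge` says. -/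
theorem Diverge.milestones {I : ℕ → Tape → Prop} {c : ℕ → Tape} {P : Code} {h : ℕ} {T : Tape}
    (hx : Diverge I c P h T) : ∀ {emb : P.Pt → S} {exit : S}, Embeds δ hlt P emb exit →
    ∃ n, Milestones δ hlt I c ⟨emb P.entry, h, T⟩ n := by
  induction hx with
  | @loop t P h hI ht hx =>
    intro emb exit he
    have round : ∀ i, ∃ n, 0 < n ∧ Path δ hlt (I (i + 1)) n
        ⟨emb (Code.loop t P).entry, h i, c i⟩ ⟨emb (Code.loop t P).entry, h (i + 1), c (i + 1)⟩ := by
      intro i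
      obtain ⟨n, hn, p⟩ := (hx i).path he.loopBody
      have := Path.loop_test he (h i) (hI i)
      rw [if_pos (ht i)] at this
      exact ⟨2 + n, by omega, this.trans p⟩
    choose r hr p using round
    set n : ℕ → ℕ := fun i => ∑ j ∈ Finset.range (i - 1), r j with hn
    have hn' : ∀ i, n (i + 2) = n (i + 1) + r i := fun i => by
      simp [hn, Finset.sum_range_succ]
    have hit : ∀ i, (Config.step δ)^[n (i + 1)] ⟨emb (Code.loop t P).entry, h 0, c 0⟩ =
        ⟨emb (Code.loop t P).entry, h i, c i⟩ := by
      intro i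
      induction i with
      | zero => rfl
      | succ i ih => rw [hn', add_comm, Function.iterate_add_apply, ih, (p i).iterate_eq]
    refine ⟨n, rfl, ?_, ?_, fun i => by rw [hit], ?_⟩
    · refine monotone_nat_of_le_succ fun i => ?_
      rcases i with _ | i
      · simp [hn]
      · rw [hn']
        omega
    · intro i
      rw [hn']
      have := hr i
      omega
    · intro i k h1 h2
      rcases i with _ | i
      · simp [hn] at h2
      · obtain ⟨k, rfl⟩ : ∃ k', k = k' + n (i + 1) := ⟨k - n (i + 1), by omega⟩
        rw [Function.iterate_add_apply, hit]
        rw [hn'] at h2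
        exact (p i).before k (by omega)
  | seqLeft _ ih =>
    intro emb exit he
    exact ih he.seqLeft
  | seqRight hp _ ih =>
    intro emb exit he
    obtain ⟨m, _, p⟩ := hp.path he.seqLeft
    obtain ⟨n, hn⟩ := ih he.seqRight
    exact hn.prepend p
  | @iteTrue _ _ _ h _ hI ht _ ih =>
    intro emb exit he
    obtain ⟨n, hn⟩ := ih he.iteLeft
    have := Path.ite_test he h hI
    rw [if_pos ht] at this
    exact hn.prepend this
  | @iteFalse _ _ _ h _ hI ht _ ih =>
    intro emb exit he
    obtain ⟨n, hn⟩ := ih he.iteRight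
    have := Path.ite_test he h hI
    rw [if_neg (by simp [ht])] at this
    exact hn.prepend this

end Compile

/-! ### Machines assembled from programs for the start, limit and cardinal states -/

theorem tape_limit {S : Type} (M : Machine S) (x : Cantor) {l : Ordinal.{0}}
    (hl : Order.IsSuccLimit l) (t : Track) (k : ℕ) :
    (M.run x l).tape t k = true ↔ ∀ a < l, ∃ b < l, a ≤ b ∧ (M.run x b).tape t k = true := by
  rw [M.run_limit x hl]
  simp only [Machine.limitConfig, decide_eq_true_eq]
  exact ⟨fun h a ha => let ⟨b, hb, h1, h2⟩ := h a ha; ⟨b, hb, h1, h2⟩,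
    fun h a ha => let ⟨b, hb, h1, h2⟩ := h a ha; ⟨b, hb, h1, h2⟩⟩

theorem run_limit_eq {S : Type} (M : Machine S) (x : Cantor) {l : Ordinal.{0}}
    (hl : Order.IsSuccLimit l) :
    M.run x l = ⟨M.limitState l, 0, (M.run x l).tape⟩ := by
  rw [M.run_limit x hl]
  rfl

theorem run_add_nat {S : Type} (M : Machine S) (x : Cantor) (a : Ordinal.{0}) (n : ℕ) :
    M.run x (a + n) = (Config.step M.table)^[n] (M.run x a) := by
  induction n with
  | zero => simp
  | succ n ih =>
    rw [Nat.cast_succ, ← add_assoc, M.run_add_one, ih, Function.iterate_succ_apply']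

theorem isSuccLimit_add_omega (a : Ordinal.{0}) : Order.IsSuccLimit (a + Ordinal.omega0) :=
  Ordinal.isSuccLimit_add _ Ordinal.isSuccLimit_omega0

theorem exists_of_lt_add_omega {a b : Ordinal.{0}} (hb : b < a + Ordinal.omega0) :
    b < a ∨ ∃ n : ℕ, b = a + n := by
  rcases lt_or_ge b a with h | h
  · exact Or.inl h
  · obtain ⟨c, rfl⟩ := exists_add_of_le h
    obtain ⟨n, rfl⟩ := Ordinal.lt_omega0.1 ((add_lt_add_iff_left a).1 hb)
    exact Or.inr ⟨n, rfl⟩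

theorem tape_add_omega {S : Type} (M : Machine S) (x : Cantor) (a : Ordinal.{0}) (t : Track)
    (k : ℕ) : (M.run x (a + Ordinal.omega0)).tape t k = true ↔
      ∀ N : ℕ, ∃ n : ℕ, N ≤ n ∧ (M.run x (a + n)).tape t k = true := by
  rw [tape_limit M x (isSuccLimit_add_omega a)]
  constructor
  · intro h N
    obtain ⟨b, hb, h1, h2⟩ :=
      h (a + N) ((add_lt_add_iff_left a).2 (Ordinal.natCast_lt_omega0 N))
    rcases exists_of_lt_add_omega hb with h3 | ⟨n, rfl⟩
    · exact absurd (lt_of_le_of_lt h1 h3) (not_lt.2 (le_self_add))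
    · exact ⟨n, by simpa using h1, h2⟩
  · intro h b hb
    rcases exists_of_lt_add_omega hb with h3 | ⟨N, rfl⟩
    · obtain ⟨n, _, h2⟩ := h 0
      exact ⟨a + n, (add_lt_add_iff_left a).2 (Ordinal.natCast_lt_omega0 n),
        h3.le.trans (le_self_add), h2⟩
    · obtain ⟨n, h1, h2⟩ := h N
      exact ⟨a + n, (add_lt_add_iff_left a).2 (Ordinal.natCast_lt_omega0 n),
        by simpa using h1, h2⟩

/-- The cardinal-recognizing machine that runs the program `A` from the start state, `B` from the
limit state and `C` from the cardinal state. It halts when one of them ends. -/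
def assemble (A B C : Code) : CProgram (A.Pt ⊕ (B.Pt ⊕ C.Pt))
  | CState.start => A.table CState.halt (fun p => CState.aux (Sum.inl p)) CState.halt A.entry
  | CState.halt => fun s => ⟨CState.halt, s, Turing.Dir.right⟩
  | CState.limit =>
    B.table CState.halt (fun p => CState.aux (Sum.inr (Sum.inl p))) CState.halt B.entry
  | CState.cardinal =>
    C.table CState.halt (fun p => CState.aux (Sum.inr (Sum.inr p))) CState.halt C.entry
  | CState.aux (Sum.inl p) => A.table CState.halt (fun p => CState.aux (Sum.inl p)) CState.halt p
  | CState.aux (Sum.inr (Sum.inl p)) =>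
    B.table CState.halt (fun p => CState.aux (Sum.inr (Sum.inl p))) CState.halt p
  | CState.aux (Sum.inr (Sum.inr p)) =>
    C.table CState.halt (fun p => CState.aux (Sum.inr (Sum.inr p))) CState.halt p

/-- In the state `s`, the table `δ` starts the program `P`. -/
def Starts {S : Type} (δ : Table S) (hlt : S) (P : Code) (s : S) : Prop :=
  s ≠ hlt ∧ ∃ emb : P.Pt → S, Embeds δ hlt P emb hlt ∧ δ s = δ (emb P.entry)

theorem starts_start (A B C : Code) : Starts (assemble A B C) CState.halt A CState.start :=
  ⟨by simp, fun p => CState.aux (Sum.inl p), ⟨fun _ _ => rfl, by simp⟩, rfl⟩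

theorem starts_limit (A B C : Code) : Starts (assemble A B C) CState.halt B CState.limit :=
  ⟨by simp, fun p => CState.aux (Sum.inr (Sum.inl p)), ⟨fun _ _ => rfl, by simp⟩, rfl⟩

theorem starts_cardinal (A B C : Code) : Starts (assemble A B C) CState.halt C CState.cardinal :=
  ⟨by simp, fun p => CState.aux (Sum.inr (Sum.inr p)), ⟨fun _ _ => rfl, by simp⟩, rfl⟩

theorem iterate_congr_state {S : Type} {δ : Table S} {s s' : S} (hs : δ s' = δ s) (h : ℕ)
    (T : Tape) {n : ℕ} (hn : 0 < n) :
    (Config.step δ)^[n] ⟨s', h, T⟩ = (Config.step δ)^[n] ⟨s, h, T⟩ := by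
  obtain ⟨n, rfl⟩ := Nat.exists_eq_succ_of_ne_zero hn.ne'
  rw [Function.iterate_succ_apply, Function.iterate_succ_apply, step_mk, step_mk, hs]

theorem isStage_of_le {S : Type} {M : Machine S} {x : Cantor} {a b : Ordinal.{0}}
    (h : M.IsStage x b) (hab : a ≤ b) : M.IsStage x a :=
  fun c hc => h c (hc.trans_le hab)

theorem isStage_add_nat {S : Type} {M : Machine S} {x : Cantor} {a : Ordinal.{0}} {n : ℕ}
    (h : M.IsStage x a) (hn : ∀ i < n, (M.run x (a + i)).state ≠ M.halt) :
    M.IsStage x (a + n) := by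
  intro b hb
  rcases exists_of_lt_add_omega (hb.trans ((add_lt_add_iff_left a).2
    (Ordinal.natCast_lt_omega0 n))) with h1 | ⟨i, rfl⟩
  · exact h b h1
  · exact hn i (by simpa using hb)

theorem isStage_add_omega {S : Type} {M : Machine S} {x : Cantor} {a : Ordinal.{0}}
    (h : M.IsStage x a) (hn : ∀ i : ℕ, (M.run x (a + i)).state ≠ M.halt) :
    M.IsStage x (a + Ordinal.omega0) := by
  intro b hb
  rcases exists_of_lt_add_omega hb with h1 | ⟨i, rfl⟩
  · exact h b h1
  · exact hn i

/-- A program that halts, or runs to its end, makes the machine halt. -/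
theorem haltsAt_of_exec {S : Type} {M : Machine S} {x : Cantor} {a : Ordinal.{0}} {P : Code} {s : S}
    {I : Tape → Prop} {h : ℕ} {T : Tape} {o : Bool} {h' : ℕ} {T' : Tape}
    (ha : M.IsStage x a) (hs : Starts M.table M.halt P s) (hr : M.run x a = ⟨s, h, T⟩)
    (hx : Exec I P h T o h' T') :
    ∃ n : ℕ, M.HaltsAt x (a + n) ∧ (M.run x (a + n)).tape = T' := by
  obtain ⟨hne, emb, he, heq⟩ := hs
  obtain ⟨n, hn, p⟩ := hx.path he
  have key : ∀ i : ℕ, 0 < i →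
      M.run x (a + i) = (Config.step M.table)^[i] ⟨emb P.entry, h, T⟩ := fun i hi => by
    rw [run_add_nat, hr, iterate_congr_state heq _ _ hi]
  refine ⟨n, ⟨isStage_add_nat ha fun i hi => ?_, ?_⟩, ?_⟩
  · rcases Nat.eq_zero_or_pos i with rfl | h0
    · simpa [hr] using hne
    · rw [key i h0]
      exact (p.before i hi).1
  · rw [key n hn, p.iterate_eq]
    simp
  · rw [key n hn, p.iterate_eq]

/-- The sequence `f` of tapes passes through the rounds of a loop, as described for `Diverge`. -/
structure Rounds (f : ℕ → Tape) (I : ℕ → Tape → Prop) (c : ℕ → Tape) (n : ℕ → ℕ) : Prop where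
  zero : n 0 = 0
  mono : Monotone n
  lt : ∀ i, n (i + 1) < n (i + 2)
  tape : ∀ i, f (n (i + 1)) = c i
  between : ∀ i k, n i ≤ k → k < n (i + 1) → I i (f k)

theorem Rounds.add_le {f : ℕ → Tape} {I : ℕ → Tape → Prop} {c : ℕ → Tape} {n : ℕ → ℕ}
    (h : Rounds f I c n) (i : ℕ) : i ≤ n (i + 1) := by
  induction i with
  | zero => exact Nat.zero_le _
  | succ i ih =>
    have : n (i + 1) < n (i + 1 + 1) := h.lt i
    omega

theorem Rounds.exists_round {f : ℕ → Tape} {I : ℕ → Tape → Prop} {c : ℕ → Tape} {n : ℕ → ℕ}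
    (h : Rounds f I c n) (k : ℕ) : ∃ i, n i ≤ k ∧ k < n (i + 1) := by
  have hex : ∃ i, k < n (i + 1) := ⟨k + 1, lt_of_lt_of_le (Nat.lt_succ_self k) (h.add_le _)⟩
  classical
  refine ⟨Nat.find hex, ?_, Nat.find_spec hex⟩
  by_contra hlt
  rcases h0 : Nat.find hex with _ | j
  · rw [h0, h.zero] at hlt
    omega
  · rw [h0] at hlt
    exact Nat.find_min hex (m := j) (by omega) (by omega)

/-- From the beginning of round `i` on, the tapes have one of the properties of the later rounds. -/
theorem Rounds.eventually {f : ℕ → Tape} {I : ℕ → Tape → Prop} {c : ℕ → Tape} {n : ℕ → ℕ}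
    (h : Rounds f I c n) (i k : ℕ) (hk : n i ≤ k) : ∃ j, i ≤ j ∧ I j (f k) := by
  obtain ⟨j, h1, h2⟩ := h.exists_round k
  refine ⟨j, ?_, h.between j k h1 h2⟩
  by_contra hlt
  have := h.mono (show j + 1 ≤ i by omega)
  omega

/-- While a diverging program runs, the machine does not halt. -/
theorem isStage_of_diverge {S : Type} {M : Machine S} {x : Cantor} {a : Ordinal.{0}} {P : Code}
    {s : S} {I : ℕ → Tape → Prop} {c : ℕ → Tape} {h : ℕ} {T : Tape}
    (ha : M.IsStage x a) (hs : Starts M.table M.halt P s) (hr : M.run x a = ⟨s, h, T⟩)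
    (hx : Diverge I c P h T) :
    M.IsStage x (a + Ordinal.omega0) ∧
      ∃ n, Rounds (fun k => (M.run x (a + k)).tape) I c n := by
  obtain ⟨hne, emb, he, heq⟩ := hs
  obtain ⟨n, hn⟩ := hx.milestones he
  have key : ∀ i : ℕ, 0 < i →
      M.run x (a + i) = (Config.step M.table)^[i] ⟨emb P.entry, h, T⟩ := fun i hi => by
    rw [run_add_nat, hr, iterate_congr_state heq _ _ hi]
  have key' : ∀ i : ℕ,
      (M.run x (a + i)).tape = ((Config.step M.table)^[i] ⟨emb P.entry, h, T⟩).tape := by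
    intro i
    rcases Nat.eq_zero_or_pos i with rfl | h0
    · simp [hr]
    · rw [key i h0]
  have hR : Rounds (fun k => (M.run x (a + k)).tape) I c n :=
    ⟨hn.zero, hn.mono, hn.lt, fun i => by rw [key', hn.tape],
      fun i k h1 h2 => by rw [key']; exact (hn.between i k h1 h2).2⟩
  refine ⟨isStage_add_omega ha fun i => ?_, n, hR⟩
  rcases Nat.eq_zero_or_pos i with rfl | h0
  · simpa [hr] using hne
  · obtain ⟨j, h1, h2⟩ := hR.exists_round i
    rw [key i h0]
    exact (hn.between j i h1 h2).1

/-- The limit of a diverging run whose tapes converge. -/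
theorem tape_add_omega_of_rounds {S : Type} {M : Machine S} {x : Cantor} {a : Ordinal.{0}}
    {I : ℕ → Tape → Prop} {c : ℕ → Tape} {n : ℕ → ℕ}
    (h : Rounds (fun k => (M.run x (a + k)).tape) I c n) (L : Tape)
    (hL : ∀ t k, ∃ i, ∀ j, i ≤ j → ∀ T, I j T → T t k = L t k) :
    (M.run x (a + Ordinal.omega0)).tape = L := by
  funext t k
  obtain ⟨i, hi⟩ := hL t k
  have hev : ∀ m, n i ≤ m → (M.run x (a + m)).tape t k = L t k := by
    intro m hm
    obtain ⟨j, h1, h2⟩ := h.eventually i m hm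
    exact hi j h1 _ h2
  rw [Bool.eq_iff_iff, tape_add_omega]
  constructor
  · intro h0
    obtain ⟨m, h1, h2⟩ := h0 (n i)
    rwa [hev m h1] at h2
  · intro h0 N
    exact ⟨max N (n i), le_max_left _ _, by rw [hev _ (le_max_right _ _), h0]⟩

open Cardinal Ordinal in
theorem limitState_of_lt {Q : Type} (p : CProgram Q) {l : Ordinal.{0}} (hl : l < ω₁) :
    p.machine.limitState l = CState.limit := by
  simp only [CProgram.machine]
  rw [if_neg]
  rintro ⟨κ, hκ, rfl⟩
  rw [← ord_aleph, ord_lt_ord] at hl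
  have : ℵ₁ ≤ κ := by
    rw [← succ_aleph0]
    exact Order.succ_le_of_lt hκ
  exact absurd hl (not_lt.2 this)

open Cardinal Ordinal in
theorem limitState_omega1 {Q : Type} (p : CProgram Q) :
    p.machine.limitState ω₁ = CState.cardinal := by
  simp only [CProgram.machine]
  rw [if_pos]
  exact ⟨ℵ₁, aleph0_lt_aleph_one, by rw [ord_aleph]⟩


/-! ### A memory with named fields on the scratch tape -/

/-- The scratch tape is divided into units of 12 cells, and the cells of a unit are called its
fields. The fields `simInput`, `simScratch` and `simOutput` of unit `k` hold the cells `k` of the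
tapes of a simulated machine, the field `code` holds the `k`-th bit of the code of its program. The
field `left` is 1 in unit 0 only. The fields `copied`, `scanned`, `checked` and `changed` are used
in unit 0 only, and are flags; the last three fields hold marks. -/
inductive Field
  | left
  | copied
  | scanned
  | checked
  | code
  | simInput
  | simScratch
  | simOutput
  | changed
  | markA
  | markP
  | markH
  deriving DecidableEq

namespace Field

/-- The position of a field in its unit. -/
def off : Field → ℕ
  | left => 0
  | copied => 1
  | scanned => 2
  | checked => 3
  | code => 4
  | simInput => 5
  | simScratch => 6
  | simOutput => 7
  | changed => 8
  | markA => 9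
  | markP => 10
  | markH => 11

/-- The field at a given position of the unit. -/
def at' : ℕ → Field
  | 0 => left
  | 1 => copied
  | 2 => scanned
  | 3 => checked
  | 4 => code
  | 5 => simInput
  | 6 => simScratch
  | 7 => simOutput
  | 8 => changed
  | 9 => markA
  | 10 => markP
  | _ => markH

theorem off_lt (v : Field) : v.off < 12 := by
  cases v <;> simp [off]

theorem at'_off (v : Field) : at' v.off = v := by
  cases v <;> rfl

theorem off_at' {n : ℕ} (hn : n < 12) : (at' n).off = n := by
  interval_cases n <;> rfl

/-- The fields that hold marks. -/
def isMark : Field → Bool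
  | markA => true
  | markP => true
  | markH => true
  | _ => false

/-- The field for the cells of a tape of the simulated machine. -/
def sim : Track → Field
  | Track.input => simInput
  | Track.scratch => simScratch
  | Track.output => simOutput

end Field

/-- The contents of all fields of all units. -/
abbrev Memory : Type := Field → ℕ → Bool

/-- The tapes that represent a memory, where `z` is the content of the input tape, and the output
tape is blank. -/
def tapeOf (z : Cantor) (m : Memory) : Tape
  | Track.input => z
  | Track.scratch => fun n => m (Field.at' (n % 12)) (n / 12)
  | Track.output => fun _ => false

/-- The memory represented by the tapes. -/
def memOf (T : Tape) : Memory := fun v k => T Track.scratch (12 * k + v.off)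

/-- The memory without its marks. -/
def core (m : Memory) : Memory := fun v => if v.isMark then fun _ => false else m v

theorem tapeOf_scratch (z : Cantor) (m : Memory) (v : Field) (k : ℕ) :
    tapeOf z m Track.scratch (12 * k + v.off) = m v k := by
  have h := v.off_lt
  have h1 : (12 * k + v.off) % 12 = v.off := by omega
  have h2 : (12 * k + v.off) / 12 = k := by omega
  simp only [tapeOf, h1, h2, Field.at'_off]

@[simp]
theorem memOf_tapeOf (z : Cantor) (m : Memory) : memOf (tapeOf z m) = m := by
  funext v k
  exact tapeOf_scratch z m v k

@[simp]
theorem core_update_mark (m : Memory) {v : Field} (hv : v.isMark = true) (f : ℕ → Bool) :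
    core (Function.update m v f) = core m := by
  funext w
  by_cases hw : w = v
  · subst hw
    simp [core, hv]
  · simp [core, hw]

theorem core_update (m : Memory) {v : Field} (hv : v.isMark = false) (f : ℕ → Bool) :
    core (Function.update m v f) = Function.update (core m) v f := by
  funext w
  by_cases hw : w = v
  · subst hw
    simp [core, hv]
  · simp [core, hw]

theorem core_apply (m : Memory) {v : Field} (hv : v.isMark = false) : core m v = m v := by
  simp [core, hv]

theorem eq_of_core_eq {m m' : Memory} (h : core m = core m') {v : Field} (hv : v.isMark = false) :
    m v = m' v := by
  rw [← core_apply m hv, h, core_apply m' hv]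

/-- The property of tapes that they represent a memory which, apart from its marks, satisfies `K`. -/
def coreInv (z : Cantor) (K : Memory → Prop) : Tape → Prop :=
  fun T => T = tapeOf z (memOf T) ∧ K (core (memOf T))

theorem putAt_scratch (z : Cantor) (m : Memory) (v : Field) (k : ℕ) (b : Bool)
    (w : (Track → Bool) → Track → Bool)
    (hw : ∀ s, w s Track.input = s Track.input ∧ w s Track.scratch = b ∧
      w s Track.output = s Track.output) :
    putAt (tapeOf z m) (12 * k + v.off) (w (scan (tapeOf z m) (12 * k + v.off))) =
      tapeOf z (Function.update m v (Function.update (m v) k b)) := by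
  have hoff := v.off_lt
  funext t n
  have h := hw (scan (tapeOf z m) (12 * k + v.off))
  by_cases hn : n = 12 * k + v.off
  · subst hn
    rw [putAt, if_pos rfl]
    cases t with
    | input => exact h.1
    | scratch => rw [h.2.1, tapeOf_scratch]; simp
    | output => exact h.2.2
  · rw [putAt, if_neg hn]
    cases t with
    | input => rfl
    | output => rfl
    | scratch =>
      simp only [tapeOf]
      by_cases hv : Field.at' (n % 12) = v
      · have h1 : n % 12 = v.off := by rw [← hv, Field.off_at' (by omega)]
        have h2 : n / 12 ≠ k := by omega
        simp [hv, h2]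
      · rw [Function.update_of_ne hv]

namespace Code

/-- Move one cell without writing. -/
def go (d : Turing.Dir) : Code := act (fun s => s) d

/-- Do nothing. -/
def stay : Code := go Turing.Dir.right ;; go Turing.Dir.left

/-- Repeat a program. -/
def rep (P : Code) : ℕ → Code
  | 0 => stay
  | n + 1 => P ;; rep P n

/-- Write on the scratch tape. -/
def setScratch (b : Bool) (s : Track → Bool) : Track → Bool
  | Track.input => s Track.input
  | Track.scratch => b
  | Track.output => s Track.output

/-- Write on the output tape. -/
def setOutput (b : Bool) (s : Track → Bool) : Track → Bool
  | Track.input => s Track.input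
  | Track.scratch => s Track.scratch
  | Track.output => b

/-- Go to the next unit. -/
def right : Code := rep (go Turing.Dir.right) 12

/-- Go to the previous unit. -/
def left : Code := rep (go Turing.Dir.left) 12

/-- Write into a field of the current unit. -/
def set (v : Field) (b : Bool) : Code :=
  rep (go Turing.Dir.right) v.off ;; act (setScratch b) Turing.Dir.right ;;
    rep (go Turing.Dir.left) (v.off + 1)

/-- Branch on a field of the current unit. -/
def onBit (v : Field) (P : Bool → Code) : Code :=
  rep (go Turing.Dir.right) v.off ;;
    ite (fun s => s Track.scratch) (rep (go Turing.Dir.left) v.off ;; P true)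
      (rep (go Turing.Dir.left) v.off ;; P false)

/-- Repeat a program as long as a field of the current unit has the value `b`. -/
def whileBit (v : Field) (b : Bool) (P : Code) : Code :=
  rep (go Turing.Dir.right) v.off ;;
    loop (fun s => s Track.scratch == b)
      (rep (go Turing.Dir.left) v.off ;; P ;; rep (go Turing.Dir.right) v.off) ;;
    rep (go Turing.Dir.left) v.off

end Code

section Exec

variable {I : Tape → Prop}

theorem exec_stay (h : ℕ) {T : Tape} (hI : I T) : Exec I stay h T false h T := by
  have h1 : Exec I (go Turing.Dir.right) h T false (h + 1) T := by
    simpa [moveHead, putAt_scan, go] using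
      Exec.act (I := I) (w := fun s => s) (d := Turing.Dir.right) (h := h) hI
  have h2 : Exec I (go Turing.Dir.left) (h + 1) T false h T := by
    simpa [moveHead, putAt_scan, go] using
      Exec.act (I := I) (w := fun s => s) (d := Turing.Dir.left) (h := h + 1) hI
  exact h1.seq h2

theorem exec_rep_right (n h : ℕ) {T : Tape} (hI : I T) :
    Exec I (rep (go Turing.Dir.right) n) h T false (h + n) T := by
  induction n generalizing h with
  | zero => exact exec_stay h hI
  | succ n ih =>
    have h1 : Exec I (go Turing.Dir.right) h T false (h + 1) T := by
      simpa [moveHead, putAt_scan, go] using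
        Exec.act (I := I) (w := fun s => s) (d := Turing.Dir.right) (h := h) hI
    have := h1.seq (ih (h + 1))
    rwa [add_assoc, add_comm 1 n] at this

theorem exec_rep_left (n h : ℕ) {T : Tape} (hI : I T) :
    Exec I (rep (go Turing.Dir.left) n) h T false (h - n) T := by
  induction n generalizing h with
  | zero => exact exec_stay h hI
  | succ n ih =>
    have h1 : Exec I (go Turing.Dir.left) h T false (h - 1) T := by
      simpa [moveHead, putAt_scan, go] using
        Exec.act (I := I) (w := fun s => s) (d := Turing.Dir.left) (h := h) hI
    have := h1.seq (ih (h - 1))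
    rwa [Nat.sub_sub, add_comm 1 n] at this

theorem exec_rep_back (n h : ℕ) {T : Tape} (hI : I T) :
    Exec I (rep (go Turing.Dir.left) n) (h + n) T false h T := by
  simpa using exec_rep_left n (h + n) hI

theorem Exec.inv_start {P : Code} {h : ℕ} {T : Tape} {o : Bool} {h' : ℕ} {T' : Tape}
    (hx : Exec I P h T o h' T') : I T := by
  induction hx with
  | seq _ _ ih _ => exact ih
  | seqHalt _ ih => exact ih
  | _ => assumption

theorem Exec.mono {J : Tape → Prop} (hJ : ∀ T, I T → J T) {P : Code} {h : ℕ} {T : Tape} {o : Bool}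
    {h' : ℕ} {T' : Tape} (hx : Exec I P h T o h' T') : Exec J P h T o h' T' := by
  induction hx with
  | act hI => exact .act (hJ _ hI)
  | seq _ _ ih1 ih2 => exact .seq ih1 ih2
  | seqHalt _ ih => exact .seqHalt ih
  | iteTrue hI ht _ ih => exact .iteTrue (hJ _ hI) ht ih
  | iteFalse hI ht _ ih => exact .iteFalse (hJ _ hI) ht ih
  | loopDone hI ht => exact .loopDone (hJ _ hI) ht
  | loopStep hI ht _ _ ih1 ih2 => exact .loopStep (hJ _ hI) ht ih1 ih2
  | loopHalt hI ht _ ih => exact .loopHalt (hJ _ hI) ht ih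
  | halt hI => exact .halt (hJ _ hI)

theorem Diverge.mono {I J : ℕ → Tape → Prop} (hJ : ∀ i T, I i T → J i T) {c : ℕ → Tape} {P : Code}
    {h : ℕ} {T : Tape} (hd : Diverge I c P h T) : Diverge J c P h T := by
  induction hd with
  | loop h h1 h2 h3 =>
    exact .loop h (fun i => hJ _ _ (h1 i)) h2 fun i => Exec.mono (hJ _) (h3 i)
  | seqLeft _ ih => exact .seqLeft ih
  | seqRight h1 _ ih => exact .seqRight (Exec.mono (hJ _) h1) ih
  | iteTrue h1 h2 _ ih => exact .iteTrue (hJ _ _ h1) h2 ih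
  | iteFalse h1 h2 _ ih => exact .iteFalse (hJ _ _ h1) h2 ih

theorem exec_onBit {v : Field} {P : Bool → Code} {h : ℕ} {T : Tape} {o : Bool} {h' : ℕ} {T' : Tape}
    (hx : Exec I (P (T Track.scratch (h + v.off))) h T o h' T') :
    Exec I (onBit v P) h T o h' T' := by
  have hI := hx.inv_start
  refine (exec_rep_right v.off h hI).seq ?_
  cases hb : T Track.scratch (h + v.off) with
  | true =>
    rw [hb] at hx
    exact .iteTrue hI hb ((exec_rep_back v.off h hI).seq hx)
  | false =>
    rw [hb] at hx
    exact .iteFalse hI hb ((exec_rep_back v.off h hI).seq hx)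

theorem diverge_onBit {I : ℕ → Tape → Prop} {c : ℕ → Tape} {v : Field} {P : Bool → Code} {h : ℕ}
    {T : Tape} (hI : I 0 T) (hx : Diverge I c (P (T Track.scratch (h + v.off))) h T) :
    Diverge I c (onBit v P) h T := by
  refine .seqRight (exec_rep_right v.off h hI) ?_
  cases hb : T Track.scratch (h + v.off) with
  | true =>
    rw [hb] at hx
    exact .iteTrue hI hb (.seqRight (exec_rep_back v.off h hI) hx)
  | false =>
    rw [hb] at hx
    exact .iteFalse hI hb (.seqRight (exec_rep_back v.off h hI) hx)

/-- The execution of the loop `whileBit v b P` from a moment at which its test is due. -/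
def WhileExec (I : Tape → Prop) (v : Field) (b : Bool) (P : Code) (h : ℕ) (T : Tape) (o : Bool)
    (h' : ℕ) (T' : Tape) : Prop :=
  Exec I (loop (fun s => s Track.scratch == b)
    (rep (go Turing.Dir.left) v.off ;; P ;; rep (go Turing.Dir.right) v.off)) (h + v.off) T o
    (if o = true then h' else h' + v.off) T'

theorem WhileExec.done {v : Field} {b : Bool} {P : Code} {h : ℕ} {T : Tape} (hI : I T)
    (hb : T Track.scratch (h + v.off) ≠ b) : WhileExec I v b P h T false h T :=
  .loopDone hI (by simpa [scan] using hb)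

theorem WhileExec.step {v : Field} {b : Bool} {P : Code} {h : ℕ} {T : Tape} {h₁ : ℕ} {T₁ : Tape}
    {o : Bool} {h' : ℕ} {T' : Tape} (hb : T Track.scratch (h + v.off) = b)
    (h1 : Exec I P h T false h₁ T₁) (h2 : WhileExec I v b P h₁ T₁ o h' T') :
    WhileExec I v b P h T o h' T' :=
  have hI := h1.inv_start
  .loopStep hI (by simpa [scan] using hb)
    ((exec_rep_back v.off h hI).seq (h1.seq (exec_rep_right v.off h₁ h2.inv_start))) h2

theorem WhileExec.halt {v : Field} {b : Bool} {P : Code} {h : ℕ} {T : Tape} {h' : ℕ} {T' : Tape}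
    (hb : T Track.scratch (h + v.off) = b) (h1 : Exec I P h T true h' T') :
    WhileExec I v b P h T true h' T' :=
  have hI := h1.inv_start
  .loopHalt hI (by simpa [scan] using hb) ((exec_rep_back v.off h hI).seq h1.seqHalt)

theorem WhileExec.exec {v : Field} {b : Bool} {P : Code} {h : ℕ} {T : Tape} {o : Bool} {h' : ℕ}
    {T' : Tape} (hx : WhileExec I v b P h T o h' T') (hI : o = false → I T') :
    Exec I (whileBit v b P) h T o h' T' := by
  refine (exec_rep_right v.off h hx.inv_start).seq ?_
  cases o with
  | true => exact Exec.seqHalt hx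
  | false => exact Exec.seq hx (exec_rep_back v.off h' (hI rfl))

theorem diverge_whileBit {I : ℕ → Tape → Prop} {v : Field} {b : Bool} {P : Code} (h : ℕ → ℕ)
    (c : ℕ → Tape) (h0 : I 0 (c 0)) (hI : ∀ i, I (i + 1) (c (i + 1)))
    (hb : ∀ i, c i Track.scratch (h i + v.off) = b)
    (hx : ∀ i, Exec (I (i + 1)) P (h i) (c i) false (h (i + 1)) (c (i + 1))) :
    Diverge I c (whileBit v b P) (h 0) (c 0) := by
  refine .seqRight (exec_rep_right v.off (h 0) h0) (.seqLeft (.loop (fun i => h i + v.off)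
    (fun i => (hx i).inv_start) (fun i => by simpa [scan] using hb i) fun i => ?_))
  exact (exec_rep_back v.off (h i) (hx i).inv_start).seq
    ((hx i).seq (exec_rep_right v.off (h (i + 1)) (hI i)))

end Exec

/-! ### Programs for the memory -/

/-- The program `P` runs to its end; it takes the head from unit `k` to unit `k'` and the memory
from `m` to `m'`. On the way the memory satisfies `K`, apart from its marks. -/
def Runs (z : Cantor) (K : Memory → Prop) (P : Code) (k : ℕ) (m : Memory) (k' : ℕ) (m' : Memory) :
    Prop :=
  Exec (coreInv z K) P (12 * k) (tapeOf z m) false (12 * k') (tapeOf z m')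

/-- Started with the head on unit `k` and memory `m`, the program `P` halts with the answer `b`. -/
def Stops (z : Cantor) (P : Code) (k : ℕ) (m : Memory) (b : Bool) : Prop :=
  ∃ h' T', Exec (fun _ => True) P (12 * k) (tapeOf z m) true h' T' ∧
    T' Track.output = fun n => decide (n = 0 ∧ b = true)

section Runs

variable {z : Cantor} {K : Memory → Prop} {P Q : Code} {k k' k₁ : ℕ} {m m' m₁ : Memory} {b : Bool}

theorem coreInv_tapeOf : coreInv z K (tapeOf z m) ↔ K (core m) := by
  simp [coreInv]

theorem Runs.exec (h : Runs z K P k m k' m') :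
    Exec (fun _ => True) P (12 * k) (tapeOf z m) false (12 * k') (tapeOf z m') :=
  Exec.mono (fun _ _ => trivial) h

theorem Runs.seq (h : Runs z K P k m k₁ m₁) (h' : Runs z K Q k₁ m₁ k' m') :
    Runs z K (P ;; Q) k m k' m' :=
  Exec.seq h h'

theorem Runs.seqStops (h : Runs z K P k m k₁ m₁) (h' : Stops z Q k₁ m₁ b) :
    Stops z (P ;; Q) k m b :=
  let ⟨h₁, T₁, h1, h2⟩ := h'
  ⟨h₁, T₁, Exec.seq h.exec h1, h2⟩

theorem Stops.seq (h : Stops z P k m b) : Stops z (P ;; Q) k m b :=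
  let ⟨h₁, T₁, h1, h2⟩ := h
  ⟨h₁, T₁, Exec.seqHalt h1, h2⟩

theorem stops_halt : Stops z halt k m false :=
  ⟨_, _, .halt trivial, by simp [tapeOf]⟩

theorem runs_stay (hK : K (core m)) : Runs z K stay k m k m :=
  exec_stay _ (coreInv_tapeOf.2 hK)

theorem runs_right (hK : K (core m)) : Runs z K right k m (k + 1) m :=
  exec_rep_right 12 (12 * k) (coreInv_tapeOf.2 hK)

theorem runs_left (hK : K (core m)) : Runs z K left k m (k - 1) m := by
  have := exec_rep_left (I := coreInv z K) (T := tapeOf z m) 12 (12 * k) (coreInv_tapeOf.2 hK)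
  rwa [show 12 * k - 12 = 12 * (k - 1) by omega] at this

theorem runs_set (v : Field) (b : Bool) (hK : K (core m))
    (hK' : K (core (Function.update m v (Function.update (m v) k b)))) :
    Runs z K (set v b) k m k (Function.update m v (Function.update (m v) k b)) := by
  refine (exec_rep_right v.off (12 * k) (coreInv_tapeOf.2 hK)).seq ?_
  have h1 := Exec.act (I := coreInv z K) (w := setScratch b) (d := Turing.Dir.right)
    (h := 12 * k + v.off) (T := tapeOf z m) (coreInv_tapeOf.2 hK)
  rw [putAt_scratch z m v k b (setScratch b) fun s => ⟨rfl, rfl, rfl⟩] at h1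
  exact h1.seq (exec_rep_back (v.off + 1) (12 * k) (coreInv_tapeOf.2 hK'))

theorem runs_onBit {v : Field} {P : Bool → Code} (h : Runs z K (P (m v k)) k m k' m') :
    Runs z K (onBit v P) k m k' m' := by
  refine exec_onBit ?_
  rwa [tapeOf_scratch]

theorem stops_onBit {v : Field} {P : Bool → Code} (h : Stops z (P (m v k)) k m b) :
    Stops z (onBit v P) k m b := by
  obtain ⟨h₁, T₁, h1, h2⟩ := h
  refine ⟨h₁, T₁, exec_onBit ?_, h2⟩
  rwa [tapeOf_scratch]

/-- The execution of a loop that runs to its end, from a moment at which its test is due. -/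
def WhileRuns (z : Cantor) (K : Memory → Prop) (v : Field) (b : Bool) (P : Code) (k : ℕ)
    (m : Memory) (k' : ℕ) (m' : Memory) : Prop :=
  K (core m') ∧ WhileExec (coreInv z K) v b P (12 * k) (tapeOf z m) false (12 * k') (tapeOf z m')

/-- The execution of a loop in which the machine halts with the answer `a`, from a moment at which
the test of the loop is due. -/
def WhileStops (z : Cantor) (v : Field) (b : Bool) (P : Code) (k : ℕ)
    (m : Memory) (a : Bool) : Prop :=
  ∃ h' T', WhileExec (fun _ => True) v b P (12 * k) (tapeOf z m) true h' T' ∧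
    T' Track.output = fun n => decide (n = 0 ∧ a = true)

variable {v : Field} {a : Bool}

theorem WhileRuns.done (hK : K (core m)) (hb : m v k ≠ b) : WhileRuns z K v b P k m k m :=
  ⟨hK, .done (coreInv_tapeOf.2 hK) (by rwa [tapeOf_scratch])⟩

theorem WhileRuns.step (hb : m v k = b) (h1 : Runs z K P k m k₁ m₁)
    (h2 : WhileRuns z K v b P k₁ m₁ k' m') : WhileRuns z K v b P k m k' m' :=
  ⟨h2.1, .step (by rwa [tapeOf_scratch]) h1 h2.2⟩

theorem WhileRuns.runs (h : WhileRuns z K v b P k m k' m') :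
    Runs z K (whileBit v b P) k m k' m' :=
  h.2.exec fun _ => coreInv_tapeOf.2 h.1

theorem WhileStops.halt (hb : m v k = b) (h : Stops z P k m a) : WhileStops z v b P k m a :=
  let ⟨h₁, T₁, h1, h2⟩ := h
  ⟨h₁, T₁, .halt (by rwa [tapeOf_scratch]) h1, h2⟩

theorem WhileStops.step (hb : m v k = b) (h1 : Runs z K P k m k₁ m₁)
    (h2 : WhileStops z v b P k₁ m₁ a) : WhileStops z v b P k m a :=
  let ⟨h₁, T₁, h3, h4⟩ := h2
  ⟨h₁, T₁, .step (by rwa [tapeOf_scratch]) h1.exec h3, h4⟩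

theorem WhileStops.stops (h : WhileStops z v b P k m a) : Stops z (whileBit v b P) k m a :=
  let ⟨h₁, T₁, h1, h2⟩ := h
  ⟨h₁, T₁, h1.exec (by simp), h2⟩

/-- A loop that is repeated forever, on the level of the memory. -/
theorem diverge_whileBit_tapeOf {K : ℕ → Memory → Prop} (k : ℕ → ℕ) (m : ℕ → Memory)
    (h0 : K 0 (core (m 0))) (hb : ∀ i, m i v (k i) = b)
    (hx : ∀ i, Runs z (K (i + 1)) P (k i) (m i) (k (i + 1)) (m (i + 1)))
    (hK : ∀ i, K (i + 1) (core (m (i + 1)))) :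
    Diverge (fun i => coreInv z (K i)) (fun i => tapeOf z (m i)) (whileBit v b P) (12 * k 0)
      (tapeOf z (m 0)) :=
  diverge_whileBit (I := fun i => coreInv z (K i)) (fun i => 12 * k i) (fun i => tapeOf z (m i))
    (coreInv_tapeOf.2 h0) (fun i => coreInv_tapeOf.2 (hK i))
    (fun i => by rw [tapeOf_scratch, hb]) hx

/-- In the field `left`, exactly unit 0 is marked. -/
def LeftOK (m : Memory) : Prop := m Field.left = fun j => decide (j = 0)

theorem LeftOK.congr (h : LeftOK m) (hm : core m' = core m) : LeftOK m' := by
  rw [LeftOK, eq_of_core_eq hm rfl]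
  exact h

/-- The first mark is in unit `k`. Marks further to the right are ignored. -/
def FirstMark (f : ℕ → Bool) (k : ℕ) : Prop := f k = true ∧ ∀ j < k, f j = false

namespace Code

/-- Go to unit 0. -/
def home : Code := whileBit Field.left false Code.left

/-- Go to the first mark. -/
def find (v : Field) : Code := home ;; whileBit v false Code.right

/-- Make the current unit the first marked one, and go to unit 0. -/
def place (v : Field) : Code :=
  set v true ;; whileBit Field.left false (Code.left ;; set v false)

end Code

theorem runs_home (hK : K (core m)) (hL : LeftOK m) (k : ℕ) : Runs z K home k m 0 m := by
  refine WhileRuns.runs ?_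
  induction k with
  | zero => exact .done hK (by rw [hL]; simp)
  | succ k ih => exact .step (by rw [hL]; simp) (runs_left hK) ih

theorem runs_search (hK : K (core m)) {v : Field} {k' : ℕ} (h1 : m v k' = true) (n k : ℕ)
    (hk : k + n = k') (h2 : ∀ j, k ≤ j → j < k' → m v j = false) :
    Runs z K (whileBit v false right) k m k' m := by
  refine WhileRuns.runs ?_
  induction n generalizing k with
  | zero =>
    obtain rfl : k = k' := hk
    exact .done hK (by simp [h1])
  | succ n ih =>
    exact .step (h2 k le_rfl (by omega)) (runs_right hK)
      (ih (k + 1) (by omega) fun j hj => h2 j (by omega))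

theorem runs_find (hK : K (core m)) (hL : LeftOK m) {v : Field} {k' : ℕ} (hm : FirstMark (m v) k')
    (k : ℕ) : Runs z K (find v) k m k' m :=
  (runs_home hK hL k).seq (runs_search hK hm.1 k' 0 (by omega) fun j _ => hm.2 j)

theorem runs_place (hK : K (core m)) (hL : LeftOK m) {v : Field} (hv : v.isMark = true) (k : ℕ) :
    ∃ f, FirstMark f k ∧ Runs z K (place v) k m 0 (Function.update m v f) := by
  have hne : v ≠ Field.left := by
    rintro rfl
    simp [Field.isMark] at hv
  have hs : ∀ f : ℕ → Bool, K (core (Function.update m v f)) := fun f => by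
    rwa [core_update_mark m hv]
  have key : ∀ (j : ℕ) (f : ℕ → Bool), ∃ g, (∀ i < j, g i = false) ∧ (∀ i, j ≤ i → g i = f i) ∧
      WhileRuns z K Field.left false (Code.left ;; set v false) j (Function.update m v f) 0
        (Function.update m v g) := by
    intro j
    induction j with
    | zero =>
      intro f
      refine ⟨f, by simp, by simp, .done (hs f) ?_⟩
      rw [Function.update_of_ne hne.symm, hL]
      simp
    | succ j ih =>
      intro f
      obtain ⟨g, h1, h2, h3⟩ := ih (Function.update f j false)
      refine ⟨g, fun i hi => ?_, fun i hi => ?_, .step ?_ ?_ h3⟩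
      · rcases Nat.lt_succ_iff_lt_or_eq.1 hi with h | rfl
        · exact h1 i h
        · rw [h2 i le_rfl]
          simp
      · rw [h2 i (by omega), Function.update_of_ne (by omega)]
      · rw [Function.update_of_ne hne.symm, hL]
        simp
      · have := runs_set (z := z) (K := K) (m := Function.update m v f) (k := j) v false (hs f)
        simp only [Function.update_self, Function.update_idem] at this
        exact (runs_left (hs f)).seq (this (hs _))
  obtain ⟨g, h1, h2, h3⟩ := key k (Function.update (m v) k true)
  exact ⟨g, ⟨by rw [h2 k le_rfl]; simp, h1⟩, (runs_set v true hK (hs _)).seq h3.runs⟩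

end Runs

/-! ### Parsing the code of a program -/

/-- The code of an instruction whose next state is given by its number. -/
def rawBits (c : Instr ℕ) : List Bool :=
  [c.write Track.input, c.write Track.scratch, c.write Track.output,
    decide (c.move = Turing.Dir.right)] ++ List.replicate c.next true ++ [false]

/-- The list `l` is written in the code `c` of a program, from place `j` on. -/
def ListAt (c : Cantor) : ℕ → List Bool → Prop
  | _, [] => True
  | j, b :: l => c (2 * j) = true ∧ c (2 * j + 1) = b ∧ ListAt c (j + 1) l

/-- From place `j` on, the code `c` of a program is blank. -/
def BlankFrom (c : Cantor) (j : ℕ) : Prop := ∀ i, j ≤ i → c (2 * i) = false ∧ c (2 * i + 1) = false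

theorem listAt_append {c : Cantor} {j : ℕ} {l l' : List Bool} :
    ListAt c j (l ++ l') ↔ ListAt c j l ∧ ListAt c (j + l.length) l' := by
  induction l generalizing j with
  | nil => simp [ListAt]
  | cons b l ih =>
    simp only [List.cons_append, ListAt, ih, List.length_cons, and_assoc]
    rw [show j + 1 + l.length = j + (l.length + 1) by omega]

theorem ListAt.mark {c : Cantor} {j : ℕ} {l : List Bool} (h : ListAt c j l) {i : ℕ}
    (hi : i < l.length) : c (2 * (j + i)) = true := by
  induction l generalizing j i with
  | nil => simp at hi
  | cons b l ih =>
    rcases i with _ | i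
    · exact h.1
    · have := ih h.2.2 (i := i) (by simpa using hi)
      rwa [show j + 1 + i = j + (i + 1) by omega] at this

namespace Code

/-- Go to the next place of the code of the program; a place consists of two units. -/
def next : Code := right ;; right

/-- Halt if the current place of the code of the program is blank. -/
def expect : Code := onBit Field.code fun b => if b then stay else halt

/-- Go over the code of one instruction, and halt if the code of the program ends before. -/
def skipInstr : Code :=
  rep (expect ;; next) 4 ;; right ;; whileBit Field.code true next ;; left ;; expect ;; next

/-- Go over the instructions for one state. -/
def skipGroup : Code := rep skipInstr 8

end Code

section Parse

variable {z : Cantor} {K : Memory → Prop} {m : Memory}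

theorem runs_next (hK : K (core m)) (j : ℕ) : Runs z K next (2 * j) m (2 * (j + 1)) m :=
  (runs_right hK).seq (runs_right hK)

theorem runs_next' (hK : K (core m)) (j : ℕ) :
    Runs z K next (2 * j + 1) m (2 * (j + 1) + 1) m :=
  (runs_right hK).seq (runs_right hK)

theorem runs_expect (hK : K (core m)) {k : ℕ} (h : m Field.code k = true) :
    Runs z K expect k m k m := by
  refine runs_onBit ?_
  rw [h]
  exact runs_stay hK

theorem stops_expect {k : ℕ} (h : m Field.code k = false) :
    Stops z expect k m false := by
  refine stops_onBit ?_
  rw [h]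
  exact stops_halt

theorem runs_expects (hK : K (core m)) {j n : ℕ} {l : List Bool} (hl : ListAt (m Field.code) j l)
    (hn : n ≤ l.length) : Runs z K (rep (expect ;; next) n) (2 * j) m (2 * (j + n)) m := by
  induction n generalizing j l with
  | zero => exact runs_stay hK
  | succ n ih =>
    rcases l with _ | ⟨b, l⟩
    · simp at hn
    · have := ((runs_expect hK hl.1).seq (runs_next hK j)).seq (ih hl.2.2 (by simpa using hn))
      rwa [show j + 1 + n = j + (n + 1) by omega] at this

theorem stops_expects (hK : K (core m)) {j n : ℕ} {l : List Bool} (hl : ListAt (m Field.code) j l)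
    (hb : BlankFrom (m Field.code) (j + l.length)) (hn : l.length < n) :
    Stops z (rep (expect ;; next) n) (2 * j) m false := by
  induction n generalizing j l with
  | zero => simp at hn
  | succ n ih =>
    rcases l with _ | ⟨b, l⟩
    · exact ((stops_expect (hb j (by simp)).1).seq).seq
    · exact ((runs_expect hK hl.1).seq (runs_next hK j)).seqStops
        (ih hl.2.2 (by rwa [show j + 1 + l.length = j + (b :: l).length by simp; omega])
          (by simpa using hn))

/-- In the numeral of a next state, the program goes to the end of its ones. -/
theorem runs_ones (hK : K (core m)) {j q : ℕ} (hl : ListAt (m Field.code) j (List.replicate q true))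
    (h0 : m Field.code (2 * (j + q) + 1) = false) :
    Runs z K (whileBit Field.code true next) (2 * j + 1) m (2 * (j + q) + 1) m := by
  refine WhileRuns.runs ?_
  induction q generalizing j with
  | zero => exact .done hK (by simpa using h0)
  | succ q ih =>
    have := ih hl.2.2 (by rwa [show j + 1 + q = j + (q + 1) by omega])
    rw [show j + 1 + q = j + (q + 1) by omega] at this
    exact .step hl.2.1 (runs_next' hK j) this

theorem runs_skipInstr (hK : K (core m)) {j : ℕ} {r : Instr ℕ} {l : List Bool}
    (hl : ListAt (m Field.code) j (rawBits r ++ l)) :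
    Runs z K skipInstr (2 * j) m (2 * (j + (rawBits r).length)) m := by
  have h4 : ListAt (m Field.code) (j + 4) (List.replicate r.next true ++ (false :: l)) := by
    have : rawBits r ++ l = [r.write Track.input, r.write Track.scratch, r.write Track.output,
      decide (r.move = Turing.Dir.right)] ++ (List.replicate r.next true ++ (false :: l)) := by
      simp [rawBits]
    rw [this] at hl
    exact (listAt_append.1 hl).2
  obtain ⟨h5, h6⟩ := listAt_append.1 h4
  simp only [List.length_replicate, ListAt] at h6
  have hlen : j + (rawBits r).length = j + 4 + r.next + 1 := by
    simp [rawBits]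
    omega
  rw [hlen]
  exact (runs_expects hK hl (by simp [rawBits])).seq ((runs_right hK).seq
    ((runs_ones hK h5 h6.2.1).seq ((runs_left hK).seq ((runs_expect hK h6.1).seq
      (runs_next hK _)))))

theorem exists_ones (l : List Bool) :
    ∃ q, l = List.replicate q true ∨ ∃ l', l = List.replicate q true ++ false :: l' := by
  induction l with
  | nil => exact ⟨0, Or.inl rfl⟩
  | cons b l ih =>
    cases b with
    | false => exact ⟨0, Or.inr ⟨l, rfl⟩⟩
    | true =>
      obtain ⟨q, rfl | ⟨l', rfl⟩⟩ := ih
      · exact ⟨q + 1, Or.inl rfl⟩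
      · exact ⟨q + 1, Or.inr ⟨l', rfl⟩⟩

theorem rawBits_append_cancel {r r' : Instr ℕ} {u v : List Bool}
    (h : rawBits r ++ u = rawBits r' ++ v) : u = v := by
  simp only [rawBits, List.cons_append, List.nil_append, List.append_assoc, List.cons.injEq] at h
  exact (replicate_append_cancel h.2.2.2.2).2

/-- The program `P` goes over the code, given by `enc`, of an object with the property `ok`, and
halts if there is no such code. -/
structure Skips (z : Cantor) (K : Memory → Prop) (m : Memory) (P : Code) {α : Type}
    (enc : α → List Bool) (ok : α → Prop) : Prop where
  cancel : ∀ {a a' u v}, ok a → ok a' → enc a ++ u = enc a' ++ v → u = v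
  run : ∀ {j a l}, ok a → ListAt (m Field.code) j (enc a ++ l) →
    Runs z K P (2 * j) m (2 * (j + (enc a).length)) m
  cases : ∀ {j l}, ListAt (m Field.code) j l → BlankFrom (m Field.code) (j + l.length) →
    (∃ a l', ok a ∧ l = enc a ++ l') ∨
      (Stops z P (2 * j) m false ∧ ∀ a l', ok a → l ≠ enc a ++ l')

theorem skips_skipInstr (hK : K (core m)) : Skips z K m skipInstr rawBits fun _ => True where
  cancel _ _ h := rawBits_append_cancel h
  run _ h := runs_skipInstr hK h
  cases := by
    intro j l hl hb
    rcases Nat.lt_or_ge l.length 4 with h4 | h4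
    · refine Or.inr ⟨(stops_expects hK hl hb h4).seq, ?_⟩
      rintro r l' - rfl
      simp [rawBits] at h4
      omega
    · obtain ⟨l₀, l₁, rfl, h0⟩ : ∃ l₀ l₁, l = l₀ ++ l₁ ∧ l₀.length = 4 :=
        ⟨l.take 4, l.drop 4, (List.take_append_drop 4 l).symm, by simpa using h4⟩
      obtain ⟨q, rfl | ⟨l', rfl⟩⟩ := exists_ones l₁
      · obtain ⟨h1, h2⟩ := listAt_append.1 hl
        rw [h0] at h2
        have h3 := hb (j + 4 + q) (by simp [h0]; omega)
        refine Or.inr ⟨(runs_expects hK h1 h0.ge).seqStops ((runs_right hK).seqStops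
          ((runs_ones hK h2 h3.2).seqStops ((runs_left hK).seqStops
            (stops_expect h3.1).seq))), ?_⟩
        rintro r l' - h
        have h5 := congrArg (List.drop 4) h
        rw [List.drop_left' h0] at h5
        have h6 : false ∈ List.replicate q true := by
          rw [h5]
          simp [rawBits]
        simp at h6
      · left
        match l₀, h0 with
        | [b0, b1, b2, b3], _ =>
          refine ⟨⟨q, symbols b0 b1 b2, if b3 then Turing.Dir.right else Turing.Dir.left⟩, l',
            trivial, ?_⟩
          cases b3 <;> simp [rawBits, symbols]

theorem Skips.rep {α : Type} {enc : α → List Bool} {ok : α → Prop} {P : Code} (hK : K (core m))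
    (h : Skips z K m P enc ok) (n : ℕ) :
    Skips z K m (Code.rep P n) (fun as : List α => as.flatMap enc)
      (fun as => as.length = n ∧ ∀ a ∈ as, ok a) := by
  induction n with
  | zero =>
    refine ⟨?_, ?_, ?_⟩
    · rintro a a' u v ⟨ha, -⟩ ⟨ha', -⟩ he
      rw [List.length_eq_zero_iff] at ha ha'
      subst ha ha'
      simpa using he
    · rintro j a l ⟨ha, -⟩ _
      rw [List.length_eq_zero_iff] at ha
      subst ha
      exact runs_stay hK
    · intro j l _ _
      exact Or.inl ⟨[], l, by simp, rfl⟩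
  | succ n ih =>
    refine ⟨?_, ?_, ?_⟩
    · rintro a a' u v ⟨ha, hb⟩ ⟨ha', hb'⟩ he
      rcases a with _ | ⟨b, a⟩ <;> rcases a' with _ | ⟨b', a'⟩ <;> try (simp at ha ha'; done)
      simp only [List.flatMap_cons, List.append_assoc] at he
      exact ih.cancel ⟨by simpa using ha, fun x hx => hb x (by simp [hx])⟩
        ⟨by simpa using ha', fun x hx => hb' x (by simp [hx])⟩
        (h.cancel (hb b (by simp)) (hb' b' (by simp)) he)
    · rintro j a l ⟨ha, hb⟩ hl
      rcases a with _ | ⟨b, a⟩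
      · simp at ha
      · simp only [List.flatMap_cons, List.append_assoc, List.length_append] at hl ⊢
        have h1 := h.run (hb b (by simp)) hl
        have h2 := ih.run (a := a) ⟨by simpa using ha, fun x hx => hb x (by simp [hx])⟩
          (listAt_append.1 hl).2
        rw [add_assoc] at h2
        exact h1.seq h2
    · intro j l hl hb
      rcases h.cases hl hb with ⟨a, l', ha, rfl⟩ | ⟨h1, h2⟩
      · have hr := h.run ha hl
        rcases ih.cases (listAt_append.1 hl).2
          (by rwa [add_assoc, ← List.length_append]) with ⟨as, l₁, h3, rfl⟩ | ⟨h3, h4⟩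
        · refine Or.inl ⟨a :: as, l₁, ⟨by simp [h3.1], ?_⟩, by simp⟩
          intro x hx
          rcases List.mem_cons.1 hx with rfl | hx
          · exact ha
          · exact h3.2 x hx
        · refine Or.inr ⟨hr.seqStops h3, ?_⟩
          rintro (_ | ⟨b, as⟩) l₁ ⟨h5, h6⟩ h7
          · simp at h5
          · simp only [List.flatMap_cons, List.append_assoc] at h7
            exact h4 as l₁ ⟨by simpa using h5, fun x hx => h6 x (by simp [hx])⟩
              (h.cancel ha (h6 b (by simp)) h7)
      · refine Or.inr ⟨h1.seq, ?_⟩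
        rintro (_ | ⟨b, as⟩) l₁ ⟨h5, h6⟩ h7
        · simp at h5
        · simp only [List.flatMap_cons, List.append_assoc] at h7
          exact h2 b _ (h6 b (by simp)) h7

/-- The code of the instructions for one state. -/
def groupBits (g : List (Instr ℕ)) : List Bool := g.flatMap rawBits

/-- The code of a program, given by the lists of the instructions for each state. -/
def progBits (gs : List (List (Instr ℕ))) : List Bool := gs.flatMap groupBits

theorem skips_skipGroup (hK : K (core m)) :
    Skips z K m skipGroup groupBits fun g => g.length = 8 := by
  have h := (skips_skipInstr (z := z) hK).rep hK 8
  exact ⟨fun ha ha' => h.cancel ⟨ha, by simp⟩ ⟨ha', by simp⟩,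
    fun ha => h.run ⟨ha, by simp⟩, fun hl hb => by
      rcases h.cases hl hb with ⟨a, l', h1, h2⟩ | ⟨h1, h2⟩
      · exact Or.inl ⟨a, l', h1.1, h2⟩
      · exact Or.inr ⟨h1, fun a l' ha => h2 a l' ⟨ha, by simp⟩⟩⟩

theorem groupBits_ne_nil {g : List (Instr ℕ)} (hg : g.length = 8) : groupBits g ≠ [] := by
  rcases g with _ | ⟨r, g⟩
  · simp at hg
  · simp [groupBits, rawBits]

theorem cases_skipGroups (hK : K (core m)) (n : ℕ) {j : ℕ} {l : List Bool} (hn : l.length ≤ n)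
    (hl : ListAt (m Field.code) j l) (hb : BlankFrom (m Field.code) (j + l.length)) :
    (∃ gs, (∀ g ∈ gs, g.length = 8) ∧ l = progBits gs ∧
      WhileRuns z K Field.code true skipGroup (2 * j) m (2 * (j + l.length)) m) ∨
    (WhileStops z Field.code true skipGroup (2 * j) m false ∧
      ∀ gs, (∀ g ∈ gs, g.length = 8) → l ≠ progBits gs) := by
  induction n generalizing j l with
  | zero =>
    obtain rfl : l = [] := List.length_eq_zero_iff.1 (by omega)
    exact Or.inl ⟨[], by simp, rfl, .done hK (by simp [(hb j (by simp)).1])⟩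
  | succ n ih =>
    rcases l with _ | ⟨b, l⟩
    · exact Or.inl ⟨[], by simp, rfl, .done hK (by simp [(hb j (by simp)).1])⟩
    · have hs := skips_skipGroup (z := z) hK
      have h0 := hl.1
      rcases hs.cases hl hb with ⟨g, l', hg, h1⟩ | ⟨h1, h2⟩
      · have hpos := List.length_pos_of_ne_nil (groupBits_ne_nil hg)
        have hlen := congrArg List.length h1
        simp only [List.length_append, List.length_cons] at hlen hn
        rw [h1] at hl hb ⊢
        have hr := hs.run hg hl
        rw [List.length_append, ← add_assoc] at hb ⊢
        rcases ih (by omega) (listAt_append.1 hl).2 hb with ⟨gs, h3, rfl, h4⟩ | ⟨h3, h4⟩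
        · refine Or.inl ⟨g :: gs, ?_, rfl, .step h0 hr h4⟩
          intro x hx
          rcases List.mem_cons.1 hx with rfl | hx
          · exact hg
          · exact h3 x hx
        · refine Or.inr ⟨.step h0 hr h3, ?_⟩
          rintro (_ | ⟨g', gs⟩) h5 h6
          · simp only [progBits, List.flatMap_nil, List.append_eq_nil_iff] at h6
            exact groupBits_ne_nil hg h6.1
          · simp only [progBits, List.flatMap_cons] at h6
            exact h4 gs (fun x hx => h5 x (by simp [hx])) (hs.cancel hg (h5 g' (by simp)) h6)
      · refine Or.inr ⟨.halt h0 h1, ?_⟩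
        rintro (_ | ⟨g', gs⟩) h5 h6
        · simp [progBits] at h6
        · exact h2 g' (progBits gs) (h5 g' (by simp)) h6

namespace Code

/-- Check that the code of the program lists the instructions for at least three states. -/
def parse : Code := rep skipGroup 3 ;; whileBit Field.code true skipGroup

end Code

theorem cases_parse (hK : K (core m)) {l : List Bool}
    (hl : ListAt (m Field.code) 0 l) (hb : BlankFrom (m Field.code) l.length) :
    (∃ gs, (∀ g ∈ gs, g.length = 8) ∧ 3 ≤ gs.length ∧ l = progBits gs ∧
      Runs z K parse 0 m (2 * l.length) m) ∨
    (Stops z parse 0 m false ∧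
      ∀ gs, (∀ g ∈ gs, g.length = 8) → 3 ≤ gs.length → l ≠ progBits gs) := by
  have hs := (skips_skipGroup (z := z) hK).rep hK 3
  rcases hs.cases hl (by rwa [zero_add]) with ⟨gs, l', ⟨h1, h2⟩, rfl⟩ | ⟨h1, h2⟩
  · have hr := hs.run ⟨h1, h2⟩ hl
    have h3 := (listAt_append.1 hl).2
    rcases cases_skipGroups (z := z) hK _ le_rfl h3
      (by rwa [zero_add, ← List.length_append]) with ⟨gs', h4, rfl, h5⟩ | ⟨h4, h5⟩
    · refine Or.inl ⟨gs ++ gs', ?_, by simp [h1], by simp [progBits], ?_⟩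
      · intro g hg
        rcases List.mem_append.1 hg with h | h
        · exact h2 g h
        · exact h4 g h
      · have := hr.seq h5.runs
        rwa [zero_add, ← List.length_append] at this
    · refine Or.inr ⟨hr.seqStops h4.stops, fun gs' h6 h7 h8 => ?_⟩
      obtain ⟨g1, g2, rfl, h9⟩ : ∃ g1 g2, gs' = g1 ++ g2 ∧ g1.length = 3 :=
        ⟨gs'.take 3, gs'.drop 3, (List.take_append_drop 3 gs').symm, by simpa using h7⟩
      rw [progBits, List.flatMap_append] at h8
      exact h5 g2 (fun x hx => h6 x (by simp [hx]))
        (hs.cancel ⟨h1, h2⟩ ⟨h9, fun x hx => h6 x (by simp [hx])⟩ h8)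
  · refine Or.inr ⟨h1.seq, fun gs' h6 h7 h8 => ?_⟩
    obtain ⟨g1, g2, rfl, h9⟩ : ∃ g1 g2, gs' = g1 ++ g2 ∧ g1.length = 3 :=
      ⟨gs'.take 3, gs'.drop 3, (List.take_append_drop 3 gs').symm, by simpa using h7⟩
    rw [progBits, List.flatMap_append] at h8
    exact h2 g1 _ ⟨h9, fun x hx => h6 x (by simp [hx])⟩ h8

end Parse

/-! ### Following the number of the next state -/

/-- The place at which the instructions for state number `r` begin. -/
def statePos (gs : List (List (Instr ℕ))) (r : ℕ) : ℕ := (progBits (gs.take r)).length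

/-- The two memories agree apart from the marks `markA` and `markP`. -/
def SameOff (m m' : Memory) : Prop := ∀ v, v ≠ Field.markA → v ≠ Field.markP → m' v = m v

theorem SameOff.refl (m : Memory) : SameOff m m := fun _ _ _ => rfl

theorem SameOff.trans {m m' m'' : Memory} (h : SameOff m m') (h' : SameOff m' m'') :
    SameOff m m'' :=
  fun v h1 h2 => (h' v h1 h2).trans (h v h1 h2)

theorem SameOff.updateA (m : Memory) (f : ℕ → Bool) :
    SameOff m (Function.update m Field.markA f) :=
  fun _ h1 _ => Function.update_of_ne h1 ..

theorem SameOff.updateP (m : Memory) (f : ℕ → Bool) :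
    SameOff m (Function.update m Field.markP f) :=
  fun _ _ h2 => Function.update_of_ne h2 ..

theorem SameOff.core_eq {m m' : Memory} (h : SameOff m m') : core m' = core m := by
  funext v
  cases v <;> simp only [core, Field.isMark, if_true, if_false, Bool.false_eq_true] <;>
    exact h _ (by simp) (by simp)

theorem SameOff.leftOK {m m' : Memory} (h : SameOff m m') (hL : LeftOK m) : LeftOK m' :=
  hL.congr h.core_eq

/-- The field `code` holds the code of a program that consists of the groups `gs`. -/
structure HasCode (m : Memory) (gs : List (List (Instr ℕ))) : Prop where
  left : LeftOK m
  length : ∀ g ∈ gs, g.length = 8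
  listAt : ListAt (m Field.code) 0 (progBits gs)
  blank : BlankFrom (m Field.code) (progBits gs).length

theorem HasCode.congr {m m' : Memory} {gs : List (List (Instr ℕ))} (h : HasCode m gs)
    (hm : core m' = core m) : HasCode m' gs where
  left := h.left.congr hm
  length := h.length
  listAt := by rw [eq_of_core_eq hm rfl]; exact h.listAt
  blank := by rw [eq_of_core_eq hm rfl]; exact h.blank

theorem statePos_of_le {gs : List (List (Instr ℕ))} {r : ℕ} (hr : gs.length ≤ r) :
    statePos gs r = (progBits gs).length := by
  rw [statePos, List.take_of_length_le hr]

theorem progBits_eq_append (gs : List (List (Instr ℕ))) {r : ℕ} (hr : r < gs.length) :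
    progBits gs = progBits (gs.take r) ++ (groupBits gs[r] ++ progBits (gs.drop (r + 1))) := by
  calc progBits gs = progBits (gs.take r ++ gs.drop r) := by rw [List.take_append_drop]
    _ = _ := by
      rw [List.drop_eq_getElem_cons hr, progBits, List.flatMap_append, List.flatMap_cons]
      rfl

theorem statePos_succ (gs : List (List (Instr ℕ))) {r : ℕ} (hr : r < gs.length) :
    statePos gs (r + 1) = statePos gs r + (groupBits gs[r]).length := by
  rw [statePos, statePos, ← List.take_concat_get' gs r hr, progBits, List.flatMap_append,
    List.length_append, List.flatMap_singleton]
  rfl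

theorem HasCode.listAt_statePos {m : Memory} {gs : List (List (Instr ℕ))} (h : HasCode m gs)
    {r : ℕ} (hr : r < gs.length) : ListAt (m Field.code) (statePos gs r)
      (groupBits gs[r] ++ progBits (gs.drop (r + 1))) := by
  have := h.listAt
  rw [progBits_eq_append gs hr, listAt_append, zero_add] at this
  exact this.2

theorem HasCode.mark_statePos {m : Memory} {gs : List (List (Instr ℕ))} (h : HasCode m gs)
    {r : ℕ} (hr : r < gs.length) : m Field.code (2 * statePos gs r) = true := by
  have h1 := h.listAt_statePos hr
  have h2 : 0 < (groupBits gs[r]).length :=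
    List.length_pos_of_ne_nil (groupBits_ne_nil (h.length _ (List.getElem_mem hr)))
  have := h1.mark (i := 0) (by rw [List.length_append]; omega)
  simpa using this

namespace Code

/-- Move `markP` from the beginning of the instructions for one state to those for the next. -/
def advance : Code := find Field.markP ;; skipGroup ;; place Field.markP

/-- If `markA` is at the unary number of a state, put `markP` at the beginning of the instructions
for that state: `markP` advances by one group for each 1 of the unary number. If the number exceeds
that of the groups, the machine halts with answer 0. -/
def transfer : Code :=
  (home ;; place Field.markP) ;; find Field.markA ;; right ;;
    whileBit Field.code true
      (right ;; place Field.markA ;; advance ;; find Field.markA ;; right)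

/-- Check that the numbers of all next states are numbers of states, by following each of them with
`transfer`; `expect` then makes sure that a group begins where `markP` has arrived. -/
def checkNumbers : Code :=
  whileBit Field.code true
    (rep next 4 ;; place Field.markA ;; transfer ;; right ;; place Field.markA ;;
      find Field.markP ;; expect ;; find Field.markA)

/-- Check that the field `code` holds the code of a program, and go to unit 0. -/
def check : Code := parse ;; home ;; checkNumbers ;; home

end Code

section Transfer

variable {z : Cantor} {K : Memory → Prop} {m : Memory} {gs : List (List (Instr ℕ))}

theorem runs_placeA (hK : K (core m)) (hL : LeftOK m) (k : ℕ) :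
    ∃ m', Runs z K (place Field.markA) k m 0 m' ∧ SameOff m m' ∧ FirstMark (m' Field.markA) k ∧
      m' Field.markP = m Field.markP := by
  obtain ⟨f, h1, h2⟩ := runs_place (z := z) hK hL (v := Field.markA) rfl k
  exact ⟨_, h2, .updateA m f, by simpa using h1, by simp⟩

theorem runs_placeP (hK : K (core m)) (hL : LeftOK m) (k : ℕ) :
    ∃ m', Runs z K (place Field.markP) k m 0 m' ∧ SameOff m m' ∧ FirstMark (m' Field.markP) k ∧
      m' Field.markA = m Field.markA := by
  obtain ⟨f, h1, h2⟩ := runs_place (z := z) hK hL (v := Field.markP) rfl k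
  exact ⟨_, h2, .updateP m f, by simpa using h1, by simp⟩

theorem runs_advance (hK : K (core m)) (hc : HasCode m gs) {r : ℕ} (hr : r < gs.length)
    (hp : FirstMark (m Field.markP) (2 * statePos gs r)) (k : ℕ) :
    ∃ m', Runs z K advance k m 0 m' ∧ SameOff m m' ∧
      FirstMark (m' Field.markP) (2 * statePos gs (r + 1)) ∧ m' Field.markA = m Field.markA := by
  obtain ⟨m', h1, h2, h3, h4⟩ := runs_placeP (z := z) hK hc.left (2 * statePos gs (r + 1))
  refine ⟨m', (runs_find hK hc.left hp k).seq (Runs.seq ?_ h1), h2, h3, h4⟩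
  rw [statePos_succ gs hr]
  exact (skips_skipGroup hK).run (hc.length _ (List.getElem_mem hr)) (hc.listAt_statePos hr)

theorem stops_advance (hK : K (core m)) (hc : HasCode m gs)
    (hp : FirstMark (m Field.markP) (2 * statePos gs gs.length)) (k : ℕ) :
    Stops z advance k m false := by
  refine (runs_find hK hc.left hp k).seqStops (Stops.seq ?_)
  rw [statePos_of_le le_rfl]
  rcases (skips_skipGroup (z := z) hK).cases (l := []) (m := m) trivial
    (by simpa using hc.blank) with ⟨g, l', h1, h2⟩ | ⟨h1, -⟩
  · exact absurd (List.append_eq_nil_iff.1 h2.symm).1 (groupBits_ne_nil h1)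
  · exact h1

theorem runs_transfer_loop (hK : K (core m)) (hc : HasCode m gs) {r q j : ℕ}
    (hq : r + q ≤ gs.length) (hp : FirstMark (m Field.markP) (2 * statePos gs r))
    (hl : ListAt (m Field.code) j (List.replicate q true))
    (h0 : m Field.code (2 * (j + q) + 1) = false) :
    ∃ m', WhileRuns z K Field.code true
        (right ;; place Field.markA ;; advance ;; find Field.markA ;; right)
        (2 * j + 1) m (2 * (j + q) + 1) m' ∧ SameOff m m' ∧
      FirstMark (m' Field.markP) (2 * statePos gs (r + q)) := by
  induction q generalizing m r j with
  | zero => exact ⟨m, .done hK (by simpa using h0), .refl m, hp⟩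
  | succ q ih =>
    obtain ⟨m₁, h1, h2, h3, h4⟩ := runs_placeA (z := z) hK hc.left (2 * (j + 1))
    have hK₁ : K (core m₁) := by rwa [h2.core_eq]
    have hc₁ := hc.congr h2.core_eq
    obtain ⟨m₂, h5, h6, h7, h8⟩ := runs_advance (z := z) hK₁ hc₁ (show r < gs.length by omega)
      (by rwa [h4]) 0
    have hK₂ : K (core m₂) := by rwa [h6.core_eq]
    have hc₂ := hc₁.congr h6.core_eq
    have hcode : m₂ Field.code = m Field.code := (h2.trans h6) _ (by simp) (by simp)
    obtain ⟨m', h9, h10, h11⟩ := ih (r := r + 1) (j := j + 1) hK₂ hc₂ (by omega) h7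
      (by rw [hcode]; exact hl.2.2)
      (by rwa [hcode, show j + 1 + q = j + (q + 1) by omega])
    rw [show j + 1 + q = j + (q + 1) by omega] at h9
    rw [show r + 1 + q = r + (q + 1) by omega] at h11
    refine ⟨m', .step hl.2.1 ?_ h9, (h2.trans h6).trans h10, h11⟩
    exact (runs_right hK).seq (h1.seq (h5.seq ((runs_find hK₂ hc₂.left (by rwa [h8]) 0).seq
      (runs_right hK₂))))

theorem stops_transfer_loop (hK : K (core m)) (hc : HasCode m gs) {r q j : ℕ}
    (hr : r ≤ gs.length) (hq : gs.length < r + q)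
    (hp : FirstMark (m Field.markP) (2 * statePos gs r))
    (hl : ListAt (m Field.code) j (List.replicate q true)) :
    WhileStops z Field.code true
        (right ;; place Field.markA ;; advance ;; find Field.markA ;; right)
        (2 * j + 1) m false := by
  induction q generalizing m r j with
  | zero => omega
  | succ q ih =>
    obtain ⟨m₁, h1, h2, h3, h4⟩ := runs_placeA (z := z) hK hc.left (2 * (j + 1))
    have hK₁ : K (core m₁) := by rwa [h2.core_eq]
    have hc₁ := hc.congr h2.core_eq
    rcases hr.lt_or_eq with hr | rfl
    · obtain ⟨m₂, h5, h6, h7, h8⟩ := runs_advance (z := z) hK₁ hc₁ hr (by rwa [h4]) 0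
      have hK₂ : K (core m₂) := by rwa [h6.core_eq]
      have hc₂ := hc₁.congr h6.core_eq
      have hcode : m₂ Field.code = m Field.code := (h2.trans h6) _ (by simp) (by simp)
      have := ih (r := r + 1) (j := j + 1) hK₂ hc₂ hr (by omega) h7
        (by rw [hcode]; exact hl.2.2)
      refine .step (K := K) hl.2.1 ?_ this
      exact (runs_right hK).seq (h1.seq (h5.seq ((runs_find hK₂ hc₂.left (by rwa [h8]) 0).seq
        (runs_right hK₂))))
    · exact .halt hl.2.1 ((runs_right hK).seqStops (h1.seqStops
        (stops_advance hK₁ hc₁ (by rwa [h4]) 0).seq))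

/-- The beginning of `transfer`. -/
theorem runs_transfer_start (hK : K (core m)) (hc : HasCode m gs) {j : ℕ}
    (ha : FirstMark (m Field.markA) (2 * j)) (k : ℕ) :
    ∃ m', SameOff m m' ∧ FirstMark (m' Field.markP) (2 * statePos gs 0) ∧
      Runs z K (home ;; place Field.markP) k m 0 m' ∧
      Runs z K (find Field.markA) 0 m' (2 * j) m' ∧ Runs z K right (2 * j) m' (2 * j + 1) m' := by
  obtain ⟨m₁, h1, h2, h3, h4⟩ := runs_placeP (z := z) hK hc.left 0
  have hK₁ : K (core m₁) := by rwa [h2.core_eq]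
  exact ⟨m₁, h2, h3, (runs_home hK hc.left k).seq h1,
    runs_find hK₁ (h2.leftOK hc.left) (by rwa [h4]) 0, runs_right hK₁⟩

theorem runs_transfer (hK : K (core m)) (hc : HasCode m gs) {q j : ℕ} {l : List Bool}
    (hq : q ≤ gs.length) (ha : FirstMark (m Field.markA) (2 * j))
    (hl : ListAt (m Field.code) j (List.replicate q true ++ false :: l)) (k : ℕ) :
    ∃ m', Runs z K transfer k m (2 * (j + q) + 1) m' ∧ SameOff m m' ∧
      FirstMark (m' Field.markP) (2 * statePos gs q) := by
  obtain ⟨m₁, h1, h2, h3, h4, h5⟩ := runs_transfer_start (z := z) hK hc ha k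
  obtain ⟨h6, h7⟩ := listAt_append.1 hl
  rw [List.length_replicate] at h7
  have hcode : m₁ Field.code = m Field.code := h1 _ (by simp) (by simp)
  obtain ⟨m', h8, h9, h10⟩ := runs_transfer_loop (z := z) (K := K) (r := 0) (q := q) (j := j)
    (by rwa [h1.core_eq]) (hc.congr h1.core_eq) (by omega) h2 (by rwa [hcode])
    (by rw [hcode]; exact h7.2.1)
  rw [zero_add] at h10
  exact ⟨m', h3.seq (h4.seq (h5.seq h8.runs)), h1.trans h9, h10⟩

theorem stops_transfer (hK : K (core m)) (hc : HasCode m gs) {q j : ℕ} {l : List Bool}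
    (hq : gs.length < q) (ha : FirstMark (m Field.markA) (2 * j))
    (hl : ListAt (m Field.code) j (List.replicate q true ++ false :: l)) (k : ℕ) :
    Stops z transfer k m false := by
  obtain ⟨m₁, h1, h2, h3, h4, h5⟩ := runs_transfer_start (z := z) hK hc ha k
  obtain ⟨h6, h7⟩ := listAt_append.1 hl
  have hcode : m₁ Field.code = m Field.code := h1 _ (by simp) (by simp)
  have h8 := stops_transfer_loop (z := z) (K := K) (r := 0) (q := q) (j := j)
    (by rwa [h1.core_eq]) (hc.congr h1.core_eq) (by omega) (by omega) h2 (by rwa [hcode])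
  exact h3.seqStops (h4.seqStops (h5.seqStops h8.stops))

theorem runs_nexts (hK : K (core m)) (n j : ℕ) :
    Runs z K (rep next n) (2 * j) m (2 * (j + n)) m := by
  induction n generalizing j with
  | zero => exact runs_stay hK
  | succ n ih =>
    have := (runs_next hK j).seq (ih (j + 1))
    rwa [show j + 1 + n = j + (n + 1) by omega] at this

theorem cases_checkNumbers (hK : K (core m)) (hc : HasCode m gs) (rs : List (Instr ℕ)) {j : ℕ}
    (hl : ListAt (m Field.code) j (rs.flatMap rawBits))
    (hj : j + (rs.flatMap rawBits).length = (progBits gs).length) :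
    ((∀ r ∈ rs, r.next < gs.length) ∧ ∃ k' m', SameOff m m' ∧
      Runs z K checkNumbers (2 * j) m k' m') ∨
    ((∃ r ∈ rs, gs.length ≤ r.next) ∧ Stops z checkNumbers (2 * j) m false) := by
  suffices h : ((∀ r ∈ rs, r.next < gs.length) ∧ ∃ k' m', SameOff m m' ∧
      WhileRuns z K Field.code true
    (rep next 4 ;; place Field.markA ;; transfer ;; right ;; place Field.markA ;;
      find Field.markP ;; expect ;; find Field.markA) (2 * j) m k' m') ∨
    ((∃ r ∈ rs, gs.length ≤ r.next) ∧ WhileStops z Field.code true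
    (rep next 4 ;; place Field.markA ;; transfer ;; right ;; place Field.markA ;;
      find Field.markP ;; expect ;; find Field.markA) (2 * j) m false) by
    rcases h with ⟨h1, k', m', h2, h3⟩ | ⟨h1, h2⟩
    · exact Or.inl ⟨h1, k', m', h2, h3.runs⟩
    · exact Or.inr ⟨h1, h2.stops⟩
  induction rs generalizing m j with
  | nil =>
    have h0 := (hc.blank j (by simpa using hj.ge)).1
    exact Or.inl ⟨by simp, _, m, .refl m, .done hK (by simp [h0])⟩
  | cons r rs ih =>
    rw [List.flatMap_cons] at hl hj
    have htrue : m Field.code (2 * j) = true := by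
      have := hl.mark (i := 0) (by simp [rawBits])
      simpa using this
    have h4 : ListAt (m Field.code) (j + 4)
        (List.replicate r.next true ++ (false :: rs.flatMap rawBits)) := by
      have : rawBits r ++ rs.flatMap rawBits = [r.write Track.input, r.write Track.scratch,
        r.write Track.output, decide (r.move = Turing.Dir.right)] ++
        (List.replicate r.next true ++ (false :: rs.flatMap rawBits)) := by
        simp [rawBits]
      rw [this] at hl
      exact (listAt_append.1 hl).2
    obtain ⟨m₁, h5, h6, h7, -⟩ := runs_placeA (z := z) hK hc.left (2 * (j + 4))
    have hK₁ : K (core m₁) := by rwa [h6.core_eq]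
    have hc₁ := hc.congr h6.core_eq
    have hcode₁ : m₁ Field.code = m Field.code := h6 _ (by simp) (by simp)
    rcases Nat.lt_or_ge gs.length r.next with hq | hq
    · refine Or.inr ⟨⟨r, by simp, hq.le⟩, .halt htrue ?_⟩
      exact (runs_nexts hK 4 j).seqStops (h5.seqStops
        (stops_transfer hK₁ hc₁ hq h7 (by rw [hcode₁]; exact h4) 0).seq)
    · obtain ⟨m₂, h8, h9, h10⟩ := runs_transfer (z := z) hK₁ hc₁ hq h7
        (by rw [hcode₁]; exact h4) 0
      have hK₂ : K (core m₂) := by rwa [h9.core_eq]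
      have hc₂ := hc₁.congr h9.core_eq
      obtain ⟨m₃, h11, h12, h13, h14⟩ := runs_placeA (z := z) hK₂ hc₂.left
        (2 * (j + 4 + r.next) + 1 + 1)
      have hK₃ : K (core m₃) := by rwa [h12.core_eq]
      have hc₃ := hc₂.congr h12.core_eq
      have h15 := runs_find (z := z) hK₃ hc₃.left (by rw [h14]; exact h10) 0
      have hS := (h6.trans h9).trans h12
      have hcode₃ : m₃ Field.code = m Field.code := hS _ (by simp) (by simp)
      rcases hq.lt_or_eq with hq | hq
      · have h16 := runs_expect (z := z) hK₃ (hc₃.mark_statePos hq)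
        have h17 := runs_find (z := z) hK₃ hc₃.left h13 (2 * statePos gs r.next)
        have hlen : (rawBits r).length = 4 + r.next + 1 := by
          simp [rawBits]
          omega
        have hbody := (runs_nexts hK 4 j).seq (h5.seq (h8.seq ((runs_right hK₂).seq
          (h11.seq (h15.seq (h16.seq h17))))))
        rw [show 2 * (j + 4 + r.next) + 1 + 1 = 2 * (j + (rawBits r).length) by omega] at hbody
        rw [List.length_append, ← add_assoc] at hj
        have hl' := (listAt_append.1 hl).2
        rw [← hcode₃] at hl'
        rcases ih hK₃ hc₃ hl' hj with ⟨h18, k', m', h19, h20⟩ | ⟨⟨r', hr', h18⟩, h19⟩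
        · refine Or.inl ⟨?_, k', m', hS.trans h19, .step htrue hbody h20⟩
          intro r' hr'
          rcases List.mem_cons.1 hr' with rfl | hr'
          · exact hq
          · exact h18 r' hr'
        · exact Or.inr ⟨⟨r', by simp [hr'], h18⟩, .step htrue hbody h19⟩
      · have h16 : Stops z expect (2 * statePos gs r.next) m₃ false := by
          refine stops_expect (hc₃.blank _ ?_).1
          rw [statePos_of_le hq.ge]
        exact Or.inr ⟨⟨r, by simp, hq.ge⟩, .halt htrue ((runs_nexts hK 4 j).seqStops
          (h5.seqStops (h8.seqStops ((runs_right hK₂).seqStops (h11.seqStops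
            (h15.seqStops h16.seq))))))⟩

/-- The groups `gs` are the groups of instructions of a program. -/
structure ValidGroups (gs : List (List (Instr ℕ))) : Prop where
  length : ∀ g ∈ gs, g.length = 8
  three_le : 3 ≤ gs.length
  next_lt : ∀ g ∈ gs, ∀ r ∈ g, r.next < gs.length

theorem progBits_eq (gs : List (List (Instr ℕ))) :
    progBits gs = gs.flatten.flatMap rawBits := by
  induction gs with
  | nil => rfl
  | cons g gs ih =>
    rw [List.flatten_cons, List.flatMap_append, ← ih]
    rfl

theorem length_flatten_eq {gs : List (List (Instr ℕ))} (h : ∀ g ∈ gs, g.length = 8) :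
    gs.flatten.length = 8 * gs.length := by
  induction gs with
  | nil => rfl
  | cons g gs ih =>
    rw [List.flatten_cons, List.length_append, h g (by simp), ih fun x hx => h x (by simp [hx]),
      List.length_cons]
    omega

theorem map_next_eq {rs rs' : List (Instr ℕ)} (h : rs.flatMap rawBits = rs'.flatMap rawBits) :
    rs.map Instr.next = rs'.map Instr.next := by
  induction rs generalizing rs' with
  | nil =>
    cases rs' with
    | nil => rfl
    | cons r rs' => simp [rawBits] at h
  | cons r rs ih =>
    cases rs' with
    | nil => simp [rawBits] at h
    | cons r' rs' =>
      simp only [rawBits, List.flatMap_cons, List.cons_append, List.nil_append,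
        List.append_assoc, List.cons.injEq] at h
      obtain ⟨h1, h2⟩ := replicate_append_cancel h.2.2.2.2
      rw [List.map_cons, List.map_cons, h1, ih h2]

theorem cases_check (hK : K (core m)) (hL : LeftOK m) {l : List Bool}
    (hl : ListAt (m Field.code) 0 l) (hb : BlankFrom (m Field.code) l.length) :
    (∃ gs m', ValidGroups gs ∧ l = progBits gs ∧ HasCode m gs ∧ SameOff m m' ∧
      Runs z K check 0 m 0 m') ∨
    (Stops z check 0 m false ∧ ∀ gs, ValidGroups gs → l ≠ progBits gs) := by
  have hs := skips_skipGroup (z := z) hK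
  rcases cases_parse (z := z) hK hl hb with ⟨gs, h1, h2, rfl, h3⟩ | ⟨h1, h2⟩
  · have hc : HasCode m gs := ⟨hL, h1, hl, hb⟩
    have h4 := cases_checkNumbers (z := z) hK hc gs.flatten (j := 0) (by rwa [← progBits_eq])
      (by rw [← progBits_eq, zero_add])
    have hh := runs_home (z := z) hK hL (2 * (progBits gs).length)
    rcases h4 with ⟨h5, k', m', h6, h7⟩ | ⟨⟨r, h5, h5'⟩, h6⟩
    · refine Or.inl ⟨gs, m', ⟨h1, h2, fun g hg r hr => h5 r (List.mem_flatten.2 ⟨g, hg, hr⟩)⟩, rfl,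
        hc, h6, ?_⟩
      exact h3.seq (hh.seq (h7.seq (runs_home (by rwa [h6.core_eq]) (h6.leftOK hL) k')))
    · refine Or.inr ⟨h3.seqStops (hh.seqStops h6.seq), fun gs' hv he => ?_⟩
      have hmap := map_next_eq ((progBits_eq gs).symm.trans (he.trans (progBits_eq gs')))
      have hlen := congrArg List.length hmap
      rw [List.length_map, List.length_map, length_flatten_eq h1, length_flatten_eq hv.length]
        at hlen
      have hr : r.next ∈ gs'.flatten.map Instr.next := hmap ▸ List.mem_map_of_mem h5
      obtain ⟨r', hr', h7⟩ := List.mem_map.1 hr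
      obtain ⟨g, hg, hrg⟩ := List.mem_flatten.1 hr'
      have := hv.next_lt g hg r' hrg
      omega
  · exact Or.inr ⟨h1.seq, fun gs hv => h2 gs hv.length hv.three_le⟩

end Transfer

/-! ### Simulating one step of a machine -/

/-- An instruction in which the next state is replaced by its number. -/
def toRaw {n : ℕ} (c : Instr (IState (Fin n))) : Instr ℕ := ⟨c.next.number, c.write, c.move⟩

/-- The lists of the instructions of a program for each state. -/
def groupsOf {n : ℕ} (p : Program n) : List (List (Instr ℕ)) :=
  (stateList n).map fun q => symbolList.map fun s => toRaw (p q s)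

theorem progBits_groupsOf {n : ℕ} (p : Program n) : progBits (groupsOf p) = p.bits := by
  rw [progBits_eq, groupsOf, Program.bits, Program.instrs, List.flatMap_def (l := stateList n)]
  generalize stateList n = L
  induction L with
  | nil => rfl
  | cons q L ih =>
    rw [List.map_cons, List.map_cons, List.flatten_cons, List.flatten_cons, List.flatMap_append,
      List.flatMap_append, ih]
    rfl

theorem length_stateList (n : ℕ) : (stateList n).length = n + 3 := by
  simp [stateList]

theorem length_groupsOf {n : ℕ} (p : Program n) : (groupsOf p).length = n + 3 := by
  rw [groupsOf, List.length_map, length_stateList]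

theorem number_lt {n : ℕ} (q : IState (Fin n)) : q.number < n + 3 := by
  cases q <;> simp [IState.number]

theorem getElem_stateList {n : ℕ} (q : IState (Fin n)) (h : q.number < (stateList n).length) :
    (stateList n)[q.number] = q := by
  cases q <;> simp [stateList, IState.number]

theorem validGroups_groupsOf {n : ℕ} (p : Program n) : ValidGroups (groupsOf p) where
  length g hg := by
    obtain ⟨q, -, rfl⟩ := List.mem_map.1 hg
    rfl
  three_le := by rw [length_groupsOf]; omega
  next_lt g hg r hr := by
    obtain ⟨q, -, rfl⟩ := List.mem_map.1 hg
    obtain ⟨s, -, rfl⟩ := List.mem_map.1 hr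
    rw [length_groupsOf]
    exact number_lt _

/-- The position of a triple of symbols in the list of all triples. -/
def symbolIndex (i s o : Bool) : ℕ := 4 * i.toNat + 2 * s.toNat + o.toNat

theorem symbolList_eq (i s o : Bool) : symbolList = symbolList.take (symbolIndex i s o) ++
    symbols i s o :: symbolList.drop (symbolIndex i s o + 1) := by
  cases i <;> cases s <;> cases o <;> rfl

theorem length_take_symbolList (i s o : Bool) :
    (symbolList.take (symbolIndex i s o)).length = symbolIndex i s o := by
  cases i <;> cases s <;> cases o <;> rfl

theorem symbolIndex_lt (i s o : Bool) : symbolIndex i s o < symbolList.length := by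
  cases i <;> cases s <;> cases o <;> decide

theorem symbols_eta (s : Track → Bool) :
    symbols (s Track.input) (s Track.scratch) (s Track.output) = s := by
  funext t
  cases t <;> rfl

/-- Every valid list of groups of instructions comes from a program. -/
theorem ValidGroups.exists_program {gs : List (List (Instr ℕ))} (h : ValidGroups gs) :
    ∃ (n : ℕ) (p : Program n), gs = groupsOf p := by
  obtain ⟨n, hn⟩ : ∃ n, gs.length = n + 3 := ⟨gs.length - 3, by have := h.three_le; omega⟩
  have hq : ∀ q : IState (Fin n), q.number < gs.length := fun q => hn ▸ number_lt q
  have hs : ∀ (q : IState (Fin n)) (s : Track → Bool),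
      symbolIndex (s Track.input) (s Track.scratch) (s Track.output) <
        (gs[q.number]'(hq q)).length := fun q s => by
    rw [h.length _ (List.getElem_mem _)]
    exact symbolIndex_lt _ _ _
  have hst : ∀ k < n + 3, ∃ q : IState (Fin n), q.number = k := by
    intro k hk
    match k with
    | 0 => exact ⟨.start, rfl⟩
    | 1 => exact ⟨.halt, rfl⟩
    | 2 => exact ⟨.limit, rfl⟩
    | k + 3 => exact ⟨.aux ⟨k, by omega⟩, rfl⟩
  let r (q : IState (Fin n)) (s : Track → Bool) : Instr ℕ := (gs[q.number]'(hq q))[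
    symbolIndex (s Track.input) (s Track.scratch) (s Track.output)]'(hs q s)
  have hr : ∀ q s, ∃ q' : IState (Fin n), q'.number = (r q s).next := fun q s =>
    hst _ (by
      rw [← hn]
      exact h.next_lt _ (List.getElem_mem (hq q)) _ (List.getElem_mem (hs q s)))
  choose nx hnx using hr
  refine ⟨n, fun q s => ⟨nx q s, (r q s).write, (r q s).move⟩, ?_⟩
  have hraw : ∀ q s, toRaw (⟨nx q s, (r q s).write, (r q s).move⟩ : Instr (IState (Fin n))) = r q s :=
    fun q s => by simp [toRaw, hnx]
  refine List.ext_getElem (by simp [groupsOf, length_stateList, hn]) fun k h1 h2 => ?_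
  obtain ⟨q, rfl⟩ := hst k (by omega)
  simp only [groupsOf, List.getElem_map, hraw, getElem_stateList]
  refine List.ext_getElem ?_ fun i h3 h4 => ?_
  · rw [h.length _ (List.getElem_mem _), List.length_map]
    rfl
  · rw [List.getElem_map]
    simp only [r]
    have h5 : i < 8 := by
      rw [List.length_map] at h4
      exact h4
    congr 1
    interval_cases i <;> rfl

namespace Code

/-- Read the bit in the current place of the code, and go to the next place. -/
def readBit (P : Bool → Code) : Code := right ;; onBit Field.code fun b => right ;; P b

/-- Halt with the answer 1. -/
def accept : Code := home ;; act (setOutput true) Turing.Dir.right ;; halt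

/-- Accept if the number of the next state is 1, which is the number of the halting state. -/
def haltTest (P : Code) : Code :=
  right ;; onBit Field.code fun b =>
    if b then right ;; right ;; onBit Field.code fun b' =>
      if b' then left ;; left ;; left ;; P else accept
    else left ;; P

/-- Move the simulated head, to the right if `b` is `true`. -/
def moveSim (b : Bool) : Code := (if b then right else left) ;; place Field.markH

/-- Write the symbols `i`, `s` and `o` and move the simulated head as the bit `d` says. The flag
`changed` is set to `b`. -/
def writeSim (b i s o d : Bool) : Code :=
  set Field.changed b ;; find Field.markH ;; set Field.simInput i ;; set Field.simScratch s ;;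
    set Field.simOutput o ;; moveSim d

/-- Simulate one step of the machine. -/
def simStep : Code :=
  find Field.markH ;; onBit Field.simInput fun i => onBit Field.simScratch fun s =>
    onBit Field.simOutput fun o => find Field.markP ;; rep skipInstr (symbolIndex i s o) ;;
      readBit fun i' => readBit fun s' => readBit fun o' => readBit fun d =>
        haltTest (place Field.markA ;; writeSim (o' != o) i' s' o' d ;; transfer)

end Code

/-- The memory without its marks, when it holds the configuration `c` of a simulated machine and
the flag `changed` has the value `g`. The other fields are as in `base`. -/
def simCore {S : Type} (base : Memory) (c : Config S) (g : Bool) : Memory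
  | Field.simInput => c.tape Track.input
  | Field.simScratch => c.tape Track.scratch
  | Field.simOutput => c.tape Track.output
  | Field.changed => fun k => decide (k = 0) && g
  | Field.markA => fun _ => false
  | Field.markP => fun _ => false
  | Field.markH => fun _ => false
  | v => base v

/-- Every bit of the memory has its value in `X` or its value in `Y`. -/
def Between (X Y : Memory) : Memory → Prop := fun M => ∀ v k, M v k = X v k ∨ M v k = Y v k

theorem Between.update {X Y M : Memory} (h : Between X Y M) {v : Field} {k : ℕ} {b : Bool}
    (hb : b = Y v k) : Between X Y (Function.update M v (Function.update (M v) k b)) := by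
  intro w j
  by_cases hw : w = v
  · subst hw
    rw [Function.update_self]
    by_cases hj : j = k
    · subst hj
      simp [hb]
    · rw [Function.update_of_ne hj]
      exact h w j
  · rw [Function.update_of_ne hw]
    exact h w j

/-- The memory `m` represents the configuration `c` of the program `p`. -/
structure Represents {n : ℕ} (p : Program n) (base : Memory) (m : Memory)
    (c : Config (IState (Fin n))) (g : Bool) : Prop where
  core_eq : core m = simCore base c g
  hasCode : HasCode m (groupsOf p)
  head : FirstMark (m Field.markH) c.head
  state : FirstMark (m Field.markP) (2 * statePos (groupsOf p) c.state.number)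

/-- The scanned symbols. -/
def Config.scanned {S : Type} (c : Config S) : Track → Bool := fun t => c.tape t c.head

/-- Whether the next step changes the content of the output tape. -/
def Config.changes {S : Type} (δ : Table S) (c : Config S) : Bool :=
  (δ c.state c.scanned).write Track.output != c.tape Track.output c.head

section SimStep

variable {z : Cantor} {K : Memory → Prop} {m : Memory} {n : ℕ} {p : Program n}

theorem runs_readBit {P : Bool → Code} (hK : K (core m)) {j : ℕ} {b : Bool} {k' : ℕ} {m' : Memory}
    (hb : m Field.code (2 * j + 1) = b) (h : Runs z K (P b) (2 * (j + 1)) m k' m') :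
    Runs z K (readBit P) (2 * j) m k' m' := by
  refine (runs_right hK).seq (runs_onBit ?_)
  rw [hb]
  exact (runs_right hK).seq h

theorem stops_readBit {P : Bool → Code} (hK : K (core m)) {j : ℕ} {b a : Bool}
    (hb : m Field.code (2 * j + 1) = b) (h : Stops z (P b) (2 * (j + 1)) m a) :
    Stops z (readBit P) (2 * j) m a := by
  refine (runs_right hK).seqStops (stops_onBit ?_)
  rw [hb]
  exact (runs_right hK).seqStops h

theorem stops_accept (hL : LeftOK m) (k : ℕ) : Stops z accept k m true := by
  refine (runs_home (K := fun _ => True) trivial hL k).seqStops ⟨_, _, .seq (.act trivial) (.halt trivial), ?_⟩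
  funext j
  by_cases hj : j = 0 <;> simp [putAt, setOutput, hj, tapeOf]

theorem runs_haltTest {P : Code} (hK : K (core m)) {j q : ℕ} {l : List Bool} {k' : ℕ} {m' : Memory}
    (hl : ListAt (m Field.code) j (List.replicate q true ++ false :: l)) (hq : q ≠ 1)
    (h : Runs z K P (2 * j) m k' m') : Runs z K (haltTest P) (2 * j) m k' m' := by
  refine (runs_right hK).seq (runs_onBit ?_)
  rcases q with _ | _ | q
  · rw [hl.2.1]
    exact (runs_left hK).seq h
  · exact absurd rfl hq
  · rw [hl.2.1, if_pos rfl]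
    refine (runs_right hK).seq ((runs_right hK).seq (runs_onBit ?_))
    have := hl.2.2.2.1
    rw [show 2 * j + 1 + 1 + 1 = 2 * (j + 1) + 1 by ring, this, if_pos rfl]
    exact (runs_left hK).seq ((runs_left hK).seq ((runs_left hK).seq h))

theorem stops_haltTest {P : Code} {j : ℕ} {l : List Bool} (hL : LeftOK m)
    (hl : ListAt (m Field.code) j (List.replicate 1 true ++ false :: l)) :
    Stops z (haltTest P) (2 * j) m true := by
  refine (runs_right (K := fun _ => True) trivial).seqStops (stops_onBit ?_)
  rw [hl.2.1, if_pos rfl]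
  refine (runs_right (K := fun _ => True) trivial).seqStops ((runs_right (K := fun _ => True) trivial).seqStops (stops_onBit ?_))
  have := hl.2.2.2.1
  rw [show 2 * j + 1 + 1 + 1 = 2 * (j + 1) + 1 by ring, this]
  exact stops_accept hL _

/-- The instruction that is due begins at the place where the program stops skipping. -/
theorem Represents.listAt_instr {base : Memory} {c : Config (IState (Fin n))} {g : Bool}
    (h : Represents p base m c g) (hK : K (core m)) {i s o : Bool}
    (hs : c.scanned = symbols i s o) : ∃ j l,
      Runs z K (rep skipInstr (symbolIndex i s o))
        (2 * statePos (groupsOf p) c.state.number) m (2 * j) m ∧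
      ListAt (m Field.code) j ((p c.state c.scanned).bits ++ l) := by
  have hlt : c.state.number < (groupsOf p).length := by
    rw [length_groupsOf]
    exact number_lt _
  have h1 := h.hasCode.listAt_statePos hlt
  have h2 : (groupsOf p)[c.state.number] =
      (symbolList.take (symbolIndex i s o)).map (fun s => toRaw (p c.state s)) ++
        toRaw (p c.state c.scanned) ::
          (symbolList.drop (symbolIndex i s o + 1)).map (fun s => toRaw (p c.state s)) := by
    simp only [groupsOf, List.getElem_map, getElem_stateList]
    conv_lhs => rw [symbolList_eq i s o]
    rw [List.map_append, List.map_cons, hs]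
  rw [h2, groupBits, List.flatMap_append, List.flatMap_cons, List.append_assoc,
    List.append_assoc] at h1
  have h3 := (listAt_append.1 h1).2
  exact ⟨_, _, ((skips_skipInstr hK).rep hK (symbolIndex i s o)).run
    ⟨by rw [List.length_map, length_take_symbolList], by simp⟩ h1, h3⟩

theorem runs_moveSim (hK : K (core m)) (hL : LeftOK m) (d : Turing.Dir) (k : ℕ) :
    ∃ f, FirstMark f (moveHead d k) ∧ Runs z K (moveSim (decide (d = Turing.Dir.right))) k m 0
      (Function.update m Field.markH f) := by
  cases d with
  | left =>
    obtain ⟨f, h1, h2⟩ := runs_place (z := z) hK hL (v := Field.markH) rfl (k - 1)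
    exact ⟨f, h1, (runs_left hK).seq h2⟩
  | right =>
    obtain ⟨f, h1, h2⟩ := runs_place (z := z) hK hL (v := Field.markH) rfl (k + 1)
    exact ⟨f, h1, (runs_right hK).seq h2⟩

theorem HasCode.of_eq {m' : Memory} {gs : List (List (Instr ℕ))} (h : HasCode m gs)
    (h1 : m' Field.left = m Field.left) (h2 : m' Field.code = m Field.code) : HasCode m' gs where
  left := by rw [LeftOK, h1]; exact h.left
  length := h.length
  listAt := by rw [h2]; exact h.listAt
  blank := by rw [h2]; exact h.blank

theorem runs_set_between {X Y : Memory} (h : Between X Y (core m)) {v : Field}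
    (hv : v.isMark = false) {k : ℕ} {b : Bool} (hb : b = Y v k) :
    ∃ m', Runs z (Between X Y) (set v b) k m k m' ∧ Between X Y (core m') ∧
      (∀ w, w ≠ v → m' w = m w) ∧
      core m' = Function.update (core m) v (Function.update (core m v) k b) := by
  have h1 : core (Function.update m v (Function.update (m v) k b)) =
      Function.update (core m) v (Function.update (core m v) k b) := by
    rw [core_update m hv, core_apply m hv]
  have h2 : Between X Y (core (Function.update m v (Function.update (m v) k b))) := by
    rw [h1]
    exact h.update hb
  exact ⟨_, runs_set v b h h2, h2, fun w hw => Function.update_of_ne hw .., h1⟩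

theorem step_tape {S : Type} (δ : Table S) (c : Config S) (t : Track) :
    (c.step δ).tape t =
      Function.update (c.tape t) c.head ((δ c.state c.scanned).write t) := by
  funext k
  by_cases hk : k = c.head
  · subst hk
    simp [Config.step]
    rfl
  · simp [Config.step, hk]

theorem step_head {S : Type} (δ : Table S) (c : Config S) :
    (c.step δ).head = moveHead (δ c.state c.scanned).move c.head := by
  change (match (δ c.state c.scanned).move with
    | Turing.Dir.left => c.head - 1
    | Turing.Dir.right => c.head + 1) = _
  cases (δ c.state c.scanned).move <;> rfl

theorem runs_writeSim {base : Memory} {c : Config (IState (Fin n))} {g : Bool}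
    (hcore : core m = simCore base c g) (hc : HasCode m (groupsOf p))
    (hh : FirstMark (m Field.markH) c.head) {b i s o d : Bool} (hb : b = c.changes p)
    (hi : i = (p c.state c.scanned).write Track.input)
    (hs : s = (p c.state c.scanned).write Track.scratch)
    (ho : o = (p c.state c.scanned).write Track.output)
    (hd : d = decide ((p c.state c.scanned).move = Turing.Dir.right)) :
    ∃ m', Runs z (Between (simCore base c g) (simCore base (c.step p) (c.changes p)))
        (writeSim b i s o d) 0 m 0 m' ∧
      core m' = simCore base (c.step p) (c.changes p) ∧ HasCode m' (groupsOf p) ∧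
      FirstMark (m' Field.markH) (c.step p).head ∧ m' Field.markA = m Field.markA := by
  set X := simCore base c g with hX
  set Y := simCore base (c.step p) (c.changes p) with hY
  have hK : Between X Y (core m) := fun v k => Or.inl (by rw [hcore])
  have hYt : ∀ t, Y (Field.sim t) c.head = (p c.state c.scanned).write t := fun t => by
    have : Y (Field.sim t) = (c.step p).tape t := by cases t <;> rfl
    rw [this, step_tape, Function.update_self]
  obtain ⟨m₁, r₁, k₁, e₁, c₁⟩ := runs_set_between (z := z) (v := Field.changed) (k := 0) (b := b) hK
    rfl (by simp [hY, simCore, hb])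
  have hc₁ := hc.of_eq (e₁ Field.left (by simp)) (e₁ Field.code (by simp))
  have rf := runs_find (z := z) k₁ hc₁.left
    (by rw [e₁ Field.markH (by simp)]; exact hh) 0
  obtain ⟨m₂, r₂, k₂, e₂, c₂⟩ := runs_set_between (z := z) (v := Field.simInput) (k := c.head)
    (b := i) k₁ rfl (by rw [hi]; exact (hYt Track.input).symm)
  obtain ⟨m₃, r₃, k₃, e₃, c₃⟩ := runs_set_between (z := z) (v := Field.simScratch) (k := c.head)
    (b := s) k₂ rfl (by rw [hs]; exact (hYt Track.scratch).symm)
  obtain ⟨m₄, r₄, k₄, e₄, c₄⟩ := runs_set_between (z := z) (v := Field.simOutput) (k := c.head)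
    (b := o) k₃ rfl (by rw [ho]; exact (hYt Track.output).symm)
  have e : ∀ w, w ≠ Field.changed → w ≠ Field.simInput → w ≠ Field.simScratch →
      w ≠ Field.simOutput → m₄ w = m w := fun w h1 h2 h3 h4 => by
    rw [e₄ w h4, e₃ w h3, e₂ w h2, e₁ w h1]
  have hc₄ := hc.of_eq (e Field.left (by simp) (by simp) (by simp) (by simp))
    (e Field.code (by simp) (by simp) (by simp) (by simp))
  obtain ⟨f, hf, r₅⟩ := runs_moveSim (z := z) k₄ hc₄.left (p c.state c.scanned).move c.head
  rw [← hd] at r₅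
  have hcore₄ : core m₄ = Y := by
    rw [c₄, c₃, c₂, c₁, hcore]
    funext v
    cases v <;> simp only [hX, hY, simCore, Function.update_self, ne_eq, reduceCtorEq,
      not_false_eq_true, Function.update_of_ne, step_tape, hi, hs, ho]
    funext k
    by_cases hk : k = 0 <;> simp [hk, hb]
  refine ⟨_, r₁.seq (rf.seq (r₂.seq (r₃.seq (r₄.seq r₅)))), ?_, ?_, ?_, ?_⟩
  · rw [core_update_mark _ rfl, hcore₄]
  · exact hc₄.of_eq (by simp) (by simp)
  · rw [step_head]
    simpa using hf
  · rw [Function.update_of_ne (by simp), e Field.markA (by simp) (by simp) (by simp) (by simp)]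

theorem Represents.sim_eq {base : Memory} {c : Config (IState (Fin n))} {g : Bool}
    (h : Represents p base m c g) : m Field.simInput = c.tape Track.input ∧
      m Field.simScratch = c.tape Track.scratch ∧ m Field.simOutput = c.tape Track.output := by
  rw [← core_apply m (v := Field.simInput) rfl, ← core_apply m (v := Field.simScratch) rfl,
    ← core_apply m (v := Field.simOutput) rfl, h.core_eq]
  exact ⟨rfl, rfl, rfl⟩

/-- The bits of an instruction that is written in the code from place `j` on. -/
theorem listAt_bits {c : Cantor} {j : ℕ} {r : Instr (IState (Fin n))} {l : List Bool}
    (h : ListAt c j (r.bits ++ l)) : c (2 * j + 1) = r.write Track.input ∧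
      c (2 * (j + 1) + 1) = r.write Track.scratch ∧
      c (2 * (j + 1 + 1) + 1) = r.write Track.output ∧
      c (2 * (j + 1 + 1 + 1) + 1) = decide (r.move = Turing.Dir.right) ∧
      ListAt c (j + 1 + 1 + 1 + 1) (List.replicate r.next.number true ++ false :: l) := by
  simp only [Instr.bits, List.cons_append, List.nil_append, List.append_assoc, ListAt] at h
  exact ⟨h.2.1, h.2.2.2.1, h.2.2.2.2.2.1, h.2.2.2.2.2.2.2.1, h.2.2.2.2.2.2.2.2⟩

theorem step_state {S : Type} (δ : Table S) (c : Config S) :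
    (c.step δ).state = (δ c.state c.scanned).next := rfl

/-- The program `simStep` simulates one step that does not lead to the halting state. On the way,
every bit apart from the marks has its old value or its new value. -/
theorem runs_simStep {base : Memory} {c : Config (IState (Fin n))} {g : Bool}
    (h : Represents p base m c g) (hn : (c.step p).state ≠ IState.halt) (k : ℕ) :
    ∃ k' m', Runs z (Between (simCore base c g) (simCore base (c.step p) (c.changes p)))
      simStep k m k' m' ∧ Represents p base m' (c.step p) (c.changes p) := by
  set K := Between (simCore base c g) (simCore base (c.step p) (c.changes p)) with hKdef
  have hK : K (core m) := fun v k => Or.inl (by rw [h.core_eq])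
  have hL := h.hasCode.left
  obtain ⟨s1, s2, s3⟩ := h.sim_eq
  obtain ⟨j, l, hskip, hl⟩ := h.listAt_instr (z := z) hK (symbols_eta c.scanned).symm
  obtain ⟨b1, b2, b3, b4, b5⟩ := listAt_bits hl
  obtain ⟨m₁, r₁, o₁, a₁, -⟩ := runs_placeA (z := z) hK hL (2 * (j + 1 + 1 + 1 + 1))
  obtain ⟨m₂, r₂, c₂, hc₂, h₂, a₂⟩ := runs_writeSim (z := z) (p := p) (m := m₁) (c := c) (g := g)
    (base := base) (by rw [o₁.core_eq, h.core_eq]) (h.hasCode.congr o₁.core_eq)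
    (by rw [o₁ _ (by simp) (by simp)]; exact h.head)
    (b := c.changes p) rfl rfl rfl rfl rfl
  have hK₂ : K (core m₂) := fun v k => Or.inr (by rw [c₂])
  have hcode : m₂ Field.code = m Field.code := by
    rw [← core_apply m₂ (v := Field.code) rfl, c₂, ← core_apply m (v := Field.code) rfl, h.core_eq]
    rfl
  obtain ⟨m₃, r₃, o₃, p₃⟩ := runs_transfer (z := z) hK₂ hc₂
    (q := (c.step p).state.number) (j := j + 1 + 1 + 1 + 1) (l := l)
    (by rw [length_groupsOf]; exact (number_lt _).le) (by rw [a₂]; exact a₁)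
    (by rw [hcode]; exact b5) 0
  refine ⟨2 * (j + 1 + 1 + 1 + 1 + (c.step p).state.number) + 1, m₃, ?_, ⟨by rw [o₃.core_eq, c₂], hc₂.congr o₃.core_eq,
    by rw [o₃ _ (by simp) (by simp)]; exact h₂, p₃⟩⟩
  refine (runs_find hK hL h.head k).seq (runs_onBit (runs_onBit (runs_onBit ?_)))
  rw [s1, s2, s3]
  refine (runs_find hK hL h.state _).seq (hskip.seq ?_)
  refine runs_readBit hK b1 (runs_readBit hK b2 (runs_readBit hK b3 (runs_readBit hK b4 ?_)))
  refine runs_haltTest hK b5 ?_ (r₁.seq (r₂.seq r₃))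
  intro h1
  exact hn (IState.number_injective (h1.trans rfl : _ = (IState.halt : IState (Fin n)).number))

/-- The program `simStep` accepts when the simulated machine halts. -/
theorem stops_simStep {base : Memory} {c : Config (IState (Fin n))} {g : Bool}
    (h : Represents p base m c g) (hn : (c.step p).state = IState.halt) (k : ℕ) :
    Stops z simStep k m true := by
  have hK : (fun _ : Memory => True) (core m) := trivial
  have hL := h.hasCode.left
  obtain ⟨s1, s2, s3⟩ := h.sim_eq
  obtain ⟨j, l, hskip, hl⟩ := h.listAt_instr (z := z) (K := fun _ => True) hK (symbols_eta c.scanned).symm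
  obtain ⟨b1, b2, b3, b4, b5⟩ := listAt_bits hl
  refine (runs_find (K := fun _ => True) hK hL h.head k).seqStops (stops_onBit (stops_onBit (stops_onBit ?_)))
  rw [s1, s2, s3]
  refine (runs_find (K := fun _ => True) hK hL h.state _).seqStops (hskip.seqStops ?_)
  refine stops_readBit (K := fun _ => True) hK b1 (stops_readBit (K := fun _ => True) hK b2 (stops_readBit (K := fun _ => True) hK b3 (stops_readBit (K := fun _ => True) hK b4 ?_)))
  rw [← step_state, hn] at b5
  exact stops_haltTest hL b5

end SimStep

/-! ### Copying the input to the memory -/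

/-- Three tapes with given contents. -/
def tapes (a b c : ℕ → Bool) : Tape
  | Track.input => a
  | Track.scratch => b
  | Track.output => c

/-- The initial memory: the program code `c`, and the input `x` of the simulated machine. -/
def initMem (c x : Cantor) : Memory
  | Field.left => fun k => decide (k = 0)
  | Field.code => c
  | Field.simInput => x
  | _ => fun _ => false

/-- The contents of the scratch tape after copying. -/
def initScratch (c x : Cantor) (n : ℕ) : Bool :=
  if n % 12 = 4 then c (n / 12) else if n % 12 = 5 then x (n / 12) else decide (n = 0)

theorem tapeOf_initMem (z c x : Cantor) :
    tapeOf z (initMem c x) = tapes z (initScratch c x) (fun _ => false) := by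
  funext t n
  cases t with
  | input => rfl
  | output => rfl
  | scratch =>
    simp only [tapeOf, tapes, initScratch]
    have h : n % 12 < 12 := Nat.mod_lt _ (by norm_num)
    have hn : ∀ r, r ≠ 0 → n % 12 = r → (n = 0) = False := fun r hr h1 => by
      simp only [eq_iff_iff, iff_false]
      rintro rfl
      exact hr (by simpa using h1.symm)
    generalize hr : n % 12 = r at h
    interval_cases r <;> simp [Field.at', initMem, hn _ _ hr]
    omega

namespace Code

/-- Write on the scratch tape and on the output tape. -/
def setBoth (b b' : Bool) (s : Track → Bool) : Track → Bool
  | Track.input => s Track.input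
  | Track.scratch => b
  | Track.output => b'

/-- Move right to the next mark on the output tape. -/
def seekRight : Code := loop (fun s => !s Track.output) (go Turing.Dir.right)

/-- Move left to the next mark on the output tape. -/
def seekLeft : Code := loop (fun s => !s Track.output) (go Turing.Dir.left)

/-- Mark the first cell of the scratch tape. On the output tape, mark the first cell, from where
the first bit is to be copied, and the fifth cell, to where it is to be copied. -/
def copyInit : Code :=
  act (setBoth true true) Turing.Dir.right ;; rep (go Turing.Dir.right) 3 ;;
    act (setOutput true) Turing.Dir.left ;; rep (go Turing.Dir.left) 3

/-- Mark the current cell as the new source, write the bits `v` and `w` to the destination, mark the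
new destination, and return to the source. -/
def copyBits (v w : Bool) : Code :=
  act (setOutput true) Turing.Dir.right ;; seekRight ;;
    act (setBoth v false) Turing.Dir.right ;; act (setScratch w) Turing.Dir.right ;;
      rep (go Turing.Dir.right) 10 ;; act (setOutput true) Turing.Dir.left ;; seekLeft

/-- Copy the next bit of the input, or the next two bits, to the next unit. -/
def copyUnit (two : Bool) : Code :=
  let f (v : Bool) : Code := act (setOutput false) Turing.Dir.right ;;
    if two then ite (fun s => s Track.input) (go Turing.Dir.right ;; copyBits v true)
      (go Turing.Dir.right ;; copyBits v false)
    else copyBits v false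
  ite (fun s => s Track.input) (f true) (f false)

/-- Copy the input to the memory, where the input is the code of a program or, if `two` is `true`,
a pair of the code of a program and an input for it. -/
def copy (two : Bool) : Code := copyInit ;; loop (fun _ => true) (copyUnit two)

end Code

section Copy

variable {I : Tape → Prop} {a b c : ℕ → Bool}

theorem putAt_tapes (a b c : ℕ → Bool) (h : ℕ) (s : Track → Bool) :
    putAt (tapes a b c) h s = tapes (Function.update a h (s Track.input))
      (Function.update b h (s Track.scratch)) (Function.update c h (s Track.output)) := by
  funext t n
  by_cases hn : n = h
  · subst hn
    cases t <;> simp [putAt, tapes]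
  · cases t <;> simp [putAt, tapes, hn]

theorem exec_setOutput (v : Bool) (d : Turing.Dir) (h : ℕ) (hI : I (tapes a b c)) :
    Exec I (act (setOutput v) d) h (tapes a b c) false (moveHead d h)
      (tapes a b (Function.update c h v)) := by
  have := Exec.act (w := setOutput v) (d := d) (h := h) hI
  simpa [putAt_tapes, setOutput, scan, tapes] using this

theorem exec_setScratch (v : Bool) (d : Turing.Dir) (h : ℕ) (hI : I (tapes a b c)) :
    Exec I (act (setScratch v) d) h (tapes a b c) false (moveHead d h)
      (tapes a (Function.update b h v) c) := by
  have := Exec.act (w := setScratch v) (d := d) (h := h) hI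
  simpa [putAt_tapes, setScratch, scan, tapes] using this

theorem exec_setBoth (v w : Bool) (d : Turing.Dir) (h : ℕ) (hI : I (tapes a b c)) :
    Exec I (act (setBoth v w) d) h (tapes a b c) false (moveHead d h)
      (tapes a (Function.update b h v) (Function.update c h w)) := by
  have := Exec.act (w := setBoth v w) (d := d) (h := h) hI
  simpa [putAt_tapes, setBoth, scan, tapes] using this

theorem exec_go (d : Turing.Dir) (h : ℕ) {T : Tape} (hI : I T) :
    Exec I (go d) h T false (moveHead d h) T := by
  simpa [putAt_scan, go] using Exec.act (I := I) (w := fun s => s) (d := d) (h := h) hI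

theorem exec_seekRight (hI : I (tapes a b c)) (n h : ℕ) (h1 : ∀ i, h ≤ i → i < h + n → c i = false)
    (h2 : c (h + n) = true) :
    Exec I seekRight h (tapes a b c) false (h + n) (tapes a b c) := by
  induction n generalizing h with
  | zero => exact .loopDone hI (by simpa [scan, tapes] using h2)
  | succ n ih =>
    have := ih (h + 1) (fun i h3 h4 => h1 i (by omega) (by omega))
      (by rwa [show h + 1 + n = h + (n + 1) by omega])
    rw [show h + 1 + n = h + (n + 1) by omega] at this
    exact .loopStep hI (by simpa [scan, tapes] using h1 h le_rfl (by omega))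
      (exec_go Turing.Dir.right h hI) this

theorem exec_seekLeft (hI : I (tapes a b c)) (n h : ℕ) (h1 : ∀ i, h < i → i ≤ h + n → c i = false)
    (h2 : c h = true) :
    Exec I seekLeft (h + n) (tapes a b c) false h (tapes a b c) := by
  induction n with
  | zero => exact .loopDone hI (by simpa [scan, tapes] using h2)
  | succ n ih =>
    exact .loopStep hI (by simpa [scan, tapes] using h1 (h + (n + 1)) (by omega) le_rfl)
      (exec_go Turing.Dir.left (h + (n + 1)) hI) (ih fun i h3 h4 => h1 i h3 (by omega))

/-- The number of bits that are copied at once. -/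
def stride (two : Bool) : ℕ := if two then 2 else 1

/-- The tapes when `k` units have been copied. -/
def copyTape (two : Bool) (z c x : Cantor) (k : ℕ) : Tape :=
  tapes z (fun n => decide (n < 12 * k + 4) && initScratch c x n)
    (fun n => decide (n = stride two * k ∨ n = 12 * k + 4))

/-- The part of the tapes that no longer changes when `k` units have been copied. -/
def CopyInv (two : Bool) (z c x : Cantor) : ℕ → Tape → Prop
  | 0, _ => True
  | k + 1, T => T Track.input = z ∧ (∀ n < 12 * k, T Track.scratch n = initScratch c x n) ∧
    ∀ n < stride two * k, T Track.output n = false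

theorem exec_copyInit (z c x : Cantor) (two : Bool) :
    Exec (fun _ => True) copyInit 0 (tapes z (fun _ => false) (fun _ => false)) false 0
      (copyTape two z c x 0) := by
  have h1 := exec_setBoth (I := fun _ => True) (a := z) (b := fun _ => false) (c := fun _ => false)
    true true Turing.Dir.right 0 trivial
  have h2 := h1.seq ((exec_rep_right 3 1 trivial).seq
    ((exec_setOutput true Turing.Dir.left 4 trivial).seq (exec_rep_left 3 3 trivial)))
  have h3 : ∀ n, Function.update (fun _ => false) 0 true n =
      (decide (n < 12 * 0 + 4) && initScratch c x n) := by
    intro n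
    rcases Nat.lt_or_ge n 4 with h | h
    · interval_cases n <;> simp [initScratch]
    · have h0 : n ≠ 0 := by omega
      have h4 : ¬ n < 12 * 0 + 4 := by omega
      simp [h0, h4]
  have h4 : ∀ n, Function.update (Function.update (fun _ => false) 0 true) 4 true n =
      decide (n = stride two * 0 ∨ n = 12 * 0 + 4) := by
    intro n
    by_cases h : n = 4
    · simp [h]
    · by_cases h0 : n = 0 <;> simp [h, h0]
  rw [copyTape, ← funext h3, ← funext h4]
  exact h2

theorem exec_copyBits {z c x : Cantor} {two : Bool} {k : ℕ} {out : ℕ → Bool}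
    (hout : ∀ n, out n = decide (n = 12 * k + 4)) :
    Exec (CopyInv two z c x (k + 1)) (copyBits (c k) (x k)) (stride two * (k + 1))
      (tapes z (fun n => decide (n < 12 * k + 4) && initScratch c x n) out) false
      (stride two * (k + 1)) (copyTape two z c x (k + 1)) := by
  obtain ⟨s, hs, hs1, hs2⟩ : ∃ s, s = stride two ∧ 1 ≤ s ∧ s ≤ 2 :=
    ⟨_, rfl, by cases two <;> simp [stride], by cases two <;> simp [stride]⟩
  have hk : s * (k + 1) ≤ 2 * (k + 1) := Nat.mul_le_mul_right _ hs2
  have hsk : s * k ≤ s * (k + 1) := Nat.mul_le_mul_left _ (Nat.le_succ k)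
  simp only [copyTape, ← hs]
  obtain ⟨a, ha⟩ : ∃ a, a = s * (k + 1) := ⟨_, rfl⟩
  rw [← ha] at hk hsk ⊢
  have hI : ∀ scr out : ℕ → Bool, (∀ n < 12 * k, scr n = initScratch c x n) →
      (∀ n < a, out n = false) → CopyInv two z c x (k + 1) (tapes z scr out) :=
    fun scr out h1 h2 => ⟨rfl, h1, fun n hn => h2 n (by rw [← hs] at hn; omega)⟩
  set scr : ℕ → Bool := fun n => decide (n < 12 * k + 4) && initScratch c x n with hscr
  have hscr' : ∀ n < 12 * k, scr n = initScratch c x n := fun n hn => by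
    have : n < 12 * k + 4 := by omega
    simp [hscr, this]
  -- mark the source, and go right to the mark of the destination
  have e1 := exec_setOutput (I := CopyInv two z c x (k + 1)) (a := z) (b := scr) (c := out) true
    Turing.Dir.right a (hI _ _ hscr' fun n hn => by rw [hout]; simp; omega)
  set out1 := Function.update out a true with hout1
  have hout1' : ∀ n, out1 n = decide (n = a ∨ n = 12 * k + 4) := fun n => by
    by_cases h : n = a <;> simp [hout1, hout, h]
  have i1 := hI scr out1 hscr' fun n hn => by rw [hout1']; simp; omega
  have e2 := exec_seekRight i1 (12 * k + 4 - (a + 1)) (a + 1)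
    (fun i h1 h2 => by rw [hout1']; simp; omega) (by rw [hout1']; simp; omega)
  rw [show a + 1 + (12 * k + 4 - (a + 1)) = 12 * k + 4 by omega] at e2
  -- clear this mark, and write the bits into the fields `code` and `simInput`
  have e3 := exec_setBoth (c k) false Turing.Dir.right (12 * k + 4) i1
  set scr1 := Function.update scr (12 * k + 4) (c k) with hscr1
  set out2 := Function.update out1 (12 * k + 4) false with hout2
  have hout2' : ∀ n, out2 n = decide (n = a) := fun n => by
    by_cases h : n = 12 * k + 4
    · have : ¬ n = a := by omega
      simp [hout2, h]
      omega
    · simp [hout2, hout1', h]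
  have hscr1' : ∀ n < 12 * k, scr1 n = initScratch c x n := fun n hn => by
    rw [hscr1, Function.update_of_ne (by omega), hscr' n hn]
  have i2 := hI scr1 out2 hscr1' fun n hn => by rw [hout2']; simp; omega
  have e4 := exec_setScratch (x k) Turing.Dir.right (12 * k + 4 + 1) i2
  set scr2 := Function.update scr1 (12 * k + 4 + 1) (x k) with hscr2
  have hscr2' : ∀ n < 12 * k, scr2 n = initScratch c x n := fun n hn => by
    rw [hscr2, Function.update_of_ne (by omega), hscr1' n hn]
  have i3 := hI scr2 out2 hscr2' fun n hn => by rw [hout2']; simp; omega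
  -- mark the next destination, and go left to the source
  have e5 := exec_rep_right 10 (12 * k + 4 + 1 + 1) i3
  have e6 := exec_setOutput true Turing.Dir.left (12 * k + 4 + 1 + 1 + 10) i3
  set out3 := Function.update out2 (12 * k + 4 + 1 + 1 + 10) true with hout3
  have hout3' : ∀ n, out3 n = decide (n = a ∨ n = 12 * (k + 1) + 4) := fun n => by
    by_cases h : n = 12 * k + 4 + 1 + 1 + 10
    · have : n = 12 * (k + 1) + 4 := by omega
      simp [hout3, h]
      omega
    · have : ¬ n = 12 * (k + 1) + 4 := by omega
      simp [hout3, hout2', h, this]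
  have i4 := hI scr2 out3 hscr2' fun n hn => by rw [hout3']; simp; omega
  have e7 := exec_seekLeft i4 (12 * k + 4 + 1 + 1 + 10 - 1 - a) a
    (fun i h1 h2 => by rw [hout3']; simp; omega) (by rw [hout3']; simp)
  rw [show a + (12 * k + 4 + 1 + 1 + 10 - 1 - a) = 12 * k + 4 + 1 + 1 + 10 - 1 by omega] at e7
  have hfin : ∀ n, scr2 n = (decide (n < 12 * (k + 1) + 4) && initScratch c x n) := by
    intro n
    rcases Nat.lt_or_ge n (12 * k + 4) with h | h
    · have h1 : n < 12 * (k + 1) + 4 := by omega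
      rw [hscr2, Function.update_of_ne (by omega), hscr1, Function.update_of_ne (by omega)]
      simp [hscr, h, h1]
    · rcases Nat.lt_or_ge n (12 * (k + 1) + 4) with h' | h'
      · obtain ⟨j, rfl⟩ : ∃ j, n = 12 * k + 4 + j := ⟨n - (12 * k + 4), by omega⟩
        rcases j with _ | _ | j
        · have h1 : (12 * k + 4) % 12 = 4 := by omega
          have h2 : (12 * k + 4) / 12 = k := by omega
          rw [hscr2, Function.update_of_ne (by omega), hscr1]
          simp [initScratch, h1, h2]
        · have h1 : (12 * k + 4 + (0 + 1)) % 12 = 5 := by omega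
          have h2 : (12 * k + 4 + (0 + 1)) / 12 = k := by omega
          have h3 : 12 * k + 4 + (0 + 1) < 12 * (k + 1) + 4 := by omega
          simp only [hscr2, initScratch, h1, h2, h3]
          simp
        · have h1 : ¬ (12 * k + 4 + (j + 1 + 1)) % 12 = 4 := by omega
          have h2 : ¬ (12 * k + 4 + (j + 1 + 1)) % 12 = 5 := by omega
          have h3 : ¬ 12 * k + 4 + (j + 1 + 1) < 12 * k + 4 := by omega
          rw [hscr2, Function.update_of_ne (by omega), hscr1, Function.update_of_ne (by omega)]
          simp only [hscr, initScratch, h1, h2, h3]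
          simp
      · have h1 : ¬ n < 12 * (k + 1) + 4 := by omega
        have h2 : ¬ n < 12 * k + 4 := by omega
        rw [hscr2, Function.update_of_ne (by omega), hscr1, Function.update_of_ne (by omega)]
        simp [hscr, h1, h2]
  rw [← funext hfin, ← funext hout3']
  exact e1.seq (e2.seq (e3.seq (e4.seq (e5.seq (e6.seq e7)))))

theorem exec_copyUnit {z c x : Cantor} {two : Bool} (k : ℕ) (hc : z (stride two * k) = c k)
    (hx : (two && z (2 * k + 1)) = x k) :
    Exec (CopyInv two z c x (k + 1)) (copyUnit two) (stride two * k) (copyTape two z c x k) false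
      (stride two * (k + 1)) (copyTape two z c x (k + 1)) := by
  have hI : ∀ out : ℕ → Bool, (∀ n < stride two * k, out n = false) →
      CopyInv two z c x (k + 1)
        (tapes z (fun n => decide (n < 12 * k + 4) && initScratch c x n) out) :=
    fun out h2 => ⟨rfl, fun n hn => by
      have : n < 12 * k + 4 := by omega
      simp [tapes, this], h2⟩
  have hsk : stride two * k < 12 * k + 4 := by
    have : stride two * k ≤ 2 * k := Nat.mul_le_mul_right _ (by cases two <;> simp [stride])
    omega
  have i0 : CopyInv two z c x (k + 1) (copyTape two z c x k) :=
    hI _ fun n hn => by simp; omega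
  set out := Function.update (fun n => decide (n = stride two * k ∨ n = 12 * k + 4))
    (stride two * k) false with hout
  have hout' : ∀ n, out n = decide (n = 12 * k + 4) := fun n => by
    by_cases h : n = stride two * k
    · simp [hout, h]
      omega
    · simp [hout, h]
  have i1 := hI out fun n hn => by rw [hout']; simp; omega
  have e1 := exec_setOutput false Turing.Dir.right (stride two * k) i0
  have e2 := exec_copyBits (z := z) (c := c) (x := x) (two := two) hout'
  have key : Exec (CopyInv two z c x (k + 1)) (act (setOutput false) Turing.Dir.right ;;
      if two then Code.ite (fun s => s Track.input) (go Turing.Dir.right ;; copyBits (c k) true)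
        (go Turing.Dir.right ;; copyBits (c k) false)
      else copyBits (c k) false) (stride two * k) (copyTape two z c x k) false
      (stride two * (k + 1)) (copyTape two z c x (k + 1)) := by
    refine Exec.seq e1 ?_
    cases two with
    | false =>
      rw [show x k = false from hx.symm] at e2
      have hh : moveHead Turing.Dir.right (stride false * k) = stride false * (k + 1) := by
        simp [stride, moveHead]
      rw [if_neg (by simp), hh]
      exact e2
    | true =>
      have hx' : z (2 * k + 1) = x k := by simpa using hx
      have e3 := (exec_go Turing.Dir.right (2 * k + 1) i1).seq e2
      rw [if_pos rfl]
      cases hxk : x k with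
      | true =>
        rw [hxk] at hx' e3
        exact .iteTrue i1 (by simpa [scan, tapes, stride, moveHead] using hx') e3
      | false =>
        rw [hxk] at hx' e3
        exact .iteFalse i1 (by simpa [scan, tapes, stride, moveHead] using hx') e3
  rw [copyUnit]
  cases hck : c k with
  | true =>
    rw [hck] at hc key
    exact .iteTrue i0 (by simpa [scan, copyTape, tapes] using hc) key
  | false =>
    rw [hck] at hc key
    exact .iteFalse i0 (by simpa [scan, copyTape, tapes] using hc) key

theorem diverge_copy {z c x : Cantor} {two : Bool} (hc : ∀ k, z (stride two * k) = c k)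
    (hx : ∀ k, (two && z (2 * k + 1)) = x k) :
    Diverge (CopyInv two z c x) (copyTape two z c x) (copy two) 0
      (tapes z (fun _ => false) (fun _ => false)) := by
  refine .seqRight (exec_copyInit z c x two) ?_
  have h := fun k => exec_copyUnit (z := z) (two := two) k (hc k) (hx k)
  exact .loop (fun k => stride two * k) (fun k => (h k).inv_start) (fun _ => rfl) h

/-- After `ω` steps, the input has been copied. -/
theorem copy_limit {S : Type} {M : Machine S} {z c x : Cantor} {two : Bool}
    (hs : Starts M.table M.halt (copy two) M.start) (hc : ∀ k, z (stride two * k) = c k)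
    (hx : ∀ k, (two && z (2 * k + 1)) = x k) :
    M.IsStage z Ordinal.omega0 ∧ (M.run z Ordinal.omega0).tape = tapeOf z (initMem c x) := by
  have h0 : M.run z 0 = ⟨M.start, 0, tapes z (fun _ => false) (fun _ => false)⟩ := by
    rw [M.run_zero, Machine.init]
    congr 1
  have hst : M.IsStage z 0 := fun b hb => by simp at hb
  obtain ⟨h1, n, h2⟩ := isStage_of_diverge hst hs h0 (diverge_copy hc hx)
  have h3 := tape_add_omega_of_rounds h2 (tapeOf z (initMem c x)) ?_
  · rw [zero_add] at h1 h3
    exact ⟨h1, h3⟩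
  · have hstr : 1 ≤ stride two := by cases two <;> simp [stride]
    intro t k
    refine ⟨k + 2, fun j hj T hT => ?_⟩
    obtain ⟨j, rfl⟩ : ∃ i, j = i + 1 := ⟨j - 1, by omega⟩
    obtain ⟨h4, h5, h6⟩ := hT
    rw [tapeOf_initMem]
    cases t with
    | input => rw [h4]; rfl
    | scratch => exact h5 k (by omega)
    | output => exact h6 k (lt_of_lt_of_le (by omega) (Nat.le_mul_of_pos_left j hstr))

end Copy

/-! ### The programs for the limit states and the cardinal state -/

namespace Code

/-- Go through the marks of the program code, and halt if a bit after them is not 0. -/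
def scanTail : Code :=
  whileBit Field.code true next ;;
    whileBit Field.code false (right ;; onBit Field.code fun b => if b then halt else right) ;; halt

/-- Put the marks of head and state on unit 0. -/
def beginSim : Code := place Field.markH ;; place Field.markP

/-- Simulate a machine. -/
def mainLoop : Code := loop (fun _ => true) simStep

/-- What to do at a limit stage, depending on the flags `checked`, `scanned` and `copied`, which say
which phases of the computation have ended. -/
def limitBranch : Bool → Bool → Bool → Code
  | true, _, _ => (beginSim ;; advance ;; advance) ;; mainLoop
  | false, true, _ => halt
  | false, false, true =>
    (set Field.scanned true ;; whileBit Field.code true next) ;;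
      (home ;; check ;; set Field.checked true ;; beginSim) ;; mainLoop
  | false, false, false => set Field.copied true ;; scanTail

/-- The program for the limit state. -/
def atLimit : Code :=
  onBit Field.checked fun b₁ => onBit Field.scanned fun b₂ => onBit Field.copied fun b₃ =>
    limitBranch b₁ b₂ b₃

/-- The program for the cardinal state. If `stab` is `true`, the answer is 1 if the flag `changed` is
not set; otherwise it is 0. -/
def atCardinal (stab : Bool) : Code :=
  if stab then onBit Field.changed fun b => if b then halt else accept else halt

end Code

/-- The memory before the simulation, with the values of the flags. -/
def phaseMem (c x : Cantor) (b₁ b₂ b₃ : Bool) : Memory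
  | Field.left => fun k => decide (k = 0)
  | Field.code => c
  | Field.simInput => x
  | Field.copied => fun k => decide (k = 0) && b₁
  | Field.scanned => fun k => decide (k = 0) && b₂
  | Field.checked => fun k => decide (k = 0) && b₃
  | _ => fun _ => false

theorem core_initMem (c x : Cantor) : core (initMem c x) = phaseMem c x false false false := by
  funext v k
  cases v <;> simp [core, initMem, phaseMem, Field.isMark]

/-! ### Scanning the code -/

section Scan

variable {z : Cantor} {K : Memory → Prop} {m : Memory} {c x : Cantor}

theorem update_flag (b : Bool) :
    Function.update (fun k : ℕ => decide (k = 0) && b) 0 true = fun k => decide (k = 0) && true := by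
  funext k
  by_cases hk : k = 0 <;> simp [hk]

theorem runs_setCopied {b₁ b₂ b₃ : Bool} (h : core m = phaseMem c x b₁ b₂ b₃) :
    ∃ m', Runs z (fun _ => True) (set Field.copied true) 0 m 0 m' ∧
      core m' = phaseMem c x true b₂ b₃ := by
  refine ⟨_, runs_set Field.copied true trivial trivial, ?_⟩
  rw [core_update m rfl, ← core_apply m (v := Field.copied) rfl, h]
  funext v
  cases v <;> first | exact update_flag b₁ | rfl

theorem runs_setScanned {b₁ b₂ b₃ : Bool} (h : core m = phaseMem c x b₁ b₂ b₃) :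
    ∃ m', Runs z (fun _ => True) (set Field.scanned true) 0 m 0 m' ∧
      core m' = phaseMem c x b₁ true b₃ := by
  refine ⟨_, runs_set Field.scanned true trivial trivial, ?_⟩
  rw [core_update m rfl, ← core_apply m (v := Field.scanned) rfl, h]
  funext v
  cases v <;> first | exact update_flag b₂ | rfl

theorem runs_setChecked {b₁ b₂ b₃ : Bool} (h : core m = phaseMem c x b₁ b₂ b₃) :
    ∃ m', Runs z (fun _ => True) (set Field.checked true) 0 m 0 m' ∧
      core m' = phaseMem c x b₁ b₂ true := by
  refine ⟨_, runs_set Field.checked true trivial trivial, ?_⟩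
  rw [core_update m rfl, ← core_apply m (v := Field.checked) rfl, h]
  funext v
  cases v <;> first | exact update_flag b₃ | rfl

/-- A code of the form `1 b₀ 1 b₁ … 1 b_{k-1} 0 0 0 …`. -/
def Formatted (c : Cantor) : Prop := ∃ l, ListAt c 0 l ∧ BlankFrom c l.length

theorem listAt_iff {c : Cantor} {j : ℕ} {l : List Bool} : ListAt c j l ↔
    ∀ i < l.length, c (2 * (j + i)) = true ∧ c (2 * (j + i) + 1) = l.getD i false := by
  induction l generalizing j with
  | nil => simp [ListAt]
  | cons b l ih =>
    rw [ListAt, ih]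
    constructor
    · rintro ⟨h1, h2, h3⟩ i hi
      rcases i with _ | i
      · exact ⟨h1, by simpa using h2⟩
      · have := h3 i (by simpa using hi)
        rw [show j + 1 + i = j + (i + 1) by omega] at this
        simpa using this
    · intro h
      refine ⟨(h 0 (by simp)).1, by simpa using (h 0 (by simp)).2, fun i hi => ?_⟩
      have := h (i + 1) (by simpa using hi)
      rw [show j + 1 + i = j + (i + 1) by omega]
      simpa using this

theorem eq_code_iff {c : Cantor} {n : ℕ} {p : Program n} :
    c = p.code ↔ ListAt c 0 p.bits ∧ BlankFrom c p.bits.length := by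
  have hpair : ∀ (x y : Cantor) k, pair x y (2 * k) = x k ∧ pair x y (2 * k + 1) = y k := by
    intro x y k
    have h1 : (2 * k + 1) / 2 = k := by omega
    have h2 : (2 * k + 1) % 2 = 1 := by omega
    simp [pair, h1, h2]
  rw [listAt_iff]
  constructor
  · rintro rfl
    refine ⟨fun i hi => ?_, fun i hi => ?_⟩
    · rw [Program.code, zero_add, (hpair _ _ i).1, (hpair _ _ i).2]
      simpa using hi
    · rw [Program.code, (hpair _ _ i).1, (hpair _ _ i).2]
      simp [hi]
  · rintro ⟨h1, h2⟩
    funext k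
    rcases Nat.even_or_odd' k with ⟨j, rfl | rfl⟩
    · rw [Program.code, (hpair _ _ j).1]
      by_cases hj : j < p.bits.length
      · have := (h1 j hj).1
        rw [zero_add] at this
        simp [this, hj]
      · simp [(h2 j (by omega)).1, hj]
    · rw [Program.code, (hpair _ _ j).2]
      by_cases hj : j < p.bits.length
      · have := (h1 j hj).2
        rwa [zero_add] at this
      · rw [(h2 j (by omega)).2, List.getD_eq_default _ _ (by omega)]

theorem listAt_unique {c : Cantor} {j : ℕ} {l l' : List Bool} (h : ListAt c j l)
    (hb : BlankFrom c (j + l.length)) (h' : ListAt c j l') (hb' : BlankFrom c (j + l'.length)) :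
    l = l' := by
  induction l generalizing j l' with
  | nil =>
    cases l' with
    | nil => rfl
    | cons b l' =>
      have := (hb j (by simp)).1
      rw [h'.1] at this
      cases this
  | cons b l ih =>
    cases l' with
    | nil =>
      have := (hb' j (by simp)).1
      rw [h.1] at this
      cases this
    | cons b' l' =>
      rw [List.length_cons, show j + (l.length + 1) = j + 1 + l.length by omega] at hb
      rw [List.length_cons, show j + (l'.length + 1) = j + 1 + l'.length by omega] at hb'
      rw [ih h.2.2 hb h'.2.2 hb', h.2.1.symm.trans h'.2.1]

theorem exists_listAt {c : Cantor} (n : ℕ) {j : ℕ} (h : ∀ i < n, c (2 * (j + i)) = true) :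
    ∃ l, l.length = n ∧ ListAt c j l := by
  induction n generalizing j with
  | zero => exact ⟨[], rfl, trivial⟩
  | succ n ih =>
    obtain ⟨l, h1, h2⟩ := ih (j := j + 1) fun i hi => by
      have := h (i + 1) (by omega)
      rwa [show j + (i + 1) = j + 1 + i by omega] at this
    exact ⟨c (2 * j + 1) :: l, by simp [h1], h 0 (by omega), rfl, h2⟩

theorem whileRuns_marks (hK : K (core m)) {j : ℕ} {l : List Bool}
    (hl : ListAt (m Field.code) j l) (h0 : m Field.code (2 * (j + l.length)) = false) :
    WhileRuns z K Field.code true next (2 * j) m (2 * (j + l.length)) m := by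
  induction l generalizing j with
  | nil => exact .done hK (by simpa using h0)
  | cons b l ih =>
    have hj : j + (b :: l).length = j + 1 + l.length := by simp; omega
    rw [hj] at h0 ⊢
    exact .step hl.1 (runs_next hK j) (ih hl.2.2 h0)

/-- If all marks are 1, the search for the end of the marks goes on forever. -/
theorem diverge_marks {m : Memory} (h : ∀ j, m Field.code (2 * j) = true) {J : Memory → Prop}
    (hJ : J (core m)) :
    Diverge (fun _ => coreInv z J) (fun _ => tapeOf z m) (whileBit Field.code true next) 0
      (tapeOf z m) :=
  diverge_whileBit_tapeOf (K := fun _ => J) (fun i => 2 * i) (fun _ => m) hJ (fun i => h i)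
    (fun i => runs_next hJ i) (fun _ => hJ)

theorem runs_blank (hK : K (core m)) {j : ℕ} (h : m Field.code (2 * j + 1) = false) :
    Runs z K (right ;; onBit Field.code fun b => if b then halt else right) (2 * j) m
      (2 * (j + 1)) m := by
  refine (runs_right hK).seq (runs_onBit ?_)
  rw [h]
  exact runs_right hK

theorem stops_blanks {j : ℕ} (n : ℕ)
    (h : ¬ (m Field.code (2 * (j + n)) = false ∧ m Field.code (2 * (j + n) + 1) = false)) :
    Stops z (whileBit Field.code false
      (right ;; onBit Field.code fun b => if b then halt else right) ;; halt) (2 * j) m false := by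
  have key : WhileRuns z (fun _ => True) Field.code false
        (right ;; onBit Field.code fun b => if b then halt else right) (2 * j) m
        (2 * (j + n)) m ∨ (∃ i, WhileRuns z (fun _ => True) Field.code false
        (right ;; onBit Field.code fun b => if b then halt else right) (2 * j) m (2 * i) m) ∨
      WhileStops z Field.code false
        (right ;; onBit Field.code fun b => if b then halt else right) (2 * j) m false := by
    induction n generalizing j with
    | zero =>
      cases h1 : m Field.code (2 * j) with
      | true => exact Or.inl (.done trivial (by simp [h1]))
      | false =>
        refine Or.inr (Or.inr (.halt h1 ((runs_right (K := fun _ => True) trivial).seqStops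
          (stops_onBit ?_))))
        have h2 : m Field.code (2 * j + 1) = true := by simpa [h1] using h
        rw [h2]
        exact stops_halt
    | succ n ih =>
      cases h1 : m Field.code (2 * j) with
      | true => exact Or.inr (Or.inl ⟨j, .done trivial (by simp [h1])⟩)
      | false =>
        cases h2 : m Field.code (2 * j + 1) with
        | true =>
          refine Or.inr (Or.inr (.halt h1 ((runs_right (K := fun _ => True) trivial).seqStops
            (stops_onBit ?_))))
          rw [h2]
          exact stops_halt
        | false =>
          have hr := runs_blank (z := z) (K := fun _ => True) trivial h2
          rcases ih (j := j + 1) (by rwa [show j + 1 + n = j + (n + 1) by omega]) with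
            h3 | ⟨i, h3⟩ | h3
          · rw [show j + 1 + n = j + (n + 1) by omega] at h3
            exact Or.inl (.step h1 hr h3)
          · exact Or.inr (Or.inl ⟨i, .step h1 hr h3⟩)
          · exact Or.inr (Or.inr (.step (K := fun _ => True) h1 hr h3))
  rcases key with h1 | ⟨i, h1⟩ | h1
  · exact h1.runs.seqStops stops_halt
  · exact h1.runs.seqStops stops_halt
  · exact h1.stops.seq

/-- That `c` is 0 from some place on cannot be seen in finitely many steps. The scan halts if it sees
a 1 after the marks; otherwise it goes on forever, and the next limit stage is reached. -/
theorem cases_scanTail {J : Memory → Prop} (hJ : J (core m)) :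
    (Diverge (fun _ => coreInv z J) (fun _ => tapeOf z m) scanTail 0 (tapeOf z m) ∧
      ((∀ j, m Field.code (2 * j) = true) ∨ Formatted (m Field.code))) ∨
    (Stops z scanTail 0 m false ∧ ¬ Formatted (m Field.code)) := by
  by_cases hall : ∀ j, m Field.code (2 * j) = true
  · exact Or.inl ⟨.seqLeft (diverge_marks hall hJ), Or.inl hall⟩
  · push Not at hall
    classical
    obtain ⟨j₀, h1, h2⟩ : ∃ j₀, m Field.code (2 * j₀) = false ∧
        ∀ i < j₀, m Field.code (2 * (0 + i)) = true :=
      ⟨Nat.find hall, by simpa using Nat.find_spec hall, fun i hi => by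
        rw [zero_add]
        simpa using Nat.find_min hall hi⟩
    obtain ⟨l, h3, h4⟩ := exists_listAt j₀ h2
    have h5 := whileRuns_marks (z := z) (K := J) hJ h4 (by rwa [h3, zero_add])
    rw [h3, zero_add] at h5
    by_cases hb : BlankFrom (m Field.code) j₀
    · refine Or.inl ⟨.seqRight h5.runs (.seqLeft ?_), Or.inr ⟨l, h4, by rwa [h3]⟩⟩
      exact diverge_whileBit_tapeOf (K := fun _ => J) (fun i => 2 * (j₀ + i)) (fun _ => m) hJ
        (fun i => (hb _ (by omega)).1) (fun i => runs_blank hJ (hb _ (by omega)).2) (fun _ => hJ)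
    · refine Or.inr ⟨h5.runs.seqStops ?_, ?_⟩
      · simp only [BlankFrom, not_forall] at hb
        obtain ⟨i, hi, hb⟩ := hb
        exact stops_blanks (j := j₀) (i - j₀) (by rwa [show j₀ + (i - j₀) = i by omega])
      · rintro ⟨l', h6, h7⟩
        have hlen : l'.length = j₀ := by
          rcases lt_trichotomy l'.length j₀ with h | h | h
          · have := h2 _ h
            rw [zero_add, (h7 _ le_rfl).1] at this
            cases this
          · exact h
          · have := h6.mark h
            rw [zero_add, h1] at this
            cases this
        exact hb (hlen ▸ h7)

end Scan

/-! ### The simulation between two limit stages -/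

section Simulate

variable {z : Cantor} {n : ℕ} {p : Program n} {c x : Cantor}

theorem exists_chain {α : Type*} {R : ℕ → α → Prop} {Q : ℕ → α → α → Prop} {a : α} (h0 : R 0 a)
    (hs : ∀ i a, R i a → ∃ b, R (i + 1) b ∧ Q i a b) :
    ∃ f : ℕ → α, f 0 = a ∧ ∀ i, R i (f i) ∧ Q i (f i) (f (i + 1)) := by
  choose g hg using hs
  let f : ∀ i, {a // R i a} := fun i =>
    Nat.rec ⟨a, h0⟩ (fun i a => ⟨g i a.1 a.2, (hg i a.1 a.2).1⟩) i
  exact ⟨fun i => (f i).1, rfl, fun i => ⟨(f i).2, (hg i (f i).1 (f i).2).2⟩⟩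

open Classical in
/-- Whether the output of the computation on input `x` changes at unboundedly many stages below
`a`. For a successor `a` this means that it changes in the last step before `a`. -/
noncomputable def changedBelow (p : Program n) (x : Cantor) (a : Ordinal.{0}) : Bool :=
  decide (a ≠ 0 ∧ ∀ b < a, ∃ b' < a, b ≤ b' ∧ (p.machine.run x b').changes p = true)

theorem changedBelow_add_one (p : Program n) (x : Cantor) (a : Ordinal.{0}) :
    changedBelow p x (a + 1) = (p.machine.run x a).changes p := by
  rw [Bool.eq_iff_iff]
  simp only [changedBelow, decide_eq_true_eq]
  constructor
  · rintro ⟨-, h⟩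
    obtain ⟨b, h1, h2, h3⟩ := h a (lt_add_one a)
    rwa [← le_antisymm h2 (Order.lt_add_one_iff.1 h1)] at h3
  · intro h
    exact ⟨by simp, fun b hb => ⟨a, lt_add_one a, Order.lt_add_one_iff.1 hb, h⟩⟩

/-- The memory, apart from its marks, when stage `a` of the computation of `p` on input `x` is
reached in the simulation. -/
noncomputable def stageCore (p : Program n) (x : Cantor) (a : Ordinal.{0}) : Memory :=
  simCore (phaseMem p.code x true true true) (p.machine.run x a) (changedBelow p x a)

/-- The memory `m` represents stage `a` of the computation of `p` on input `x`. -/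
def RepresentsStage (p : Program n) (x : Cantor) (m : Memory) (a : Ordinal.{0}) : Prop :=
  Represents p (phaseMem p.code x true true true) m (p.machine.run x a) (changedBelow p x a)

theorem machine_run_add_one (p : Program n) (x : Cantor) (a : Ordinal.{0}) :
    p.machine.run x (a + 1) = (p.machine.run x a).step p :=
  Machine.run_add_one ..

/-- As long as the simulated machine does not halt, the simulation of `ω` many stages goes on. -/
theorem diverge_mainLoop {m : Memory} {k : ℕ} {a : Ordinal.{0}} (h : RepresentsStage p x m a)
    (hn : ∀ i : ℕ, (p.machine.run x (a + i + 1)).state ≠ IState.halt)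
    (I₀ : Tape → Prop) :
    ∃ m' : ℕ → Memory, (∀ i : ℕ, core (m' i) = stageCore p x (a + i)) ∧
      Diverge (fun i => Nat.casesOn i I₀ fun i => coreInv z (Between (stageCore p x (a + i))
        (stageCore p x (a + i + 1)))) (fun i => tapeOf z (m' i)) mainLoop (12 * k) (tapeOf z m) := by
  obtain ⟨f, h0, hf⟩ := exists_chain (α := ℕ × Memory)
    (R := fun i s => RepresentsStage p x s.2 (a + i))
    (Q := fun i s s' => Runs z (Between (stageCore p x (a + i)) (stageCore p x (a + i + 1)))
      simStep s.1 s.2 s'.1 s'.2)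
    (a := (k, m)) (by simpa using h) fun i s hs => by
      have hn' := hn i
      rw [machine_run_add_one] at hn'
      obtain ⟨k', m', h1, h2⟩ := runs_simStep (z := z) hs hn' s.1
      refine ⟨(k', m'), ?_, ?_⟩
      · rw [RepresentsStage, Nat.cast_succ, ← add_assoc, machine_run_add_one,
          changedBelow_add_one]
        exact h2
      · rw [stageCore, stageCore, machine_run_add_one, changedBelow_add_one]
        exact h1
  refine ⟨fun i => (f i).2, fun i => (hf i).1.core_eq, ?_⟩
  have := Diverge.loop (I := fun i => Nat.casesOn i I₀ fun i => coreInv z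
    (Between (stageCore p x (a + i)) (stageCore p x (a + i + 1))))
    (c := fun i => tapeOf z (f i).2) (t := fun _ => true) (P := simStep)
    (fun i => 12 * (f i).1) (fun i => Exec.inv_start (hf i).2) (fun _ => rfl) (fun i => (hf i).2)
  rw [h0] at this
  exact this

/-- If the simulated machine halts, the simulation accepts. -/
theorem stops_mainLoop {a : Ordinal.{0}} (i : ℕ) {m : Memory} {k : ℕ}
    (h : RepresentsStage p x m a)
    (hn : ∀ j : ℕ, j < i → (p.machine.run x (a + j + 1)).state ≠ IState.halt)
    (hh : (p.machine.run x (a + i + 1)).state = IState.halt) : Stops z mainLoop k m true := by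
  induction i generalizing a m k with
  | zero =>
    rw [Nat.cast_zero, add_zero, machine_run_add_one] at hh
    obtain ⟨h', T', h1, h2⟩ := stops_simStep (z := z) h hh k
    exact ⟨h', T', .loopHalt trivial rfl h1, h2⟩
  | succ i ih =>
    have h0 := hn 0 (by omega)
    rw [Nat.cast_zero, add_zero, machine_run_add_one] at h0
    obtain ⟨k', m', h1, h2⟩ := runs_simStep (z := z) h h0 k
    have hcast : ∀ j : ℕ, a + 1 + j = a + (j + 1 : ℕ) := fun j => by
      rw [add_assoc, ← Nat.cast_one, ← Nat.cast_add, add_comm 1 j]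
    have h3 : RepresentsStage p x m' (a + 1) := by
      rw [RepresentsStage, machine_run_add_one, changedBelow_add_one]
      exact h2
    obtain ⟨h', T', h4, h5⟩ := ih (k := k') h3 (fun j hj => by
      rw [hcast]
      exact hn (j + 1) (by omega)) (by rwa [hcast])
    exact ⟨h', T', .loopStep trivial rfl h1.exec h4, h5⟩

theorem hasCode_of_core {b : Memory} {m : Memory} {a : Config (IState (Fin n))} {g : Bool}
    (hb : b = phaseMem p.code x true true true) (h : core m = simCore b a g) :
    HasCode m (groupsOf p) := by
  subst hb
  have h1 : m Field.code = p.code := by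
    rw [← core_apply m (v := Field.code) rfl, h]
    rfl
  have h2 := (eq_code_iff (p := p) (c := p.code)).1 rfl
  refine ⟨?_, (validGroups_groupsOf p).length, ?_, ?_⟩
  · rw [LeftOK, ← core_apply m (v := Field.left) rfl, h]
    rfl
  · rw [h1, progBits_groupsOf]
    exact h2.1
  · rw [h1, progBits_groupsOf]
    exact h2.2

theorem runs_beginSim {K : Memory → Prop} {m : Memory} (hK : K (core m)) (hL : LeftOK m) :
    ∃ m', Runs z K beginSim 0 m 0 m' ∧ core m' = core m ∧ FirstMark (m' Field.markH) 0 ∧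
      FirstMark (m' Field.markP) 0 := by
  obtain ⟨f, h1, h2⟩ := runs_place (z := z) hK hL (v := Field.markH) rfl 0
  have hc : core (Function.update m Field.markH f) = core m := core_update_mark m rfl f
  obtain ⟨g, h3, h4⟩ := runs_place (z := z) (K := K) (by rwa [hc]) (hL.congr hc)
    (v := Field.markP) rfl 0
  refine ⟨_, h2.seq h4, by rw [core_update_mark _ rfl, hc], ?_, ?_⟩
  · simpa using h1
  · simpa using h3

/-- At a limit stage of the simulation, the simulated configuration is completed. -/
theorem runs_resume {m : Memory} {a : Ordinal.{0}} (ha : Order.IsSuccLimit a)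
    (h : core m = stageCore p x a) :
    ∃ m', Runs z (fun M => M = stageCore p x a) (beginSim ;; advance ;; advance) 0 m 0 m' ∧
      RepresentsStage p x m' a := by
  have hc := hasCode_of_core rfl h
  obtain ⟨m₁, r₁, c₁, h₁, p₁⟩ := runs_beginSim (z := z) (K := fun M => M = stageCore p x a) h hc.left
  have hc₁ := hc.congr c₁
  have hlen := length_groupsOf p
  obtain ⟨m₂, r₂, o₂, p₂, -⟩ := runs_advance (z := z) (K := fun M => M = stageCore p x a) (r := 0)
    (by rw [c₁, h]) hc₁ (by omega) (by simpa [statePos, progBits] using p₁) 0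
  have hc₂ := hc₁.congr o₂.core_eq
  obtain ⟨m₃, r₃, o₃, p₃, -⟩ := runs_advance (z := z) (K := fun M => M = stageCore p x a) (r := 1)
    (by rw [o₂.core_eq, c₁, h]) hc₂ (by omega) p₂ 0
  have hrun := run_limit_eq p.machine x ha
  refine ⟨m₃, r₁.seq (r₂.seq r₃), ⟨?_, hc₂.congr o₃.core_eq, ?_, ?_⟩⟩
  · rw [o₃.core_eq, o₂.core_eq, c₁, h]
    rfl
  · rw [o₃ _ (by simp) (by simp), o₂ _ (by simp) (by simp), hrun]
    exact h₁
  · rw [hrun]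
    exact p₃

end Simulate

/-! ### Every computation repeats itself from some countable stage on -/

theorem exists_of_lt_add {a b g : Ordinal.{0}} (hb : b < a + g) :
    b < a ∨ ∃ c < g, b = a + c := by
  rcases lt_or_ge b a with h | h
  · exact Or.inl h
  · obtain ⟨c, rfl⟩ := exists_add_of_le h
    exact Or.inr ⟨c, (add_lt_add_iff_left a).1 hb, rfl⟩

theorem tape_add_limit {S : Type} (M : Machine S) (x : Cantor) (a : Ordinal.{0}) {g : Ordinal.{0}}
    (hg : Order.IsSuccLimit g) (t : Track) (k : ℕ) :
    (M.run x (a + g)).tape t k = true ↔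
      ∀ c < g, ∃ d < g, c ≤ d ∧ (M.run x (a + d)).tape t k = true := by
  rw [tape_limit M x (Ordinal.isSuccLimit_add a hg)]
  constructor
  · intro h c hc
    obtain ⟨b, hb, h1, h2⟩ := h (a + c) ((add_lt_add_iff_left a).2 hc)
    rcases exists_of_lt_add hb with h3 | ⟨d, hd, rfl⟩
    · exact absurd (lt_of_le_of_lt h1 h3) (not_lt.2 le_self_add)
    · exact ⟨d, hd, by simpa using h1, h2⟩
  · intro h b hb
    rcases exists_of_lt_add hb with h3 | ⟨c, hc, rfl⟩
    · obtain ⟨d, hd, -, h2⟩ := h 0 hg.pos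
      exact ⟨a + d, (add_lt_add_iff_left a).2 hd, h3.le.trans le_self_add, h2⟩
    · obtain ⟨d, hd, h1, h2⟩ := h c hc
      exact ⟨a + d, (add_lt_add_iff_left a).2 hd, by simpa using h1, h2⟩

section Loop

open Ordinal

variable {n : ℕ} (p : Program n) (x : Cantor)

theorem machine_run_limit {l : Ordinal.{0}} (hl : Order.IsSuccLimit l) :
    p.machine.run x l = ⟨IState.limit, 0, (p.machine.run x l).tape⟩ :=
  run_limit_eq _ x hl

/-- The configuration at a stage determines the rest of the computation, because the machine enters
the same state at all limit stages. -/
theorem run_add_congr {a b : Ordinal.{0}} (h : p.machine.run x a = p.machine.run x b)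
    (c : Ordinal.{0}) : p.machine.run x (a + c) = p.machine.run x (b + c) := by
  induction c using Ordinal.limitRecOn with
  | zero => simpa using h
  | add_one c ih => rw [← add_assoc, ← add_assoc, machine_run_add_one, machine_run_add_one, ih]
  | limit c hc ih =>
    rw [machine_run_limit p x (isSuccLimit_add a hc), machine_run_limit p x (isSuccLimit_add b hc)]
    congr 1
    funext t k
    rw [Bool.eq_iff_iff, tape_add_limit _ _ _ hc, tape_add_limit _ _ _ hc]
    refine forall₂_congr fun d _ => exists_congr fun e => and_congr_right fun he => ?_
    rw [ih e he]

instance : Countable Track :=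
  ⟨⟨fun | Track.input => 0 | Track.scratch => 1 | Track.output => 2, by
    rintro (_ | _ | _) (_ | _ | _) h <;> first | rfl | cases h⟩⟩

theorem exists_bound_lt_omega_one {ι : Type} [Countable ι] {f : ι → Ordinal.{0}}
    (hf : ∀ i, f i < ω₁) : ∃ s < ω₁, ∀ i, f i ≤ s :=
  ⟨⨆ i, f i, iSup_lt_omega_one hf, Ordinal.le_iSup f⟩

/-- The configuration at stage `ω₁` occurs before `ω₁`, and the cells that show 0 in it show 0 ever
after. This is a closing-off argument: the supremum of countably many countable stages is
countable. -/
theorem exists_run_eq_omega_one {d : Ordinal.{0}} (hd : d < ω₁) :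
    ∃ l, d ≤ l ∧ l < ω₁ ∧ p.machine.run x l = p.machine.run x ω₁ ∧
      ∀ t k, (p.machine.run x ω₁).tape t k = false →
        ∀ b, l ≤ b → b < ω₁ → (p.machine.run x b).tape t k = false := by
  have hlim : Order.IsSuccLimit ω₁ := Cardinal.isSuccLimit_omega 1
  -- a stage after which the cells with limit value 0 show 0
  have h0 : ∀ c : Track × ℕ, ∃ a < ω₁, (p.machine.run x ω₁).tape c.1 c.2 = false →
      ∀ b, a ≤ b → b < ω₁ → (p.machine.run x b).tape c.1 c.2 = false := by
    rintro ⟨t, k⟩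
    by_cases h : (p.machine.run x ω₁).tape t k = false
    · have h' := h
      rw [← Bool.not_eq_true, tape_limit _ _ hlim] at h'
      push Not at h'
      obtain ⟨a, ha, h'⟩ := h'
      exact ⟨a, ha, fun _ b h1 h2 => by simpa using h' b h2 h1⟩
    · exact ⟨0, hlim.pos, fun h' => absurd h' h⟩
  choose f hf hf0 using h0
  obtain ⟨s, hs, hfs⟩ := exists_bound_lt_omega_one hf
  -- between `a` and `g a`, each cell with limit value 1 shows 1 at some stage
  have h1 : ∀ a : Ordinal.{0}, ∃ b, a < ω₁ → a < b ∧ b < ω₁ ∧ ∀ t k,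
      (p.machine.run x ω₁).tape t k = true →
        ∃ e, a ≤ e ∧ e < b ∧ (p.machine.run x e).tape t k = true := by
    intro a
    by_cases ha : a < ω₁
    · have h2 : ∀ c : Track × ℕ, ∃ e < ω₁, (p.machine.run x ω₁).tape c.1 c.2 = true →
          a ≤ e ∧ (p.machine.run x e).tape c.1 c.2 = true := by
        rintro ⟨t, k⟩
        by_cases h : (p.machine.run x ω₁).tape t k = true
        · obtain ⟨e, he, h3, h4⟩ := (tape_limit _ _ hlim t k).1 h a ha
          exact ⟨e, he, fun _ => ⟨h3, h4⟩⟩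
        · exact ⟨0, hlim.pos, fun h' => absurd h' h⟩
      choose e he he' using h2
      obtain ⟨b, hb, heb⟩ := exists_bound_lt_omega_one he
      refine ⟨max a b + 1, fun _ => ⟨Order.lt_add_one_iff.2 (le_max_left _ _),
        hlim.add_one_lt (max_lt ha hb), fun t k h => ?_⟩⟩
      exact ⟨e (t, k), (he' (t, k) h).1,
        Order.lt_add_one_iff.2 ((heb (t, k)).trans (le_max_right _ _)), (he' (t, k) h).2⟩
    · exact ⟨0, fun h => absurd h ha⟩
  choose g hg using h1
  let u : ℕ → Ordinal.{0} := fun i => g^[i] (max d s)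
  have hu : ∀ i, u (i + 1) = g (u i) := fun i => Function.iterate_succ_apply' ..
  have hlt : ∀ i, u i < ω₁ := by
    intro i
    induction i with
    | zero => exact max_lt hd hs
    | succ i ih => rw [hu]; exact (hg _ ih).2.1
  have hstep : ∀ i, u i < u (i + 1) := fun i => by rw [hu]; exact (hg _ (hlt i)).1
  have hle : ∀ i, u i ≤ ⨆ i, u i := Ordinal.le_iSup u
  have hl : Order.IsSuccLimit (⨆ i, u i) := by
    rw [isSuccLimit_iff, Order.isSuccPrelimit_iff_succ_lt]
    refine ⟨((zero_le (a := u 0)).trans_lt ((hstep 0).trans_le (hle 1))).ne', fun a ha => ?_⟩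
    obtain ⟨i, hi⟩ := Ordinal.lt_iSup_iff.1 ha
    exact (Order.succ_le_of_lt hi).trans_lt ((hstep i).trans_le (hle _))
  have hsl : max d s ≤ ⨆ i, u i := hle 0
  have hzero : ∀ t k, (p.machine.run x ω₁).tape t k = false →
      ∀ b, (⨆ i, u i) ≤ b → b < ω₁ → (p.machine.run x b).tape t k = false := fun t k h b h1 h2 =>
    hf0 (t, k) h b ((hfs (t, k)).trans ((le_max_right d s).trans (hsl.trans h1))) h2
  have hbound : (⨆ i, u i) < ω₁ := iSup_lt_omega_one hlt
  refine ⟨⨆ i, u i, (le_max_left d s).trans hsl, hbound, ?_, hzero⟩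
  rw [machine_run_limit p x hl, machine_run_limit p x hlim]
  congr 1
  funext t k
  cases h : (p.machine.run x ω₁).tape t k with
  | false => exact hzero t k h _ le_rfl hbound
  | true =>
    rw [tape_limit _ _ hl]
    intro a ha
    obtain ⟨i, hi⟩ := Ordinal.lt_iSup_iff.1 ha
    obtain ⟨e, h1, h2, h3⟩ := (hg (u i) (hlt i)).2.2 t k h
    rw [← hu] at h2
    exact ⟨e, h2.trans_le (hle _), hi.le.trans h1, h3⟩

/-- From some countable stage on, the computation is periodic with period `ω₁`. -/
theorem exists_period {d : Ordinal.{0}} (hd : d < ω₁) :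
    ∃ l, d ≤ l ∧ l < ω₁ ∧
      ∀ c, ∃ e < ω₁, e ≤ c ∧ p.machine.run x (l + c) = p.machine.run x (l + e) := by
  obtain ⟨l, hdl, hl, heq, hzero⟩ := exists_run_eq_omega_one p x hd
  have hadd : l + ω₁ = ω₁ := (isPrincipal_add_omega 1).add_eq_right hl
  have hpos : (0 : Ordinal.{0}) < ω₁ := omega_pos 1
  have key : ∀ v, p.machine.run x (l + ω₁ * v) = p.machine.run x l := by
    intro v
    induction v using Ordinal.limitRecOn with
    | zero => simp
    | add_one v ih =>
      rw [mul_add_one, ← add_assoc, run_add_congr p x ih, hadd, heq]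
    | limit v hv ih =>
      have hlim : Order.IsSuccLimit (ω₁ * v) := isSuccLimit_mul_right hpos hv
      rw [machine_run_limit p x (isSuccLimit_add l hlim), heq,
        machine_run_limit p x (Cardinal.isSuccLimit_omega 1)]
      congr 1
      funext t k
      rw [Bool.eq_iff_iff, tape_add_limit _ _ _ hlim]
      constructor
      · intro h
        by_contra hne
        obtain ⟨e, he, -, h1⟩ := h 0 hlim.pos
        obtain ⟨q, hq, r, hr, rfl⟩ := lt_mul_iff.1 he
        rw [← add_assoc, run_add_congr p x (ih q hq),
          hzero t k (by simpa using hne) _ le_self_add ?_] at h1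
        · cases h1
        · rw [← hadd]
          exact (add_lt_add_iff_left l).2 hr
      · intro h c hc
        obtain ⟨q, hq, h1⟩ := (lt_mul_iff_of_isSuccLimit hv).1 hc
        refine ⟨ω₁ * q, (mul_lt_mul_iff_right₀ hpos).2 hq, h1.le, ?_⟩
        rw [ih q hq, heq]
        exact h
  refine ⟨l, hdl, hl, fun c => ⟨c % ω₁, mod_lt c hpos.ne', ?_, ?_⟩⟩
  · conv_rhs => rw [← div_add_mod c ω₁]
    exact le_add_self
  · conv_lhs => rw [← div_add_mod c ω₁]
    rw [← add_assoc, run_add_congr p x (key _)]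

variable {p x}

theorem lt_omega_one_of_haltsAt {a : Ordinal.{0}} (h : p.machine.HaltsAt x a) : a < ω₁ := by
  by_contra ha
  obtain ⟨l, -, hl, hper⟩ := exists_period p x (omega_pos 1)
  obtain ⟨c, rfl⟩ := exists_add_of_le (hl.le.trans (not_lt.1 ha))
  obtain ⟨e, he, -, heq⟩ := hper c
  refine h.1 (l + e) (lt_of_lt_of_le (isPrincipal_add_omega 1 hl he) (not_lt.1 ha)) ?_
  rw [← heq]
  exact h.2

theorem Machine.isStage_of_not_halts {S : Type} {M : Machine S} {y : Cantor} (h : ¬ M.Halts y)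
    (a : Ordinal.{0}) : M.IsStage y a := by
  induction a using WellFoundedLT.induction with
  | _ a ih => exact fun b hb hh => h ⟨b, ih b hb, hh⟩

theorem Machine.stabilizes_of_halts {S : Type} {M : Machine S} {y : Cantor} (h : M.Halts y) :
    M.Stabilizes y := by
  obtain ⟨a, h1, h2⟩ := h
  refine ⟨a, h1, fun b hab hb => ?_⟩
  rcases hab.eq_or_lt with rfl | hlt
  · rfl
  · exact absurd h2 (hb a hlt)

theorem output_add_one_eq_iff {a : Ordinal.{0}} :
    (p.machine.run x (a + 1)).tape Track.output = (p.machine.run x a).tape Track.output ↔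
      (p.machine.run x a).changes p = false := by
  rw [machine_run_add_one]
  set c := p.machine.run x a
  simp only [Config.changes, bne_eq_false_iff_eq,
    show c.scanned = fun t => c.tape t c.head from rfl]
  constructor
  · intro h
    have := congrFun h c.head
    simpa [Config.step] using this
  · intro h
    funext k
    by_cases hk : k = c.head
    · subst hk
      simpa [Config.step] using h
    · simp [Config.step, hk]

theorem output_eq_of_no_change {a : Ordinal.{0}} (c : Ordinal.{0})
    (h : ∀ e < c, (p.machine.run x (a + e)).changes p = false) :
    (p.machine.run x (a + c)).tape Track.output = (p.machine.run x a).tape Track.output := by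
  induction c using Ordinal.limitRecOn with
  | zero => simp
  | add_one c ih =>
    rw [← add_assoc, output_add_one_eq_iff.2 (h c (lt_add_one c)),
      ih fun e he => h e (he.trans (lt_add_one c))]
  | limit c hc ih =>
    have ih' : ∀ e < c, (p.machine.run x (a + e)).tape Track.output =
        (p.machine.run x a).tape Track.output := fun e he =>
      ih e he fun i hi => h i (hi.trans he)
    funext k
    rw [Bool.eq_iff_iff, tape_add_limit _ _ _ hc]
    constructor
    · intro h1
      obtain ⟨e, he, -, h2⟩ := h1 0 hc.pos
      rwa [ih' e he] at h2
    · intro h1 e he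
      exact ⟨e, he, le_rfl, by rwa [ih' e he]⟩

/-- The output of a computation that does not halt stabilizes if and only if it is constant from
some countable stage up to `ω₁`. -/
theorem stabilizes_iff (hn : ¬ p.machine.Halts x) :
    p.machine.Stabilizes x ↔ changedBelow p x ω₁ = false := by
  have hpos : (0 : Ordinal.{0}) < ω₁ := omega_pos 1
  have hst := Machine.isStage_of_not_halts hn
  rw [← Bool.not_eq_true]
  simp only [changedBelow, decide_eq_true_eq]
  constructor
  · rintro ⟨a, -, ha⟩ ⟨-, hc⟩
    -- a stage before `ω₁` from which on the output does not change
    obtain ⟨l, -, hl, hper⟩ := exists_period p x hpos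
    obtain ⟨e, he, -, heq⟩ := hper a
    obtain ⟨b, hb, h1, h2⟩ := hc (l + e) (isPrincipal_add_omega 1 hl he)
    obtain ⟨d, rfl⟩ := exists_add_of_le h1
    have h3 : ∀ i, a ≤ l + a + i := fun i => (le_add_self (a := a)).trans le_self_add
    have h4 := ha _ (h3 (d + 1)) (hst _)
    rw [← ha _ (h3 d) (hst _), ← add_assoc, output_add_one_eq_iff,
      run_add_congr p x heq, h2] at h4
    cases h4
  · intro h
    push Not at h
    obtain ⟨b, hb, h⟩ := h hpos.ne'
    obtain ⟨l, hbl, hl, hper⟩ := exists_period p x hb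
    refine ⟨l, hst _, fun a ha _ => ?_⟩
    obtain ⟨c, rfl⟩ := exists_add_of_le ha
    refine output_eq_of_no_change c fun e _ => ?_
    obtain ⟨e', he', -, heq⟩ := hper e
    rw [heq]
    simpa using h (l + e') (isPrincipal_add_omega 1 hl he') (hbl.trans le_self_add)

end Loop


/-! ### Limits of the memory -/

theorem eq_tapeOf_memOf_iff {z : Cantor} {T : Tape} :
    T = tapeOf z (memOf T) ↔ T Track.input = z ∧ ∀ k, T Track.output k = false := by
  constructor
  · intro h
    rw [h]
    exact ⟨rfl, fun _ => rfl⟩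
  · rintro ⟨h1, h2⟩
    funext t k
    cases t with
    | input => rw [h1]; rfl
    | output => rw [h2]; rfl
    | scratch =>
      have h3 : k % 12 < 12 := Nat.mod_lt _ (by norm_num)
      have h4 : (Field.at' (k % 12)).off = k % 12 := by
        generalize k % 12 = i at h3
        interval_cases i <;> rfl
      simp only [tapeOf, memOf, h4]
      rw [Nat.div_add_mod]

section Limit

variable {S : Type} {M : Machine S} {z : Cantor}

theorem tapeOf_limit {l : Ordinal.{0}} (hl : Order.IsSuccLimit l) {a : Ordinal.{0}} (ha : a < l)
    (h : ∀ b, a ≤ b → b < l → (M.run z b).tape = tapeOf z (memOf (M.run z b).tape)) :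
    (M.run z l).tape = tapeOf z (memOf (M.run z l).tape) := by
  simp only [eq_tapeOf_memOf_iff] at h ⊢
  constructor
  · funext k
    rw [Bool.eq_iff_iff, tape_limit _ _ hl]
    constructor
    · intro h1
      obtain ⟨b, hb, h2, h3⟩ := h1 a ha
      rwa [(h b h2 hb).1] at h3
    · intro h1 b hb
      exact ⟨max a b, max_lt ha hb, le_max_right _ _, by
        rwa [(h _ (le_max_left _ _) (max_lt ha hb)).1]⟩
  · intro k
    rw [← Bool.not_eq_true, tape_limit _ _ hl]
    intro h1
    obtain ⟨b, hb, h2, h3⟩ := h1 a ha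
    rw [(h b h2 hb).2] at h3
    cases h3

/-- The memory after a phase in which it eventually does not change, apart from its marks. -/
theorem exists_memory_of_rounds {a : Ordinal.{0}} {I : ℕ → Tape → Prop} {c : ℕ → Tape}
    {n : ℕ → ℕ} (h : Rounds (fun k => (M.run z (a + k)).tape) I c n) {Y : Memory}
    (hI : ∀ i T, I (i + 1) T → coreInv z (fun X => X = Y) T) :
    ∃ m, (M.run z (a + Ordinal.omega0)).tape = tapeOf z m ∧ core m = Y := by
  have hev : ∀ k, n 1 ≤ k → coreInv z (fun X => X = Y) (M.run z (a + k)).tape := by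
    intro k hk
    obtain ⟨j, h1, h2⟩ := h.eventually 1 k hk
    obtain ⟨j, rfl⟩ := Nat.exists_eq_add_of_le' h1
    exact hI j _ h2
  refine ⟨_, tapeOf_limit (isSuccLimit_add_omega a)
    ((add_lt_add_iff_left a).2 (Ordinal.natCast_lt_omega0 (n 1))) fun b h1 h2 => ?_, ?_⟩
  · rcases exists_of_lt_add_omega h2 with h3 | ⟨k, rfl⟩
    · exact absurd (h1.trans_lt h3) (not_lt.2 le_self_add)
    · exact (hev k (by simpa using h1)).1
  · funext v k
    by_cases hv : v.isMark = true
    · rw [← (hev _ le_rfl).2]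
      simp [core, hv]
    · rw [core_apply _ (by simpa using hv), memOf, Bool.eq_iff_iff, tape_add_omega]
      have hev' : ∀ i, n 1 ≤ i →
          (M.run z (a + i)).tape Track.scratch (12 * k + v.off) = Y v k := fun i hi => by
        rw [← (hev i hi).2, core_apply _ (by simpa using hv)]
        rfl
      constructor
      · intro h1
        obtain ⟨i, hi, h2⟩ := h1 (n 1)
        rwa [hev' i hi] at h2
      · intro h1 N
        exact ⟨max N (n 1), le_max_left _ _, by rwa [hev' _ (le_max_right _ _)]⟩

/-- A program that halts with answer `b` makes the machine halt with that output. -/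
theorem haltsWith_of_stops {a : Ordinal.{0}} {P : Code} {s : S} {m : Memory} {b : Bool}
    (ha : M.IsStage z a) (hs : Starts M.table M.halt P s) (hr : M.run z a = ⟨s, 0, tapeOf z m⟩)
    (h : Stops z P 0 m b) : M.HaltsWith z fun k => decide (k = 0 ∧ b = true) := by
  obtain ⟨h', T', h1, h2⟩ := h
  obtain ⟨n, h3, h4⟩ := haltsAt_of_exec ha hs hr h1
  exact ⟨a + n, h3, by rw [h4, h2]⟩

end Limit

/-! ### The phases of the computation at limit stages -/

section Phases

variable {z c x : Cantor} {m : Memory}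

theorem stops_atLimit {b : Bool}
    (h : Stops z (limitBranch (m Field.checked 0) (m Field.scanned 0) (m Field.copied 0)) 0 m b) :
    Stops z atLimit 0 m b :=
  stops_onBit (stops_onBit (stops_onBit h))

theorem diverge_atLimit {I : ℕ → Tape → Prop} {t : ℕ → Tape} (hI : I 0 (tapeOf z m))
    (h : Diverge I t (limitBranch (m Field.checked 0) (m Field.scanned 0) (m Field.copied 0)) 0
      (tapeOf z m)) : Diverge I t atLimit 0 (tapeOf z m) := by
  have hbit : ∀ v : Field, tapeOf z m Track.scratch (0 + v.off) = m v 0 := fun v => by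
    simpa using tapeOf_scratch z m v 0
  refine diverge_onBit hI (diverge_onBit hI (diverge_onBit hI ?_))
  rwa [hbit, hbit, hbit]

theorem flags_of_core {b₁ b₂ b₃ : Bool} (h : core m = phaseMem c x b₁ b₂ b₃) :
    m Field.copied 0 = b₁ ∧ m Field.scanned 0 = b₂ ∧ m Field.checked 0 = b₃ := by
  refine ⟨?_, ?_, ?_⟩
  · rw [← core_apply m (v := Field.copied) rfl, h]; simp [phaseMem]
  · rw [← core_apply m (v := Field.scanned) rfl, h]; simp [phaseMem]
  · rw [← core_apply m (v := Field.checked) rfl, h]; simp [phaseMem]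

theorem code_of_core {b₁ b₂ b₃ : Bool} (h : core m = phaseMem c x b₁ b₂ b₃) :
    m Field.code = c := by
  rw [← core_apply m (v := Field.code) rfl, h]
  rfl

theorem leftOK_of_core {b₁ b₂ b₃ : Bool} (h : core m = phaseMem c x b₁ b₂ b₃) : LeftOK m := by
  rw [LeftOK, ← core_apply m (v := Field.left) rfl, h]
  rfl

/-- No restriction in round 0, and memory `Y`, apart from its marks, in all later rounds. -/
def settles (z : Cantor) (Y : Memory) : ℕ → Tape → Prop
  | 0 => fun _ => True
  | _ + 1 => coreInv z fun X => X = Y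

theorem formatted_code {n : ℕ} (p : Program n) : Formatted p.code :=
  ⟨p.bits, eq_code_iff.1 rfl⟩

/-- The first limit stage: either `c` is recognized not to be a code, or the tail of `c` is
scanned. -/
theorem cases_scanPhase (h : core m = phaseMem c x false false false) :
    ((∃ t, Diverge (settles z (phaseMem c x true false false)) t atLimit 0 (tapeOf z m)) ∧
      ((∀ j, c (2 * j) = true) ∨ Formatted c)) ∨
    (Stops z atLimit 0 m false ∧ ¬ Formatted c) := by
  obtain ⟨m', h1, h2⟩ := runs_setCopied (z := z) h
  obtain ⟨f1, f2, f3⟩ := flags_of_core h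
  rcases cases_scanTail (z := z) (m := m') (J := fun X => X = phaseMem c x true false false) h2 with
    ⟨h3, h4⟩ | ⟨h3, h4⟩
  · rw [code_of_core h2] at h4
    refine Or.inl ⟨⟨fun _ => tapeOf z m', diverge_atLimit trivial ?_⟩, h4⟩
    rw [f1, f2, f3]
    refine .seqRight h1.exec (h3.mono fun i T hT => ?_)
    cases i with
    | zero => trivial
    | succ i => exact hT
  · rw [code_of_core h2] at h4
    refine Or.inr ⟨stops_atLimit ?_, h4⟩
    rw [f1, f2, f3]
    exact h1.seqStops h3

theorem changedBelow_zero {n : ℕ} (p : Program n) (x : Cantor) : changedBelow p x 0 = false := by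
  rw [← Bool.not_eq_true]
  simp [changedBelow]

theorem stageCore_zero {n : ℕ} (p : Program n) (x : Cantor) :
    stageCore p x 0 = phaseMem p.code x true true true := by
  rw [stageCore, changedBelow_zero, p.machine.run_zero]
  funext v k
  cases v <;> simp [simCore, phaseMem, Machine.init]

/-- At a limit stage with memory `m`, the main loop is started with memory `m₀`. The tapes have the
property `I₀` until then. -/
structure Enters (z : Cantor) (I₀ : Tape → Prop) (m m₀ : Memory) : Prop where
  diverge : ∀ I t, (∀ T, I₀ T → I 0 T) → Diverge I t mainLoop 0 (tapeOf z m₀) →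
    Diverge I t atLimit 0 (tapeOf z m)
  stops : ∀ b, Stops z mainLoop 0 m₀ b → Stops z atLimit 0 m b

/-- The second limit stage: either `c` has infinitely many marks, or it is recognized not to be a
code, or the simulation is started. -/
theorem cases_checkPhase (h : core m = phaseMem c x true false false)
    (hc : (∀ j, c (2 * j) = true) ∨ Formatted c) :
    (∃ t, Diverge (settles z (phaseMem c x true true false)) t atLimit 0 (tapeOf z m)) ∧
      ¬ Formatted c ∨
    Stops z atLimit 0 m false ∧ (∀ n (p : Program n), c ≠ p.code) ∨
    ∃ (n : ℕ) (p : Program n) (m₀ : Memory), c = p.code ∧ RepresentsStage p x m₀ 0 ∧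
      Enters z (fun _ => True) m m₀ := by
  obtain ⟨m₁, r₁, c₁⟩ := runs_setScanned (z := z) h
  obtain ⟨f1, f2, f3⟩ := flags_of_core h
  have hcode := code_of_core c₁
  by_cases hall : ∀ j, c (2 * j) = true
  · refine Or.inl ⟨⟨fun _ => tapeOf z m₁, diverge_atLimit trivial ?_⟩, ?_⟩
    · rw [f1, f2, f3]
      refine .seqLeft (.seqRight r₁.exec ((diverge_marks (z := z) (m := m₁)
        (J := fun X => X = phaseMem c x true true false) (by rwa [hcode]) c₁).mono
          fun i T hT => ?_))
      cases i with
      | zero => trivial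
      | succ i => exact hT
    · rintro ⟨l, -, h2⟩
      have := (h2 _ le_rfl).1
      rw [hall] at this
      cases this
  obtain ⟨l, hl, hb⟩ := hc.resolve_left hall
  rw [← hcode] at hl hb
  have hL := leftOK_of_core c₁
  have r₂ := r₁.seq (whileRuns_marks (z := z) (K := fun _ => True) trivial hl
    (by rw [zero_add]; exact (hb _ le_rfl).1)).runs
  have r₃ := runs_home (z := z) (K := fun _ => True) trivial hL (2 * (0 + l.length))
  rcases cases_check (z := z) (K := fun _ => True) trivial hL hl hb with
    ⟨gs, m₂, hgs, rfl, hm₂, off, r₄⟩ | ⟨hs, hne⟩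
  · obtain ⟨n, p, rfl⟩ := hgs.exists_program
    rw [progBits_groupsOf] at hl hb
    obtain rfl : c = p.code := by
      rw [← hcode]
      exact eq_code_iff.2 ⟨hl, hb⟩
    obtain ⟨m₃, r₅, c₃⟩ := runs_setChecked (z := z) (m := m₂) (off.core_eq.trans c₁)
    obtain ⟨m₄, r₆, c₄, hH, hP⟩ := runs_beginSim (z := z) (m := m₃) (K := fun _ => True) trivial
      (leftOK_of_core c₃)
    have c₅ : core m₄ = stageCore p x 0 := by rw [c₄, c₃, stageCore_zero]
    refine Or.inr (Or.inr ⟨n, p, m₄, rfl, ⟨c₅, hasCode_of_core rfl c₅, ?_, ?_⟩, ?_, ?_⟩)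
    · rw [p.machine.run_zero]
      exact hH
    · rw [p.machine.run_zero]
      simpa [statePos, progBits, Machine.init, Program.machine, IState.number] using hP
    · intro I t hI hd
      refine diverge_atLimit (hI _ trivial) ?_
      rw [f1, f2, f3]
      exact .seqRight (Exec.mono (fun T _ => hI T trivial) r₂)
        (.seqRight (Exec.mono (fun T _ => hI T trivial) (r₃.seq (r₄.seq (r₅.seq r₆)))) hd)
    · intro b hs
      refine stops_atLimit ?_
      rw [f1, f2, f3]
      exact r₂.seqStops ((r₃.seq (r₄.seq (r₅.seq r₆))).seqStops hs)
  · refine Or.inr (Or.inl ⟨stops_atLimit ?_, ?_⟩)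
    · rw [f1, f2, f3]
      exact r₂.seqStops (Stops.seq (r₃.seqStops hs.seq))
    · rintro n p rfl
      refine hne _ (validGroups_groupsOf p) ?_
      rw [progBits_groupsOf]
      have h2 := eq_code_iff.1 hcode
      exact listAt_unique hl (by rwa [zero_add]) h2.1 (by rw [zero_add]; exact h2.2)

/-- At a limit stage of the simulation, the main loop is entered with the memory that represents
the simulated limit stage. -/
theorem exists_enters {n : ℕ} {p : Program n} {a : Ordinal.{0}} (ha : Order.IsSuccLimit a)
    (h : core m = stageCore p x a) :
    ∃ m₀, RepresentsStage p x m₀ a ∧ Enters z (coreInv z fun X => X = stageCore p x a) m m₀ := by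
  have hf : m Field.checked 0 = true := by
    rw [← core_apply m (v := Field.checked) rfl, h]
    rfl
  obtain ⟨m₀, h1, h2⟩ := runs_resume (z := z) ha h
  refine ⟨m₀, h2, ?_, ?_⟩
  · intro I t hI hd
    refine diverge_atLimit (hI _ (coreInv_tapeOf.2 h)) ?_
    rw [hf]
    exact .seqRight (Exec.mono hI h1) hd
  · intro b hs
    refine stops_atLimit ?_
    rw [hf]
    exact h1.seqStops hs

end Phases


/-! ### The simulation of `ω₁` many stages -/

section Simulation

open Ordinal

variable {n : ℕ} {p : Program n} {x z : Cantor}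

theorem changedBelow_limit {l : Ordinal.{0}} (hl : Order.IsSuccLimit l) :
    changedBelow p x l = true ↔ ∀ a < l, ∃ b < l, a ≤ b ∧ changedBelow p x b = true := by
  constructor
  · intro h a ha
    simp only [changedBelow, decide_eq_true_eq] at h
    obtain ⟨b, hb, h1, h2⟩ := h.2 a ha
    exact ⟨b + 1, hl.add_one_lt hb, h1.trans (le_add_right le_rfl), by
      rwa [changedBelow_add_one]⟩
  · intro h
    simp only [changedBelow, decide_eq_true_eq]
    refine ⟨hl.ne_bot, fun a ha => ?_⟩
    obtain ⟨b, hb, h1, h2⟩ := h (a + 1) (hl.add_one_lt ha)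
    simp only [changedBelow, decide_eq_true_eq] at h2
    obtain ⟨b', h3, h4, h5⟩ := h2.2 a ((lt_add_one a).trans_le h1)
    exact ⟨b', h3.trans hb, h4, h5⟩

/-- The memory of the simulation obeys the limsup rule. -/
theorem stageCore_limit {l : Ordinal.{0}} (hl : Order.IsSuccLimit l) (v : Field) (k : ℕ) :
    stageCore p x l v k = true ↔ ∀ a < l, ∃ b < l, a ≤ b ∧ stageCore p x b v k = true := by
  have hconst : ∀ b : Bool, b = true ↔ ∀ a < l, ∃ b' < l, a ≤ b' ∧ b = true := fun b =>
    ⟨fun h a ha => ⟨a, ha, le_rfl, h⟩, fun h => let ⟨_, _, _, h1⟩ := h 0 hl.pos; h1⟩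
  cases v with
  | simInput => exact tape_limit _ _ hl _ _
  | simScratch => exact tape_limit _ _ hl _ _
  | simOutput => exact tape_limit _ _ hl _ _
  | changed =>
    by_cases hk : k = 0
    · simpa [stageCore, simCore, hk] using changedBelow_limit hl
    · simpa [stageCore, simCore, hk] using ⟨0, hl.pos⟩
  | _ => exact hconst _

/-- The properties of the tapes in the rounds of the simulation of the stages from `a` to `a + ω`.
If `a = 0`, the time before the first round is exempt, because the tapes are still being prepared. -/
def blockInv (p : Program n) (x z : Cantor) (a : Ordinal.{0}) : ℕ → Tape → Prop
  | 0 => fun T => a ≠ 0 → coreInv z (fun X => X = stageCore p x a) T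
  | i + 1 => coreInv z (Between (stageCore p x (a + i)) (stageCore p x (a + i + 1)))

/-- The tapes `f 0`, `f 1`, … simulate the stages from `a` to `a + ω`. -/
def SimBlock (p : Program n) (x z : Cantor) (f : ℕ → Tape) (a : Ordinal.{0}) : Prop :=
  ∃ c r, Rounds f (blockInv p x z a) c r ∧
    ∀ i : ℕ, ∃ m, c i = tapeOf z m ∧ core m = stageCore p x (a + i)

theorem core_memOf_apply {T : Tape} {v : Field} (hv : v.isMark = false) {k : ℕ} :
    core (memOf T) v k = T Track.scratch (12 * k + v.off) := by
  rw [core_apply _ hv]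
  rfl

theorem SimBlock.exists_le {f : ℕ → Tape} {a : Ordinal.{0}} (h : SimBlock p x z f a) (i : ℕ) :
    ∃ k, i ≤ k ∧ ∀ v : Field, v.isMark = false → ∀ j,
      f k Track.scratch (12 * j + v.off) = stageCore p x (a + i) v j := by
  obtain ⟨c, r, h1, h2⟩ := h
  obtain ⟨m, h3, h4⟩ := h2 i
  refine ⟨r (i + 1), h1.add_le i, fun v hv j => ?_⟩
  rw [h1.tape, h3, tapeOf_scratch, ← core_apply m hv, h4]

theorem between_stageCore {a : Ordinal.{0}} {T : Tape} {i j : ℕ} (hij : i ≤ j)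
    (h : coreInv z (Between (stageCore p x (a + j)) (stageCore p x (a + j + 1))) T) {v : Field}
    (hv : v.isMark = false) {k : ℕ} (hT : T Track.scratch (12 * k + v.off) = true) :
    ∃ e : ℕ, i ≤ e ∧ stageCore p x (a + e) v k = true := by
  rw [← core_memOf_apply (T := T) hv] at hT
  rcases h.2 v k with h1 | h1
  · exact ⟨j, hij, by rw [← h1, hT]⟩
  · refine ⟨j + 1, hij.trans (Nat.le_succ j), ?_⟩
    rw [Nat.cast_succ, ← add_assoc, ← h1, hT]

theorem SimBlock.exists_stage {f : ℕ → Tape} {a : Ordinal.{0}} (h : SimBlock p x z f a) (i : ℕ) :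
    ∃ N, ∀ k, N ≤ k → f k = tapeOf z (memOf (f k)) ∧ ∀ v : Field, v.isMark = false → ∀ j,
      f k Track.scratch (12 * j + v.off) = true →
        ∃ e : ℕ, i ≤ e ∧ stageCore p x (a + e) v j = true := by
  obtain ⟨c, r, h1, -⟩ := h
  refine ⟨r (i + 1), fun k hk => ?_⟩
  obtain ⟨j, h2, h3⟩ := h1.eventually _ k hk
  obtain ⟨j, rfl⟩ : ∃ j', j = j' + 1 := ⟨j - 1, by omega⟩
  exact ⟨h3.1, fun v hv l hl => between_stageCore (by omega) h3 hv hl⟩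

theorem SimBlock.exists_stage_of_ne_zero {f : ℕ → Tape} {a : Ordinal.{0}}
    (h : SimBlock p x z f a) (ha : a ≠ 0) (k : ℕ) :
    f k = tapeOf z (memOf (f k)) ∧ ∀ v : Field, v.isMark = false → ∀ j,
      f k Track.scratch (12 * j + v.off) = true →
        ∃ e : ℕ, stageCore p x (a + e) v j = true := by
  obtain ⟨c, r, h1, -⟩ := h
  obtain ⟨j, h2, h3⟩ := h1.eventually 0 k (by rw [h1.zero]; omega)
  cases j with
  | zero =>
    have h4 := h3 ha
    refine ⟨h4.1, fun v hv l hl => ⟨0, ?_⟩⟩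
    rw [← core_memOf_apply (T := f k) hv, h4.2] at hl
    simpa using hl
  | succ j =>
    exact ⟨h3.1, fun v hv l hl =>
      let ⟨e, _, h5⟩ := between_stageCore (Nat.zero_le j) h3 hv hl; ⟨e, h5⟩⟩

variable {S : Type} {M : Machine S} {t : Ordinal.{0}}

theorem lt_omega0_mul {a b : Ordinal.{0}} (h : a < ω * b) :
    ∃ c < b, ∃ i : ℕ, a = ω * c + i := by
  obtain ⟨q, hq, r, hr, rfl⟩ := lt_mul_iff.1 h
  obtain ⟨i, rfl⟩ := lt_omega0.1 hr
  exact ⟨q, hq, i, rfl⟩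

theorem omega0_mul_add_lt {b c : Ordinal.{0}} (h : c < b) (i : ℕ) : ω * c + i < ω * b := by
  refine lt_of_lt_of_le ((add_lt_add_iff_left _).2 (natCast_lt_omega0 i)) ?_
  rw [← mul_add_one]
  exact mul_le_mul_right (Order.add_one_le_of_lt h) ω

theorem le_of_omega0_mul_add_le {b c : Ordinal.{0}} {i j : ℕ} (h : ω * b + i ≤ ω * c + j) :
    b < c ∨ (b = c ∧ i ≤ j) := by
  rcases lt_trichotomy b c with h1 | rfl | h1
  · exact Or.inl h1
  · exact Or.inr ⟨rfl, by simpa using h⟩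
  · exact absurd ((omega0_mul_add_lt h1 j).trans_le (le_self_add.trans h)) (lt_irrefl _)

theorem omega0_mul_add_le {b c : Ordinal.{0}} {i j : ℕ} (h : b < c ∨ (b = c ∧ i ≤ j)) :
    ω * b + i ≤ ω * c + j := by
  rcases h with h | ⟨rfl, h⟩
  · exact (omega0_mul_add_lt h i).le.trans le_self_add
  · simpa using h

/-- At a limit of blocks, the memory is that of the simulated limit stage. -/
theorem exists_memory_limit {b : Ordinal.{0}} (hb : b ≠ 0)
    (h : ∀ c < b, SimBlock p x z (fun k => (M.run z (t + ω * c + k)).tape) (ω * c)) :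
    ∃ m, (M.run z (t + ω * b)).tape = tapeOf z m ∧ core m = stageCore p x (ω * b) := by
  have hpos : 0 < b := pos_iff_ne_zero.2 hb
  have hl : Order.IsSuccLimit (ω * b) := isSuccLimit_mul_left isSuccLimit_omega0 hpos
  obtain ⟨N, hN⟩ := (h 0 hpos).exists_stage 0
  refine ⟨_, tapeOf_limit (isSuccLimit_add t hl)
    ((add_lt_add_iff_left t).2 (omega0_mul_add_lt hpos N)) fun d h1 h2 => ?_, ?_⟩
  · rcases exists_of_lt_add h2 with h3 | ⟨d, hd, rfl⟩
    · exact absurd (h1.trans_lt h3) (not_lt.2 le_self_add)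
    · obtain ⟨c, hc, k, rfl⟩ := lt_omega0_mul hd
      rw [← add_assoc]
      rcases le_of_omega0_mul_add_le ((add_le_add_iff_left t).1 h1) with h3 | ⟨rfl, h3⟩
      · exact ((h c hc).exists_stage_of_ne_zero (by simpa using h3.ne') k).1
      · exact (hN k h3).1
  · funext v k
    by_cases hv : v.isMark = true
    · cases v <;> first | rfl | cases hv
    replace hv : v.isMark = false := by simpa using hv
    rw [core_apply _ hv, memOf, Bool.eq_iff_iff, tape_add_limit _ _ _ hl, stageCore_limit hl]
    constructor
    · intro h1 a ha
      obtain ⟨c, hc, i, rfl⟩ := lt_omega0_mul ha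
      obtain ⟨N, hN⟩ := (h c hc).exists_stage i
      obtain ⟨d, hd, h2, h3⟩ := h1 _ (omega0_mul_add_lt hc N)
      obtain ⟨c', hc', k', rfl⟩ := lt_omega0_mul hd
      rw [← add_assoc] at h3
      rcases le_of_omega0_mul_add_le h2 with h4 | ⟨rfl, h4⟩
      · obtain ⟨e, h5⟩ := ((h c' hc').exists_stage_of_ne_zero
          (mul_ne_zero omega0_ne_zero (pos_of_gt h4).ne') k').2 v hv k h3
        exact ⟨_, omega0_mul_add_lt hc' e, omega0_mul_add_le (Or.inl h4), h5⟩
      · obtain ⟨e, h5, h6⟩ := (hN k' h4).2 v hv k h3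
        exact ⟨_, omega0_mul_add_lt hc e, omega0_mul_add_le (Or.inr ⟨rfl, h5⟩), h6⟩
    · intro h1 a ha
      obtain ⟨c, hc, i, rfl⟩ := lt_omega0_mul ha
      obtain ⟨d, hd, h2, h3⟩ := h1 _ ha
      obtain ⟨c', hc', i', rfl⟩ := lt_omega0_mul hd
      obtain ⟨k', h4, h5⟩ := (h c' hc').exists_le i'
      refine ⟨_, omega0_mul_add_lt hc' k', h2.trans (omega0_mul_add_le (Or.inr ⟨rfl, h4⟩)), ?_⟩
      rw [← add_assoc, h5 v hv, h3]

end Simulation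

section Blocks

open Ordinal

variable {n : ℕ} {p : Program n} {x z : Cantor} {Q : Type} {q : CProgram Q} {t : Ordinal.{0}}
  {m : Memory}

/-- The machine `q` has reached stage `t`, where the simulation starts. -/
structure Ready (q : CProgram Q) (p : Program n) (x z : Cantor) (t : Ordinal.{0}) (m : Memory) :
    Prop where
  lt : t < ω₁
  limit : Order.IsSuccLimit t
  starts : Starts q CState.halt atLimit CState.limit
  isStage : q.machine.IsStage z t
  tape : (q.machine.run z t).tape = tapeOf z m
  enters : ∃ m₀, RepresentsStage p x m₀ 0 ∧ Enters z (fun _ => True) m m₀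

theorem Ready.lt_omega_one (h : Ready q p x z t m) {b : Ordinal.{0}} (hb : b < ω₁) :
    t + ω * b < ω₁ :=
  isPrincipal_add_omega 1 h.lt (isPrincipal_mul_omega 1 omega0_lt_omega_one hb)

/-- The beginning of a block of the simulation, if the simulation has got so far. -/
theorem Ready.exists_enters (h : Ready q p x z t m) {b : Ordinal.{0}} (hb : b < ω₁)
    (hsim : ∀ c < b, SimBlock p x z (fun k => (q.machine.run z (t + ω * c + k)).tape) (ω * c)) :
    ∃ m' m₀, q.machine.run z (t + ω * b) = ⟨CState.limit, 0, tapeOf z m'⟩ ∧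
      RepresentsStage p x m₀ (ω * b) ∧ Enters z (blockInv p x z (ω * b) 0) m' m₀ := by
  have hlim : Order.IsSuccLimit (t + ω * b) := by
    rcases eq_or_ne b 0 with rfl | hb0
    · simpa using h.limit
    · exact isSuccLimit_add t (isSuccLimit_mul_left isSuccLimit_omega0 (pos_iff_ne_zero.2 hb0))
  rw [run_limit_eq _ _ hlim, limitState_of_lt q (h.lt_omega_one hb)]
  rcases eq_or_ne b 0 with rfl | hb0
  · obtain ⟨m₀, h1, h2⟩ := h.enters
    rw [mul_zero, add_zero]
    refine ⟨m, m₀, by rw [h.tape], h1, fun I s hI => h2.diverge I s fun T _ => hI T ?_, h2.stops⟩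
    exact fun h0 => absurd rfl h0
  · obtain ⟨m', h1, h2⟩ := exists_memory_limit hb0 hsim
    have hl : Order.IsSuccLimit (ω * b) :=
      isSuccLimit_mul_left isSuccLimit_omega0 (pos_iff_ne_zero.2 hb0)
    obtain ⟨m₀, h3, h4⟩ := CRITTM.exists_enters (z := z) hl h2
    refine ⟨m', m₀, by rw [h1], h3, fun I s hI => h4.diverge I s fun T hT => hI T ?_, h4.stops⟩
    exact fun _ => hT

theorem Ready.isStage_of_blocks (h : Ready q p x z t m) {b : Ordinal.{0}}
    (hs : ∀ c < b, q.machine.IsStage z (t + ω * (c + 1))) : q.machine.IsStage z (t + ω * b) := by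
  intro d hd
  rcases exists_of_lt_add hd with h1 | ⟨e, he, rfl⟩
  · exact h.isStage d h1
  · obtain ⟨c, hc, i, rfl⟩ := lt_omega0_mul he
    exact hs c hc _ ((add_lt_add_iff_left t).2 (omega0_mul_add_lt (lt_add_one c) i))

/-- As long as the simulated computation goes on, so does the simulation. -/
theorem Ready.block (h : Ready q p x z t m) {b : Ordinal.{0}} (hb : b < ω₁)
    (hp : p.machine.IsStage x (ω * (b + 1))) :
    q.machine.IsStage z (t + ω * (b + 1)) ∧
      SimBlock p x z (fun k => (q.machine.run z (t + ω * b + k)).tape) (ω * b) := by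
  induction b using WellFoundedLT.induction with
  | _ b ih =>
    have ih' : ∀ c < b, _ := fun c hc => ih c hc (hc.trans hb)
      (isStage_of_le hp (mul_le_mul_right (add_le_add_left hc.le 1) ω))
    obtain ⟨m', m₀, h1, h2, h3⟩ := h.exists_enters hb fun c hc => (ih' c hc).2
    obtain ⟨f, h4, h5⟩ := diverge_mainLoop (z := z) (k := 0) h2 (fun i => hp _ (by
      have := omega0_mul_add_lt (lt_add_one b) (i + 1)
      rwa [Nat.cast_succ, ← add_assoc] at this)) (blockInv p x z (ω * b) 0)
    have h6 := h3.diverge (blockInv p x z (ω * b)) _ (fun T hT => hT)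
      (h5.mono fun i T hT => by cases i <;> exact hT)
    obtain ⟨h7, r, h8⟩ := isStage_of_diverge (M := q.machine)
      (h.isStage_of_blocks fun c hc => (ih' c hc).1) h.starts h1 h6
    exact ⟨by rwa [mul_add_one, ← add_assoc], _, r, h8, fun i => ⟨f i, rfl, h4 i⟩⟩

/-- If the simulated computation halts, the answer is 1. -/
theorem Ready.haltsWith_of_halts (h : Ready q p x z t m) (hp : p.machine.Halts x) :
    q.machine.HaltsWith z fun k => decide (k = 0 ∧ true = true) := by
  obtain ⟨a, ha⟩ := hp
  have hlt := lt_omega_one_of_haltsAt ha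
  obtain ⟨b, hb, i, rfl⟩ := lt_omega0_mul
    (show a < ω * ω₁ by rwa [(isPrincipal_mul_iff_mul_left_eq.1 (isPrincipal_mul_omega 1)) ω
      omega0_pos omega0_lt_omega_one])
  have hblock : ∀ c < b, _ := fun c hc => h.block (hc.trans hb) (isStage_of_le ha.1
    ((mul_le_mul_right (Order.add_one_le_of_lt hc) ω).trans le_self_add))
  obtain ⟨m', m₀, h1, h2, h3⟩ := h.exists_enters hb fun c hc => (hblock c hc).2
  refine haltsWith_of_stops (M := q.machine)
    (h.isStage_of_blocks fun c hc => (hblock c hc).1) h.starts h1 (h3.stops _ ?_)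
  -- the machine halts at a successor stage
  obtain ⟨j, rfl⟩ : ∃ j, i = j + 1 := by
    cases i with
    | succ j => exact ⟨j, rfl⟩
    | zero =>
      exfalso
      have h4 := ha.2
      rw [Nat.cast_zero, add_zero] at h4
      rcases eq_or_ne b 0 with rfl | hb0
      · rw [mul_zero, p.machine.run_zero] at h4
        cases h4
      · rw [machine_run_limit p x
          (isSuccLimit_mul_left isSuccLimit_omega0 (pos_iff_ne_zero.2 hb0))] at h4
        cases h4
  refine stops_mainLoop j h2 (fun e he => ?_) ?_
  · refine ha.1 _ ?_
    rw [add_assoc, add_lt_add_iff_left]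
    exact_mod_cast Nat.succ_lt_succ he
  · have h4 := ha.2
    rwa [Nat.cast_succ, ← add_assoc] at h4

/-- If the simulated computation does not halt, the simulation arrives at stage `ω₁`. -/
theorem Ready.exists_memory_omega_one (h : Ready q p x z t m) (hp : ¬ p.machine.Halts x) :
    q.machine.IsStage z ω₁ ∧ ∃ m', q.machine.run z ω₁ = ⟨CState.cardinal, 0, tapeOf z m'⟩ ∧
      core m' = stageCore p x ω₁ := by
  have hω : ω * ω₁ = ω₁ := isPrincipal_mul_iff_mul_left_eq.1 (isPrincipal_mul_omega 1) ω
    omega0_pos omega0_lt_omega_one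
  have ht : t + ω * ω₁ = ω₁ := by
    rw [hω]
    exact (isPrincipal_add_omega 1).add_eq_right h.lt
  have hblock : ∀ c < ω₁, _ := fun c hc => h.block hc (Machine.isStage_of_not_halts hp _)
  have h1 := h.isStage_of_blocks fun c hc => (hblock c hc).1
  obtain ⟨m', h2, h3⟩ := exists_memory_limit (omega_pos 1).ne' fun c hc => (hblock c hc).2
  rw [ht] at h1 h2
  rw [hω] at h3
  refine ⟨h1, m', ?_, h3⟩
  rw [run_limit_eq _ _ (Cardinal.isSuccLimit_omega 1), limitState_omega1, h2]

end Blocks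

/-! ### The decision procedures -/

section Decide

open Ordinal

variable {two stab : Bool} {z c x : Cantor}

theorem stops_atCardinal {n : ℕ} {p : Program n} {m : Memory} (h : core m = stageCore p x ω₁) :
    Stops z (atCardinal stab) 0 m (stab && !changedBelow p x ω₁) := by
  cases stab with
  | false => exact stops_halt
  | true =>
    have h1 : m Field.changed 0 = changedBelow p x ω₁ := by
      rw [← core_apply m (v := Field.changed) rfl, h]
      simp [stageCore, simCore]
    rw [atCardinal, if_pos rfl]
    refine stops_onBit ?_
    rw [h1]
    cases changedBelow p x ω₁ with
    | true => exact stops_halt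
    | false => exact stops_accept (hasCode_of_core rfl h).left 0

/-- What is asked for: whether `c` codes a program that halts on input `x` or, if `stab` is `true`,
whose output stabilizes. -/
def Answer (stab : Bool) (c x : Cantor) : Prop :=
  ∃ (n : ℕ) (p : Program n), c = p.code ∧
    (p.machine.Halts x ∨ stab = true ∧ p.machine.Stabilizes x)

theorem answer_iff {n : ℕ} {p : Program n} :
    Answer stab p.code x ↔ p.machine.Halts x ∨ stab = true ∧ p.machine.Stabilizes x := by
  constructor
  · rintro ⟨n', p', h1, h2⟩
    obtain ⟨rfl, h3⟩ := Program.code_injective h1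
    rwa [eq_of_heq h3]
  · exact fun h => ⟨n, p, rfl, h⟩

open Classical in
/-- The machine that copies its input, simulates the coded program, and reads off the answer in the
cardinal state. The flag `two` says that the input is a pair. -/
theorem haltsWith_answer {Q : Type} {q : CProgram Q}
    (hstart : Starts q CState.halt (copy two) CState.start)
    (hlimit : Starts q CState.halt atLimit CState.limit)
    (hcardinal : Starts q CState.halt (atCardinal stab) CState.cardinal)
    (hc : ∀ k, z (stride two * k) = c k) (hx : ∀ k, (two && z (2 * k + 1)) = x k) :
    q.machine.HaltsWith z fun k => decide (k = 0 ∧ Answer stab c x) := by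
  -- it suffices to halt with a bit that is the answer
  have hout : ∀ b : Bool, (b = true ↔ Answer stab c x) →
      (q.machine.HaltsWith z fun k => decide (k = 0 ∧ b = true)) →
      q.machine.HaltsWith z fun k => decide (k = 0 ∧ Answer stab c x) := by
    intro b hb h
    simpa only [hb] using h
  have hreject : (∀ n (p : Program n), c ≠ p.code) →
      (q.machine.HaltsWith z fun k => decide (k = 0 ∧ false = true)) →
      q.machine.HaltsWith z fun k => decide (k = 0 ∧ Answer stab c x) := fun hno =>
    hout false (by simpa using fun ⟨n, p, h, _⟩ => hno n p h)
  have hformat : ¬ Formatted c → ∀ n (p : Program n), c ≠ p.code := fun hno n p h =>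
    hno (h ▸ formatted_code p)
  -- stage `ω`
  obtain ⟨s₁, t₁⟩ := copy_limit (M := q.machine) hstart hc hx
  have e₁ : q.machine.run z ω = ⟨CState.limit, 0, tapeOf z (initMem c x)⟩ := by
    rw [run_limit_eq _ _ isSuccLimit_omega0, limitState_of_lt q omega0_lt_omega_one, t₁]
  have hlt : ∀ {a : Ordinal.{0}}, a < ω₁ → a + ω < ω₁ := fun ha =>
    isPrincipal_add_omega 1 ha omega0_lt_omega_one
  have hlt₂ := hlt omega0_lt_omega_one
  rcases cases_scanPhase (z := z) (core_initMem c x) with ⟨⟨_, d⟩, hform⟩ | ⟨h1, h2⟩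
  swap
  · exact hreject (hformat h2) (haltsWith_of_stops (M := q.machine) s₁ hlimit e₁ h1)
  -- stage `ω + ω`
  obtain ⟨s₂, r, hr⟩ := isStage_of_diverge (M := q.machine) s₁ hlimit e₁ d
  obtain ⟨m, t₂, c₂⟩ := exists_memory_of_rounds hr fun i T h => h
  have e₂ : q.machine.run z (ω + ω) = ⟨CState.limit, 0, tapeOf z m⟩ := by
    rw [run_limit_eq _ _ (isSuccLimit_add_omega _), limitState_of_lt q hlt₂, t₂]
  rcases cases_checkPhase (z := z) c₂ hform with
    ⟨⟨_, d⟩, h2⟩ | ⟨h1, h2⟩ | ⟨n, p, m₀, rfl, h1, h2⟩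
  · obtain ⟨s₃, r, hr⟩ := isStage_of_diverge (M := q.machine) s₂ hlimit e₂ d
    obtain ⟨m', t₃, c₃⟩ := exists_memory_of_rounds hr fun i T h => h
    have e₃ : q.machine.run z (ω + ω + ω) = ⟨CState.limit, 0, tapeOf z m'⟩ := by
      rw [run_limit_eq _ _ (isSuccLimit_add_omega _), limitState_of_lt q (hlt hlt₂), t₃]
    refine hreject (hformat h2) (haltsWith_of_stops (M := q.machine) s₃ hlimit e₃ (stops_atLimit ?_))
    obtain ⟨f1, f2, f3⟩ := flags_of_core c₃
    rw [f1, f2, f3]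
    exact stops_halt
  · exact hreject h2 (haltsWith_of_stops (M := q.machine) s₂ hlimit e₂ h1)
  -- the simulation
  have ready : Ready q p x z (ω + ω) m :=
    ⟨hlt₂, isSuccLimit_add_omega _, hlimit, s₂, t₂, m₀, h1, h2⟩
  by_cases hp : p.machine.Halts x
  · exact hout true (by simp [answer_iff, hp]) (ready.haltsWith_of_halts hp)
  · obtain ⟨s, m', e, hm'⟩ := ready.exists_memory_omega_one hp
    refine hout _ ?_ (haltsWith_of_stops (M := q.machine) s hcardinal e (stops_atCardinal hm'))
    rw [answer_iff, stabilizes_iff hp]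
    simp [hp]

theorem finite_pt_sum (A B C : Code) : Finite (A.Pt ⊕ (B.Pt ⊕ C.Pt)) := by
  have := A.finite_pt
  have := B.finite_pt
  have := C.finite_pt
  infer_instance

open Classical in
theorem decidable_of_answer {A : Set Cantor} (two stab : Bool) (c x : Cantor → Cantor)
    (hc : ∀ z k, z (stride two * k) = c z k) (hx : ∀ z k, (two && z (2 * k + 1)) = x z k)
    (hA : ∀ z, z ∈ A ↔ Answer stab (c z) (x z)) : DecidableSet A := by
  refine ⟨_, finite_pt_sum (copy two) atLimit (atCardinal stab), assemble _ _ _, fun z => ?_⟩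
  have h := haltsWith_answer (starts_start (copy two) atLimit (atCardinal stab))
    (starts_limit ..) (starts_cardinal ..) (hc z) (hx z)
  have : charFun A z = fun k => decide (k = 0 ∧ Answer stab (c z) (x z)) := by
    funext k
    simp only [charFun, hA]
  rwa [this]

/-- Every real is the code of a pair. -/
theorem eq_pair_iff {z y x : Cantor} :
    z = pair y x ↔ (fun k => z (2 * k)) = y ∧ (fun k => z (2 * k + 1)) = x := by
  have h : z = pair (fun k => z (2 * k)) fun k => z (2 * k + 1) := by
    funext k
    simp only [pair]
    split
    · congr 1; omega
    · congr 1; omega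
  constructor
  · intro h'
    exact pair_injective (h.symm.trans h')
  · rintro ⟨rfl, rfl⟩
    exact h

end Decide

end CRITTM

theorem mainTheorem2 :
    CRITTM.DecidableSet CRITTM.weakHalting ∧
      CRITTM.DecidableSet CRITTM.strongHalting ∧
      CRITTM.DecidableSet CRITTM.stabilization := by
  open CRITTM in
  refine ⟨decidable_of_answer false false (fun z => z) (fun _ _ => false) ?_ ?_ ?_,
    decidable_of_answer true false (fun z k => z (2 * k)) (fun z k => z (2 * k + 1)) ?_ ?_ ?_,
    decidable_of_answer true true (fun z k => z (2 * k)) (fun z k => z (2 * k + 1)) ?_ ?_ ?_⟩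
  · intro z k
    simp [stride]
  · intro z k
    rfl
  · intro z
    simp [weakHalting, Answer]
  · intro z k
    rfl
  · intro z k
    rfl
  · intro z
    simp only [strongHalting, Answer, eq_pair_iff, Set.mem_ofPred_eq]
    refine exists₂_congr fun n p => ?_
    simp
  · intro z k
    rfl
  · intro z k
    rfl
  · intro z
    simp only [stabilization, Answer, eq_pair_iff, Set.mem_ofPred_eq]
    refine exists₂_congr fun n p => ?_
    simpa using fun _ h => Machine.stabilizes_of_halts h
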